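/- **Setting.** For $\alpha\in\{0,1\}^3$ a real function $f$ on $\mathbb R^3$ has symmetry $Tf=\alpha$ if it has the same reflection symmetries as the monomial $x^\alpha$, i.e. $f((-1)^{\beta_1}x_1,(-1)^{\beta_2}x_2,(-1)^{\beta_3}x_3)=(-1)^{\alpha\cdot\beta}f(x)$ for all $\beta\in\{0,1\}^3$ and a.e. $x$ (the zero function has every symmetry). A real vector field $v=(v_1,v_2,v_3)$ has symmetry type $T(v)=(\alpha_1,\alpha_2,\alpha_3)$ if $Tv_l=\alpha_l$ for $l=1,2,3$. Let $e_1,e_2,e_3$ be the standard unit vectors. Write $\mathbb P\nabla(u\otimes v)=\sum_j\partial_j(u_jv)+(-\Delta)^{-1}\nabla\sum_{j,k}\partial_j\partial_k(u_jv_k)$ and $B(u,v)(t)=\int_0^t e^{(t-s)\Delta}\mathbb P\nabla(u\otimes v)(s)\,ds$. Let $u_0$ be a real divergence-free vector field on $\mathbb R^3$ with $\int|u_0|^2(1+|x|)^{-4}dx<\infty$. A (global) real mild solution of the Navier–Stokes equations with initial datum $u_0$ is a real field $u(t,x)$ with $u(0)=u_0$ and $\operatorname{div}u(t)=0$ for all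 $t\ge 0$, which satisfies $u(t)=e^{t\Delta}u_0-B(u,u)(t)$ for $t>0$ and is the limit, in the sense of tempered distributions at each time $t>0$, of the iterates $u^{0}=e^{t\Delta}u_0$, $u^{\tau+1}=u^0-B(u^\tau,u^\tau)$. Here $v=u$ and all iterates $v=u^\tau$ are required to be measurable on $(0,\infty)\times\mathbb R^3$, to satisfy $\int|v(t,x)|^2(1+|x|)^{-4}dx<\infty$ for each $t>0$ and $\int_0^T\!\int|v|^2(1+|x|)^{-4}dx\,dt<\infty$ for each $T>0$, and to be such that, for each $t>0$ and a.e. $x$, the integrals over $(0,t)\times\mathbb R^3$ defining $B(v,v)(t,x)$ through the kernel of $e^{(t-s)\Delta}\mathbb P\nabla$ converge absolutely. **Theorem.** Let $u$ be a real mild solution with initial datum $u_0$, where $u_0$ has some symmetry type. Assume that $u$ is not two-and-a-half dimensional, in the following sense: for every $t\ge0$ and $l\in\{1,2,3\}$, if $u_l(t,\cdot)$ is not identically zero, then every component of $u(t,\cdot)$ that does not depend on the variable $x_l$ is constant. (This holds, for instance, if each $u(t,\cdot)$ is the sum of a constant vector and a field in $L^p(\mathbb R^3)$ with $p<\infty$.)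 Then $u$ has the same symmetry type for all $t\ge0$, that is, there are $\alpha_1,\alpha_2,\alpha_3\in\{0,1\}^3$ with $T(u(t,\cdot))=(\alpha_1,\alpha_2,\alpha_3)$ for all $t\ge0$, if and only if one of the following holds: (i) $T(u_0)=(e_1,e_2,e_3)$; (ii) $\operatorname{div}u_0=0$ and $\mathbb P\nabla(e^{t\Delta}u_0\otimes e^{t\Delta}u_0)=0$ in the sense of tempered distributions for all $t>0$. -/

import Mathlib

open MeasureTheory Filter Topology
open scoped SchwartzMap

noncomputable section

namespace NavierStokes

/-- Euclidean three-space. -/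
abbrev E3 : Type := EuclideanSpace ℝ (Fin 3)

/-! ### Reflection symmetries -/

/-- The reflection `x ↦ ((-1)^β₁ x₁, (-1)^β₂ x₂, (-1)^β₃ x₃)`. -/
def reflect (β : Fin 3 → ZMod 2) (x : E3) : E3 :=
  WithLp.toLp 2 (fun i => (-1 : ℝ) ^ (β i).val * x i)

/-- The factor picked up by the monomial `x^α` under `reflect β`. -/
def reflectSign (α β : Fin 3 → ZMod 2) : ℝ :=
  ∏ i, (-1 : ℝ) ^ ((α i).val * (β i).val)

/-- `T f = α`: the real function `f` has the same reflection symmetry as the monomial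
`x^α = x₁^α₁ x₂^α₂ x₃^α₃`. Functions are identified when they agree almost everywhere; the zero
function has every symmetry. -/
def HasSymmetry (f : E3 → ℝ) (α : Fin 3 → ZMod 2) : Prop :=
  ∀ β : Fin 3 → ZMod 2, ∀ᵐ x : E3, f (reflect β x) = reflectSign α β * f x

/-- `T v = (α 0, α 1, α 2)`: componentwise symmetry type of a real vector field. -/
def HasSymmetryType (v : E3 → E3) (α : Fin 3 → Fin 3 → ZMod 2) : Prop :=
  ∀ l, HasSymmetry (fun x => v x l) (α l)

/-- The symmetry type `(e₁, e₂, e₃)`. -/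
def basicType : Fin 3 → Fin 3 → ZMod 2 := fun l => Pi.single l 1

/-! ### Heat semigroup, inverse Laplacian and Leray projection -/

/-- The partial derivative `∂_j f`. -/
def partialDeriv (j : Fin 3) (f : E3 → ℝ) (x : E3) : ℝ :=
  fderiv ℝ f x (EuclideanSpace.single j 1)

/-- The Gauss kernel `(4 π t)^(-3/2) exp(-|x|² / (4 t))`, for `t > 0`. -/
def heatKernel (t : ℝ) (x : E3) : ℝ :=
  (4 * Real.pi * t) ^ (-(3 / 2) : ℝ) * Real.exp (-(‖x‖ ^ 2) / (4 * t))

/-- `e^{tΔ} f`, for a scalar function `f` and `t > 0`. -/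
def heat (t : ℝ) (f : E3 → ℝ) (x : E3) : ℝ :=
  ∫ y, heatKernel t (x - y) * f y

/-- `e^{tΔ} v`, for a vector field `v` and `t > 0`. -/
def heatVec (t : ℝ) (v : E3 → E3) (x : E3) : E3 :=
  WithLp.toLp 2 (fun l => heat t (fun y => v y l) x)

/-- `(-Δ)⁻¹ f`, the Newtonian potential of `f` on three-space. -/
def invNegLaplacian (f : E3 → ℝ) (x : E3) : ℝ :=
  ∫ y, (1 / (4 * Real.pi * ‖x - y‖)) * f y

/-- For a smooth rapidly decreasing `φ`, the function
`δ_{kl} ∂_j φ + (-Δ)⁻¹ ∂_j ∂_k ∂_l φ`. It is the symbol of the bilinear term: the `l`-th component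
of `ℙ∇(u ⊗ v) = ∑_j ∂_j (u_j v) + (-Δ)⁻¹ ∇ ∑_{j,k} ∂_j ∂_k (u_j v_k)` is
`∑_{j,k} (δ_{kl} ∂_j + (-Δ)⁻¹ ∂_j ∂_k ∂_l) (u_j v_k)`. -/
def lerayDeriv (j k l : Fin 3) (φ : E3 → ℝ) (x : E3) : ℝ :=
  (if k = l then partialDeriv j φ x else 0) +
    invNegLaplacian (partialDeriv j (partialDeriv k (partialDeriv l φ))) x

/-- The tempered distribution `ℙ∇(u ⊗ v)`, `l`-th component, paired with a test function `φ`. The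
operator `δ_{kl} ∂_j + (-Δ)⁻¹ ∂_j ∂_k ∂_l` is skew-adjoint, whence the minus sign. The integrals
converge absolutely when `u` and `v` are square integrable against the weight `(1 + |x|)⁻⁴`. -/
def lerayBilinear (u v : E3 → E3) (l : Fin 3) (φ : 𝓢(E3, ℝ)) : ℝ :=
  -∑ j, ∑ k, ∫ x, u x j * v x k * lerayDeriv j k l (fun y => φ y) x

/-- The kernel of `e^{tΔ} (δ_{kl} ∂_j + (-Δ)⁻¹ ∂_j ∂_k ∂_l)`, for `t > 0`. -/
def oseenKernel (j k l : Fin 3) (t : ℝ) : E3 → ℝ :=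
  lerayDeriv j k l (heatKernel t)

/-- `B(u, v)(t, x) = ∫₀ᵗ e^{(t-s)Δ} ℙ∇(u ⊗ v)(s, x) ds`. -/
def duhamel (u v : ℝ → E3 → E3) (t : ℝ) (x : E3) : E3 :=
  WithLp.toLp 2 (fun l => ∑ j, ∑ k, ∫ s in Set.Ioo 0 t, ∫ y,
    oseenKernel j k l (t - s) (x - y) * (u s y j * v s y k))

/-! ### Mild solutions -/

/-- The iterates `u⁰ = e^{tΔ} u₀`, `u^{τ+1} = u⁰ - B(u^τ, u^τ)`. -/
def picard (u₀ : E3 → E3) : ℕ → ℝ → E3 → E3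
  | 0 => fun t => heatVec t u₀
  | n + 1 => fun t x => heatVec t u₀ x - duhamel (picard u₀ n) (picard u₀ n) t x

/-- `div v = 0` in the sense of tempered distributions. -/
def IsSolenoidal (v : E3 → E3) : Prop :=
  ∀ φ : 𝓢(E3, ℝ), ∫ x, ∑ l, v x l * partialDeriv l (fun y => φ y) x = 0

/-- Vector fields that are square integrable against the weight `(1 + |x|)⁻⁴`. This contains
the fields in `L^p` for `2 ≤ p ≤ ∞`, in particular `Ḣ^{1/2}`. -/
structure WeightedL2 (v : E3 → E3) : Prop where
  aestronglyMeasurable : AEStronglyMeasurable v volume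
  integrable : Integrable (fun x => ‖v x‖ ^ 2 / (1 + ‖x‖) ^ 4)

/-- The time dependent vector fields `v` for which `B(v, v)` makes sense as an absolutely
convergent integral. -/
structure InPathSpace (v : ℝ → E3 → E3) : Prop where
  aestronglyMeasurable : AEStronglyMeasurable (fun p : ℝ × E3 => v p.1 p.2)
    ((volume.restrict (Set.Ioi 0)).prod volume)
  weightedL2 : ∀ t, 0 < t → WeightedL2 (v t)
  integrable : ∀ t, 0 < t → Integrable (fun p : ℝ × E3 => ‖v p.1 p.2‖ ^ 2 / (1 + ‖p.2‖) ^ 4)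
    ((volume.restrict (Set.Ioo 0 t)).prod volume)
  duhamel_integrable : ∀ t, 0 < t → ∀ᵐ x : E3, ∀ j k l : Fin 3,
    Integrable (fun p : ℝ × E3 =>
      oseenKernel j k l (t - p.1) (x - p.2) * (v p.1 p.2 j * v p.1 p.2 k))
      ((volume.restrict (Set.Ioo 0 t)).prod volume)

/-- `u` is a (global, real valued) mild solution of the Navier-Stokes equations on three-space with
initial datum `u₀`: a divergence free solution of `u = e^{tΔ} u₀ - B(u, u)` which is the limit of
the iterates `picard u₀ τ`. Only the weakest mode of convergence is asked for, that of tempered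
distributions at each time. -/
structure IsMildSolution (u₀ : E3 → E3) (u : ℝ → E3 → E3) : Prop where
  data_weightedL2 : WeightedL2 u₀
  data_solenoidal : IsSolenoidal u₀
  initial : u 0 =ᵐ[volume] u₀
  inPathSpace : InPathSpace u
  solenoidal : ∀ t, 0 < t → IsSolenoidal (u t)
  integral_equation : ∀ t, 0 < t →
    u t =ᵐ[volume] fun x => heatVec t u₀ x - duhamel u u t x
  picard_inPathSpace : ∀ n, InPathSpace (picard u₀ n)
  picard_tendsto : ∀ t, 0 < t → ∀ (l : Fin 3) (φ : 𝓢(E3, ℝ)),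
    Tendsto (fun n => ∫ x, picard u₀ n t x l * φ x) atTop (𝓝 (∫ x, u t x l * φ x))

/-- `u₀` is of Beltrami type: `div u₀ = 0` and `ℙ∇(e^{tΔ} u₀ ⊗ e^{tΔ} u₀) = 0` for all `t > 0`, as
tempered distributions. -/
def IsBeltramiType (u₀ : E3 → E3) : Prop :=
  IsSolenoidal u₀ ∧ ∀ t, 0 < t → ∀ (l : Fin 3) (φ : 𝓢(E3, ℝ)),
    lerayBilinear (heatVec t u₀) (heatVec t u₀) l φ = 0

/-! ### Flows that degenerate to two dimensions -/

/-- `f` does not depend on the variable `x_l`. -/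
def IndependentOf (f : E3 → ℝ) (l : Fin 3) : Prop :=
  ∀ h : ℝ, ∀ᵐ x : E3, f (x + EuclideanSpace.single l h) = f x

/-- `f` is a constant function. -/
def IsConstant (f : E3 → ℝ) : Prop :=
  ∃ c : ℝ, ∀ᵐ x : E3, f x = c

/-- Whenever the component `v_l` does not vanish identically, every component of `v` that does not
depend on `x_l` is constant. This excludes the two-and-a-half dimensional fields
`v(x) = (v₁(x₁, x₂), v₂(x₁, x₂), v₃(x₁, x₂))` with `v₃ ≠ 0`. It holds if `v` is the sum of a constant
vector and a field in `L^p`, `p < ∞`, or a planar field with `v₃ = 0` whose components `v₁, v₂`,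
unless constant, depend on both `x₁` and `x₂`. -/
def NotTwoAndHalfDimensional (v : E3 → E3) : Prop :=
  ∀ l : Fin 3, (¬ ∀ᵐ x : E3, v x l = 0) →
    ∀ k : Fin 3, IndependentOf (fun x => v x k) l → IsConstant (fun x => v x k)

end NavierStokes

end

/-!
A field with symmetry type `α` has the defects `γ_l = α_l + e_l`, and the product `u_j u_k`
contributes to the `l`-th component of `B(u, u)` a function of symmetry `e_l + γ_j + γ_k`. In the
integral equation for `u_l` every other term has symmetry `e_l + γ_l`, so the characters of the
reflection group separate the contributions: those with `γ_j + γ_k = δ` add up to zero for every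
`δ ≠ γ_l`.

If all defects vanish, the type is the basic one. If they agree and do not vanish, then
`B(u, u) = 0`; hence `u(t) = e^{tΔ} u₀`, and differentiating the Duhamel integral in time gives
`ℙ∇(u ⊗ u) = 0`. If `γ_r` differs from the other two defects, then `∂_r u_r` and the other `∂_l u_l`
have different symmetries, so that `div u = 0` gives `∂_r u_r = 0`, and `u_r = c(t)` because `u` is
not two-and-a-half dimensional. The products of `u_r` with the other components contribute
`c ∂_r u_l` to component `l`. Wherever this contribution has to vanish while `c ≠ 0`, the field is
constant in space; otherwise the separation of symmetries again gives `B(u, u) = 0` or the basic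
type.

Conversely, the Picard iterates inherit the basic symmetry type, and for Beltrami data they are all
equal to `e^{tΔ} u₀`; both facts pass to the limit.
-/

noncomputable section

open scoped LineDeriv Real

namespace NavierStokes

/-! ### The weight -/

section BracketWeight

variable {E F : Type*} [NormedAddCommGroup E] [NormedAddCommGroup F]

/-- The weight `⟨x⟩⁻⁴ = (1 + |x|²)⁻²`: a smooth substitute for the weight `(1 + |x|)⁻⁴` of
`WeightedL2`, for which the decay of the Oseen kernel takes a convenient form. -/
def bracketWeight (x : E) : ℝ := ((1 + ‖x‖ ^ 2) ^ 2)⁻¹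

lemma bracketWeight_pos (x : E) : 0 < bracketWeight x := by
  unfold bracketWeight; positivity

lemma bracketWeight_nonneg (x : E) : 0 ≤ bracketWeight x := (bracketWeight_pos x).le

lemma bracketWeight_le_one (x : E) : bracketWeight x ≤ 1 :=
  inv_le_one_of_one_le₀ (one_le_pow₀ (le_add_of_nonneg_right (sq_nonneg _)))

lemma bracketWeight_neg (x : E) : bracketWeight (-x) = bracketWeight x := by
  simp [bracketWeight]

lemma continuous_bracketWeight : Continuous (bracketWeight : E → ℝ) :=
  Continuous.inv₀ (by fun_prop) fun x => by positivity

lemma one_add_norm_sq_le_mul (x y : E) :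
    1 + ‖x‖ ^ 2 ≤ 2 * (1 + ‖y‖ ^ 2) * (1 + ‖x - y‖ ^ 2) := by
  have htri : ‖x‖ ≤ ‖x - y‖ + ‖y‖ := by simpa using norm_add_le (x - y) y
  have hsq : ‖x‖ ^ 2 ≤ (‖x - y‖ + ‖y‖) ^ 2 := by gcongr
  nlinarith [sq_nonneg (‖x - y‖ - ‖y‖), mul_nonneg (sq_nonneg ‖x - y‖) (sq_nonneg ‖y‖)]

lemma bracketWeight_sub_le (x y : E) :
    bracketWeight (x - y) ≤ 4 * (1 + ‖y‖ ^ 2) ^ 2 * bracketWeight x := by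
  have hsq : (1 + ‖x‖ ^ 2) ^ 2 ≤ (2 * (1 + ‖y‖ ^ 2) * (1 + ‖x - y‖ ^ 2)) ^ 2 :=
    pow_le_pow_left₀ (by positivity) (one_add_norm_sq_le_mul x y) 2
  unfold bracketWeight
  rw [← div_eq_mul_inv, inv_eq_one_div, div_le_div_iff₀ (by positivity) (by positivity)]
  linarith

lemma norm_sq_mul_bracketWeight_le (a : F) (x : E) :
    ‖a‖ ^ 2 * bracketWeight x ≤ 4 * (‖a‖ ^ 2 / (1 + ‖x‖) ^ 4) := by
  have hsq : (1 + ‖x‖) ^ 2 ≤ 2 * (1 + ‖x‖ ^ 2) := by nlinarith [sq_nonneg (1 - ‖x‖)]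
  have hfour : (1 + ‖x‖) ^ 4 ≤ 4 * (1 + ‖x‖ ^ 2) ^ 2 := by
    nlinarith [pow_le_pow_left₀ (by positivity) hsq 2]
  unfold bracketWeight
  rw [← div_eq_mul_inv, ← mul_div_assoc, div_le_div_iff₀ (by positivity) (by positivity)]
  linarith [mul_le_mul_of_nonneg_left hfour (sq_nonneg ‖a‖)]

lemma integrable_bracketWeight [NormedSpace ℝ E] [FiniteDimensional ℝ E] [MeasurableSpace E]
    [BorelSpace E] (μ : Measure E) [μ.IsAddHaarMeasure] (hE : Module.finrank ℝ E < 4) :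
    Integrable (bracketWeight : E → ℝ) μ := by
  refine (integrable_rpow_neg_one_add_norm_sq (r := 4) (by exact_mod_cast hE)).congr
    (Eventually.of_forall fun x => ?_)
  have hpos : (0 : ℝ) ≤ 1 + ‖x‖ ^ 2 := by positivity
  simp only [bracketWeight]
  rw [show (-4 / 2 : ℝ) = -((2 : ℕ) : ℝ) by norm_num, Real.rpow_neg hpos, Real.rpow_natCast]

end BracketWeight

/-! ### Gaussians and convolutions of Schwartz functions -/

lemma one_add_pow_mul_exp_neg_mul_sq_le {b : ℝ} (hb : 0 < b) (m : ℕ) {r : ℝ} (hr : 0 ≤ r) :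
    (1 + r) ^ m * Real.exp (-b * r ^ 2) ≤ m.factorial / b ^ m * Real.exp (2 * b) := by
  have hpow : (b * (1 + r)) ^ m ≤ m.factorial * Real.exp (b * (1 + r)) := by
    rw [← div_le_iff₀' (by positivity)]
    exact Real.pow_div_factorial_le_exp _ (by positivity) m
  have hexp : b * (1 + r) ≤ 2 * b + b * r ^ 2 := by nlinarith [sq_nonneg (r - 1)]
  calc (1 + r) ^ m * Real.exp (-b * r ^ 2)
      = (b * (1 + r)) ^ m / b ^ m * Real.exp (-b * r ^ 2) := by rw [mul_pow]; field_simp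
    _ ≤ m.factorial * Real.exp (2 * b + b * r ^ 2) / b ^ m * Real.exp (-b * r ^ 2) := by
      gcongr; exact hpow.trans (by gcongr)
    _ = m.factorial / b ^ m * Real.exp (2 * b) := by
      rw [Real.exp_add, neg_mul, Real.exp_neg]; field_simp

section GaussianSchwartz

variable {V : Type*} [NormedAddCommGroup V] [InnerProductSpace ℝ V]

lemma norm_iteratedFDeriv_exp (n : ℕ) (s : ℝ) :
    ‖iteratedFDeriv ℝ n Real.exp s‖ = Real.exp s := by
  rw [norm_iteratedFDeriv_eq_norm_iteratedDeriv, iteratedDeriv_eq_iterate, Real.iter_deriv_exp,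
    Real.norm_eq_abs, abs_of_pos (Real.exp_pos _)]

lemma exists_norm_iteratedFDeriv_exp_comp_le {g : V → ℝ} (hg : g.HasTemperateGrowth) (n : ℕ) :
    ∃ (m : ℕ) (C : ℝ), 0 ≤ C ∧ ∀ x,
      ‖iteratedFDeriv ℝ n (Real.exp ∘ g) x‖ ≤ C * (1 + ‖x‖) ^ m * Real.exp (g x) := by
  obtain ⟨l, C, hC, hgrowth⟩ := hg.norm_iteratedFDeriv_le_uniform n
  refine ⟨l * n, n.factorial * (C + 1) ^ n, by positivity, fun x => ?_⟩
  have hgrowth_pow : ∀ N : ℕ, 1 ≤ N → N ≤ n →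
      ‖iteratedFDeriv ℝ N g x‖ ≤ ((C + 1) * (1 + ‖x‖) ^ l) ^ N := fun N hN hNn =>
    calc ‖iteratedFDeriv ℝ N g x‖ ≤ C * (1 + ‖x‖) ^ l := hgrowth N hNn x
      _ ≤ (C + 1) * (1 + ‖x‖) ^ l := by gcongr; linarith
      _ ≤ ((C + 1) * (1 + ‖x‖) ^ l) ^ N := by
        refine le_self_pow₀ (one_le_mul_of_one_le_of_one_le (by linarith) ?_) (by lia)
        exact one_le_pow₀ (by linarith [norm_nonneg x])
  refine (norm_iteratedFDeriv_comp_le (N := (⊤ : ℕ∞)) Real.contDiff_exp hg.1 (mod_cast le_top) x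
    (fun i _ => (norm_iteratedFDeriv_exp i _).le) hgrowth_pow).trans_eq ?_
  rw [mul_pow, ← pow_mul]
  ring

/-- The Gaussian `exp (-b |x|²)`, `b > 0`, as a Schwartz function. -/
def gaussianSchwartz {b : ℝ} (hb : 0 < b) : 𝓢(V, ℝ) where
  toFun := Real.exp ∘ fun x => -b * ‖x‖ ^ 2
  smooth' := Real.contDiff_exp.comp (contDiff_const.mul (contDiff_norm_sq ℝ))
  decay' k n := by
    obtain ⟨m, C, hC, hbound⟩ := exists_norm_iteratedFDeriv_exp_comp_le
      (g := fun x : V => -b * ‖x‖ ^ 2) (by fun_prop) n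
    refine ⟨C * ((k + m).factorial / b ^ (k + m) * Real.exp (2 * b)), fun x => ?_⟩
    calc ‖x‖ ^ k * ‖iteratedFDeriv ℝ n (Real.exp ∘ fun x => -b * ‖x‖ ^ 2) x‖
        ≤ (1 + ‖x‖) ^ k * (C * (1 + ‖x‖) ^ m * Real.exp (-b * ‖x‖ ^ 2)) := by
          gcongr
          · linarith
          · exact hbound x
      _ = C * ((1 + ‖x‖) ^ (k + m) * Real.exp (-b * ‖x‖ ^ 2)) := by ring
      _ ≤ C * ((k + m).factorial / b ^ (k + m) * Real.exp (2 * b)) :=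
          mul_le_mul_of_nonneg_left
            (one_add_pow_mul_exp_neg_mul_sq_le hb (k + m) (norm_nonneg x)) hC

end GaussianSchwartz

section SchwartzConv

variable {V : Type*} [NormedAddCommGroup V] [NormedSpace ℝ V]

lemma fderiv_comp_const_sub (f : V → ℝ) (x y : V) :
    fderiv ℝ (fun z => f (x - z)) y = -fderiv ℝ f (x - y) := by
  have hcomp : (fun z => f (x - z)) =
      (fun w => f (x + w)) ∘ (ContinuousLinearEquiv.neg ℝ (M := V)) := by
    funext z; simp [sub_eq_add_neg]
  rw [hcomp, ContinuousLinearEquiv.comp_right_fderiv, fderiv_comp_add_left]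
  ext v
  simp [sub_eq_add_neg]

/-- The Schwartz function `y ↦ φ (x - y)`, through which the values of a convolution are written as
pairings with a test function. -/
def compConstSub (x : V) (φ : 𝓢(V, ℝ)) : 𝓢(V, ℝ) :=
  SchwartzMap.compCLMOfAntilipschitz (g := fun y => x - y) (K := 1) ℝ (by fun_prop)
    (fun _ _ => by simp [edist_dist, dist_eq_norm, norm_sub_rev]) φ

variable [FiniteDimensional ℝ V] [MeasureSpace V] [BorelSpace V]
  [(volume : Measure V).IsAddHaarMeasure]

/-- The convolution of two Schwartz functions. -/
def schwartzConv (φ ψ : 𝓢(V, ℝ)) (x : V) : ℝ := ∫ y, φ (x - y) * ψ y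

lemma schwartzConv_comm (φ ψ : 𝓢(V, ℝ)) (x : V) :
    schwartzConv φ ψ x = schwartzConv ψ φ x := by
  unfold schwartzConv
  rw [← integral_sub_left_eq_self _ volume x]
  simp [mul_comm]

lemma integrable_smul_comp_sub {F : Type*} [NormedAddCommGroup F] [NormedSpace ℝ F]
    (φ : 𝓢(V, F)) (ψ : 𝓢(V, ℝ)) (x : V) : Integrable (fun y => ψ y • φ (x - y)) :=
  (ψ.integrable (μ := volume)).smul_bdd _
    (φ.continuous.comp (by fun_prop)).aestronglyMeasurable
    (Eventually.of_forall fun y => φ.norm_le_seminorm ℝ (x - y))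

lemma hasFDerivAt_schwartzConv (φ ψ : 𝓢(V, ℝ)) (x : V) :
    HasFDerivAt (schwartzConv φ ψ) (∫ y, ψ y • fderiv ℝ φ (x - y)) x := by
  let φ' := SchwartzMap.fderivCLM ℝ V ℝ φ
  refine hasFDerivAt_integral_of_dominated_of_fderiv_le (s := Set.univ)
    (F := fun x y => φ (x - y) * ψ y) (F' := fun x y => ψ y • fderiv ℝ φ (x - y))
    (bound := fun y => SchwartzMap.seminorm ℝ 0 0 φ' * ‖ψ y‖) univ_mem
    (Eventually.of_forall fun x => ?_) ?_ ?_ ?_ (ψ.integrable.norm.const_mul _) ?_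
  · exact (φ.continuous.comp (by fun_prop)).mul ψ.continuous |>.aestronglyMeasurable
  · simpa only [smul_eq_mul, mul_comm] using integrable_smul_comp_sub φ ψ x
  · exact (ψ.continuous.smul (φ'.continuous.comp (by fun_prop))).aestronglyMeasurable
  · refine Eventually.of_forall fun y x _ => ?_
    rw [norm_smul, mul_comm]
    gcongr
    exact φ'.norm_le_seminorm ℝ (x - y)
  · refine Eventually.of_forall fun y x _ => ?_
    simpa using ((φ.hasFDerivAt (x - y)).comp x ((hasFDerivAt_id x).sub_const y)).mul_const (ψ y)

lemma fderiv_schwartzConv_apply (φ ψ : 𝓢(V, ℝ)) (x v : V) :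
    fderiv ℝ (schwartzConv φ ψ) x v = schwartzConv (∂_{v} φ) ψ x := by
  have hint : Integrable (fun y => ψ y • fderiv ℝ φ (x - y)) :=
    integrable_smul_comp_sub (SchwartzMap.fderivCLM ℝ V ℝ φ) ψ x
  rw [(hasFDerivAt_schwartzConv φ ψ x).fderiv, ContinuousLinearMap.integral_apply hint]
  simp only [schwartzConv, SchwartzMap.lineDerivOp_apply_eq_fderiv, smul_apply, smul_eq_mul,
    mul_comm]

end SchwartzConv

/-! ### The heat kernel -/

/-- The unit vector in direction `j`. -/
abbrev basisVec (j : Fin 3) : E3 := EuclideanSpace.single j 1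

/-- The partial derivative of a Schwartz function, again as a Schwartz function. -/
def schwartzPartial (j : Fin 3) (φ : 𝓢(E3, ℝ)) : 𝓢(E3, ℝ) := ∂_{basisVec j} φ

lemma coe_schwartzPartial (j : Fin 3) (φ : 𝓢(E3, ℝ)) :
    ⇑(schwartzPartial j φ) = partialDeriv j φ :=
  funext fun _ => SchwartzMap.lineDerivOp_apply_eq_fderiv _ _ _

lemma partialDeriv_comp_sub (j : Fin 3) (f : E3 → ℝ) (x y : E3) :
    partialDeriv j (fun z => f (x - z)) y = -partialDeriv j f (x - y) := by
  simp only [partialDeriv, fderiv_comp_const_sub, neg_apply]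

lemma partialDeriv_schwartzConv (j : Fin 3) (φ ψ : 𝓢(E3, ℝ)) :
    partialDeriv j (schwartzConv φ ψ) = schwartzConv (schwartzPartial j φ) ψ :=
  funext fun x => fderiv_schwartzConv_apply φ ψ x _

lemma heatKernel_pos {t : ℝ} (ht : 0 < t) (x : E3) : 0 < heatKernel t x := by
  unfold heatKernel; positivity

lemma heatKernel_neg (t : ℝ) (x : E3) : heatKernel t (-x) = heatKernel t x := by
  simp [heatKernel]

lemma measurable_heatKernel : Measurable (fun p : ℝ × E3 => heatKernel p.1 p.2) := by
  unfold heatKernel; fun_prop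

/-- The heat kernel at a positive time, as a Schwartz function. -/
def heatKernelSchwartz {t : ℝ} (ht : 0 < t) : 𝓢(E3, ℝ) :=
  (4 * π * t) ^ (-(3 / 2) : ℝ) • gaussianSchwartz (b := (4 * t)⁻¹) (by positivity)

lemma heatKernel_eq_gaussian (t : ℝ) (x : E3) :
    heatKernel t x = (4 * π * t) ^ (-(3 / 2) : ℝ) * Real.exp (-(4 * t)⁻¹ * ‖x‖ ^ 2) := by
  rw [heatKernel, neg_div, div_eq_inv_mul (‖x‖ ^ 2), neg_mul]

lemma coe_heatKernelSchwartz {t : ℝ} (ht : 0 < t) : ⇑(heatKernelSchwartz ht) = heatKernel t :=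
  funext fun x => (heatKernel_eq_gaussian t x).symm

lemma continuous_heatKernel {t : ℝ} (ht : 0 < t) : Continuous (heatKernel t) :=
  coe_heatKernelSchwartz ht ▸ (heatKernelSchwartz ht).continuous

lemma integrable_heatKernel {t : ℝ} (ht : 0 < t) : Integrable (heatKernel t) :=
  coe_heatKernelSchwartz ht ▸ (heatKernelSchwartz ht).integrable

lemma integral_exp_neg_mul_norm_sq {b : ℝ} (hb : 0 < b) :
    ∫ v : E3, Real.exp (-b * ‖v‖ ^ 2) = (π / b) ^ (3 / 2 : ℝ) := by
  simpa using GaussianFourier.integral_rexp_neg_mul_sq_norm (V := E3) hb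

lemma integral_heatKernel {t : ℝ} (ht : 0 < t) : ∫ x, heatKernel t x = 1 := by
  simp_rw [heatKernel_eq_gaussian]
  rw [integral_const_mul, integral_exp_neg_mul_norm_sq (by positivity),
    Real.rpow_neg (by positivity), show π / (4 * t)⁻¹ = 4 * π * t by field_simp]
  exact inv_mul_cancel₀ (by positivity)

/-- Completing the square: `y ↦ G_s (x - y) G_t y` is a Gaussian centred at `t / (s + t) • x`. -/
lemma heatKernel_sub_mul_heatKernel {s t : ℝ} (hs : 0 < s) (ht : 0 < t) (x y : E3) :
    heatKernel s (x - y) * heatKernel t y =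
      (4 * π * s) ^ (-(3 / 2) : ℝ) * (4 * π * t) ^ (-(3 / 2) : ℝ) *
        Real.exp (-(‖x‖ ^ 2) / (4 * (s + t))) *
        Real.exp (-((s + t) / (4 * s * t)) * ‖y - (t / (s + t)) • x‖ ^ 2) := by
  have hexp : Real.exp (-(‖x‖ ^ 2) / (4 * (s + t))) *
      Real.exp (-((s + t) / (4 * s * t)) * ‖y - (t / (s + t)) • x‖ ^ 2) =
      Real.exp (-(‖x - y‖ ^ 2) / (4 * s)) * Real.exp (-(‖y‖ ^ 2) / (4 * t)) := by
    rw [← Real.exp_add, ← Real.exp_add]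
    congr 1
    rw [norm_sub_sq_real, norm_sub_sq_real, inner_smul_right, norm_smul, mul_pow,
      Real.norm_eq_abs, sq_abs, real_inner_comm]
    field_simp
    ring
  rw [mul_assoc _ (Real.exp _), hexp, heatKernel, heatKernel]
  ring

lemma heat_heatKernel {s t : ℝ} (hs : 0 < s) (ht : 0 < t) :
    heat s (heatKernel t) = heatKernel (s + t) := by
  funext x
  have hconst : (4 * π * s) ^ (-(3 / 2) : ℝ) * (4 * π * t) ^ (-(3 / 2) : ℝ) *
      (π / ((s + t) / (4 * s * t))) ^ (3 / 2 : ℝ) = (4 * π * (s + t)) ^ (-(3 / 2) : ℝ) := by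
    simp_rw [Real.rpow_neg_eq_inv_rpow]
    rw [← Real.mul_rpow (by positivity) (by positivity),
      ← Real.mul_rpow (by positivity) (by positivity)]
    congr 1
    field_simp
  simp_rw [heat, heatKernel_sub_mul_heatKernel hs ht]
  rw [integral_const_mul, integral_sub_right_eq_self
    (fun y : E3 => Real.exp (-((s + t) / (4 * s * t)) * ‖y‖ ^ 2)),
    integral_exp_neg_mul_norm_sq (by positivity), heatKernel, ← hconst]
  ring

lemma hasFDerivAt_heatKernel (t : ℝ) (x : E3) :
    HasFDerivAt (heatKernel t) (-(heatKernel t x / (2 * t)) • innerSL ℝ x) x := by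
  have hderiv : HasFDerivAt (heatKernel t) _ x :=
    (((((hasStrictFDerivAt_norm_sq x).hasFDerivAt).neg).mul_const ((4 * t)⁻¹)).exp).const_mul
      ((4 * π * t) ^ (-(3 / 2) : ℝ))
  refine hderiv.congr_fderiv ?_
  ext y
  simp only [heatKernel, Pi.neg_apply, div_eq_mul_inv, mul_inv, smul_neg, neg_apply, smul_apply,
    innerSL_apply_apply, nsmul_eq_mul, Nat.cast_ofNat, smul_eq_mul, neg_smul, neg_inj]
  ring

lemma schwartzConv_heatKernelSchwartz {t : ℝ} (ht : 0 < t) (φ : 𝓢(E3, ℝ)) :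
    schwartzConv (heatKernelSchwartz ht) φ = heat t φ := by
  funext x
  rw [schwartzConv, coe_heatKernelSchwartz, heat]

lemma partialDeriv_heat (j : Fin 3) {t : ℝ} (ht : 0 < t) (φ : 𝓢(E3, ℝ)) :
    partialDeriv j (heat t φ) = heat t (schwartzPartial j φ) := by
  rw [← schwartzConv_heatKernelSchwartz ht, ← schwartzConv_heatKernelSchwartz ht,
    funext (schwartzConv_comm _ φ), partialDeriv_schwartzConv, ← funext (schwartzConv_comm _ _)]

/-- The third partial derivative `∂_j ∂_k ∂_l φ` of a Schwartz function. -/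
def thirdPartial (j k l : Fin 3) (φ : 𝓢(E3, ℝ)) : 𝓢(E3, ℝ) :=
  schwartzPartial j (schwartzPartial k (schwartzPartial l φ))

lemma coe_thirdPartial (j k l : Fin 3) (φ : 𝓢(E3, ℝ)) :
    ⇑(thirdPartial j k l φ) = partialDeriv j (partialDeriv k (partialDeriv l φ)) := by
  simp only [thirdPartial, coe_schwartzPartial]

lemma heat_thirdPartial_heatKernel (j k l : Fin 3) {s t : ℝ} (hs : 0 < s) (ht : 0 < t) :
    heat s (thirdPartial j k l (heatKernelSchwartz ht)) =
      thirdPartial j k l (heatKernelSchwartz (add_pos hs ht)) := by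
  rw [coe_thirdPartial _ _ _ (heatKernelSchwartz (add_pos hs ht)), coe_heatKernelSchwartz,
    ← heat_heatKernel hs ht, ← coe_heatKernelSchwartz ht, partialDeriv_heat l hs,
    partialDeriv_heat k hs, partialDeriv_heat j hs, thirdPartial]

/-! ### Derivatives of the heat kernel -/

lemma inner_basisVec (x : E3) (j : Fin 3) : inner ℝ x (basisVec j) = x j := by
  simp [basisVec, EuclideanSpace.inner_single_right]

lemma partialDeriv_heatKernel (j : Fin 3) (t : ℝ) (x : E3) :
    partialDeriv j (heatKernel t) x = -(x j / (2 * t)) * heatKernel t x := by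
  rw [partialDeriv, (hasFDerivAt_heatKernel t x).fderiv, smul_apply, smul_eq_mul,
    innerSL_apply_apply, inner_basisVec]
  ring

lemma partialDeriv_mul_heatKernel (j : Fin 3) (t : ℝ) {p : E3 → ℝ} {x : E3}
    (hp : DifferentiableAt ℝ p x) :
    partialDeriv j (fun x => p x * heatKernel t x) x =
      (partialDeriv j p x - p x * (x j / (2 * t))) * heatKernel t x := by
  have hkernel := partialDeriv_heatKernel j t x
  unfold partialDeriv at hkernel ⊢
  rw [fderiv_fun_mul hp (hasFDerivAt_heatKernel t x).differentiableAt]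
  simp only [add_apply, smul_apply, smul_eq_mul]
  rw [hkernel]
  ring

lemma hasFDerivAt_coord (k : Fin 3) (x : E3) :
    HasFDerivAt (fun x : E3 => x k) (EuclideanSpace.proj k : E3 →L[ℝ] ℝ) x :=
  (EuclideanSpace.proj k : E3 →L[ℝ] ℝ).hasFDerivAt

/-- The Kronecker symbol `δ_{jk}`. -/
def kronecker (j k : Fin 3) : ℝ := if j = k then 1 else 0

lemma kronecker_comm (j k : Fin 3) : kronecker j k = kronecker k j := by
  simp [kronecker, eq_comm]

lemma proj_basisVec (j k : Fin 3) :
    (EuclideanSpace.proj k : E3 →L[ℝ] ℝ) (basisVec j) = kronecker j k := by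
  simp [basisVec, kronecker, eq_comm]

lemma abs_kronecker_le_one (j k : Fin 3) : |kronecker j k| ≤ 1 := by
  unfold kronecker; split_ifs <;> simp

/-- The explicit form of `∂_j ∂_k ∂_l` of the heat kernel. -/
def heatKernelD3 (j k l : Fin 3) (t : ℝ) (x : E3) : ℝ :=
  ((kronecker j k * x l + kronecker j l * x k + kronecker k l * x j) / (4 * t ^ 2) -
    x j * x k * x l / (8 * t ^ 3)) * heatKernel t x

lemma measurable_heatKernelD3 (j k l : Fin 3) :
    Measurable (fun p : ℝ × E3 => heatKernelD3 j k l p.1 p.2) :=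
  Measurable.mul (by fun_prop) measurable_heatKernel

lemma heatKernelD3_neg (j k l : Fin 3) (t : ℝ) (x : E3) :
    heatKernelD3 j k l t (-x) = -heatKernelD3 j k l t x := by
  simp only [heatKernelD3, heatKernel_neg, PiLp.neg_apply]
  ring

lemma heatKernelD3_swap (j k l : Fin 3) (t : ℝ) (x : E3) :
    heatKernelD3 j k l t x = heatKernelD3 k j l t x := by
  simp only [heatKernelD3, kronecker_comm k j]
  ring

lemma partialDeriv_partialDeriv_heatKernel (k l : Fin 3) {t : ℝ} (ht : 0 < t) (x : E3) :
    partialDeriv k (partialDeriv l (heatKernel t)) x =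
      (x k * x l / (4 * t ^ 2) - kronecker k l / (2 * t)) * heatKernel t x := by
  have hlin : HasFDerivAt (fun x : E3 => -(x l / (2 * t))) _ x :=
    ((hasFDerivAt_coord l x).mul_const ((2 * t)⁻¹)).neg
  rw [funext (partialDeriv_heatKernel l t), partialDeriv_mul_heatKernel k t hlin.differentiableAt,
    partialDeriv, hlin.fderiv, neg_apply, smul_apply, smul_eq_mul, proj_basisVec]
  field_simp
  ring

lemma coe_thirdPartial_heatKernelSchwartz (j k l : Fin 3) {t : ℝ} (ht : 0 < t) :
    ⇑(thirdPartial j k l (heatKernelSchwartz ht)) = heatKernelD3 j k l t := by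
  funext x
  have hquad : HasFDerivAt (fun x : E3 => x k * x l / (4 * t ^ 2) - kronecker k l / (2 * t)) _ x :=
    (((hasFDerivAt_coord k x).mul (hasFDerivAt_coord l x)).mul_const ((4 * t ^ 2)⁻¹)).sub_const
      (kronecker k l / (2 * t))
  rw [coe_thirdPartial, coe_heatKernelSchwartz,
    funext (partialDeriv_partialDeriv_heatKernel k l ht),
    partialDeriv_mul_heatKernel j t hquad.differentiableAt, partialDeriv, hquad.fderiv]
  simp only [add_apply, smul_apply, smul_eq_mul, proj_basisVec, heatKernelD3]
  field_simp
  ring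

lemma heatKernel_le {t : ℝ} (ht : 0 < t) (x : E3) :
    heatKernel t x ≤ (8 * √t ^ 3)⁻¹ * Real.exp (-(‖x‖ ^ 2 / (4 * t))) := by
  have hpow : (4 * t) ^ (3 / 2 : ℝ) = 8 * √t ^ 3 := by
    rw [show 4 * t = (2 * √t) ^ (2 : ℝ) by
        rw [Real.rpow_two, mul_pow, Real.sq_sqrt ht.le]; norm_num,
      ← Real.rpow_mul (by positivity)]
    norm_num
    ring
  rw [heatKernel, neg_div, Real.rpow_neg (by positivity), ← hpow]
  gcongr
  linarith [Real.pi_gt_three]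

/-- Half of the Gaussian decay of the heat kernel absorbs a factor of polynomial growth. -/
lemma mul_heatKernel_le {t : ℝ} (ht : 0 < t) {x : E3} {p M : ℝ} (hM : 0 ≤ M)
    (hp : p ≤ M * Real.exp (‖x‖ ^ 2 / (8 * t))) :
    p * heatKernel t x ≤ M * (8 * √t ^ 3)⁻¹ * Real.exp (-(‖x‖ ^ 2 / (8 * t))) := by
  have hexp : Real.exp (-(‖x‖ ^ 2 / (4 * t))) =
      Real.exp (-(‖x‖ ^ 2 / (8 * t))) * Real.exp (-(‖x‖ ^ 2 / (8 * t))) := by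
    rw [← Real.exp_add]; congr 1; field_simp; ring
  calc p * heatKernel t x
      ≤ M * Real.exp (‖x‖ ^ 2 / (8 * t)) *
          ((8 * √t ^ 3)⁻¹ * Real.exp (-(‖x‖ ^ 2 / (4 * t)))) := by
        gcongr
        · exact (heatKernel_pos ht x).le
        · exact heatKernel_le ht x
    _ = M * (8 * √t ^ 3)⁻¹ * Real.exp (-(‖x‖ ^ 2 / (8 * t))) := by
        rw [hexp, Real.exp_neg]; field_simp

lemma one_add_add_sq_le_exp_norm_sq_div {s : ℝ} (hs : 0 < s) (x : E3) :
    1 + (‖x‖ / s) ^ 2 / 8 + (‖x‖ / s) ^ 4 / 128 ≤ Real.exp (‖x‖ ^ 2 / (8 * s ^ 2)) := by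
  have hquad := Real.quadratic_le_exp_of_nonneg
    (x := ‖x‖ ^ 2 / (8 * s ^ 2)) (by positivity)
  have hdiv : ‖x‖ ^ 2 / (8 * s ^ 2) = (‖x‖ / s) ^ 2 / 8 := by field_simp
  rw [hdiv] at hquad ⊢
  linarith

lemma abs_coord_le_norm (x : E3) (j : Fin 3) : |x j| ≤ ‖x‖ := by
  simpa using PiLp.norm_apply_le x j

lemma abs_partialDeriv_heatKernel_le (j : Fin 3) {t : ℝ} (ht : 0 < t) (x : E3) :
    |partialDeriv j (heatKernel t) x| ≤ (t ^ 2)⁻¹ * Real.exp (-(‖x‖ ^ 2 / (8 * t))) := by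
  rw [partialDeriv_heatKernel, abs_mul, abs_of_pos (heatKernel_pos ht x), abs_neg, abs_div,
    abs_of_pos (by positivity : 0 < 2 * t)]
  obtain ⟨s, hs, rfl⟩ : ∃ s : ℝ, 0 < s ∧ t = s ^ 2 :=
    ⟨√t, Real.sqrt_pos.2 ht, (Real.sq_sqrt ht.le).symm⟩
  have hcoef : |x j| / (2 * s ^ 2) ≤ 8 / s * Real.exp (‖x‖ ^ 2 / (8 * s ^ 2)) := calc
    |x j| / (2 * s ^ 2) ≤ ‖x‖ / (2 * s ^ 2) := by gcongr; exact abs_coord_le_norm x j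
    _ = 8 / s * (‖x‖ / s / 16) := by field_simp; ring
    _ ≤ 8 / s * (1 + (‖x‖ / s) ^ 2 / 8 + (‖x‖ / s) ^ 4 / 128) := by
      gcongr
      nlinarith [sq_nonneg (‖x‖ / s - 1), sq_nonneg ((‖x‖ / s) ^ 2)]
    _ ≤ 8 / s * Real.exp (‖x‖ ^ 2 / (8 * s ^ 2)) := by
      gcongr; exact one_add_add_sq_le_exp_norm_sq_div hs x
  refine (mul_heatKernel_le ht (by positivity) hcoef).trans_eq ?_
  rw [Real.sqrt_sq hs.le]
  field_simp

lemma abs_heatKernelD3_coeff_le (j k l : Fin 3) {t : ℝ} (ht : 0 < t) (x : E3) :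
    |(kronecker j k * x l + kronecker j l * x k + kronecker k l * x j) / (4 * t ^ 2) -
      x j * x k * x l / (8 * t ^ 3)| ≤ 3 * ‖x‖ / (4 * t ^ 2) + ‖x‖ ^ 3 / (8 * t ^ 3) := by
  have hcoord := abs_coord_le_norm x
  have hkronecker (a b i : Fin 3) : |kronecker a b * x i| ≤ ‖x‖ := by
    rw [abs_mul]
    exact (mul_le_mul (abs_kronecker_le_one a b) (hcoord i) (abs_nonneg _) zero_le_one).trans_eq
      (one_mul _)
  refine (abs_sub _ _).trans ?_
  rw [abs_div, abs_div, abs_of_pos (by positivity : 0 < 4 * t ^ 2),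
    abs_of_pos (by positivity : 0 < 8 * t ^ 3)]
  gcongr
  · refine (abs_add_three _ _ _).trans ?_
    linarith [hkronecker j k l, hkronecker j l k, hkronecker k l j]
  · rw [abs_mul, abs_mul, pow_three, ← mul_assoc]
    gcongr <;> exact hcoord _

lemma abs_heatKernelD3_le (j k l : Fin 3) {t : ℝ} (ht : 0 < t) (x : E3) :
    |heatKernelD3 j k l t x| ≤ 11 * ((t ^ 3)⁻¹ * Real.exp (-(‖x‖ ^ 2 / (8 * t)))) := by
  rw [heatKernelD3, abs_mul, abs_of_pos (heatKernel_pos ht x)]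
  obtain ⟨s, hs, rfl⟩ : ∃ s : ℝ, 0 < s ∧ t = s ^ 2 :=
    ⟨√t, Real.sqrt_pos.2 ht, (Real.sq_sqrt ht.le).symm⟩
  have hpoly (ρ : ℝ) (hρ : 0 ≤ ρ) :
      3 * ρ / 4 + ρ ^ 3 / 8 ≤ 88 * (1 + ρ ^ 2 / 8 + ρ ^ 4 / 128) := by
    nlinarith [sq_nonneg (ρ - 1), mul_nonneg hρ (sq_nonneg (ρ - 1)), sq_nonneg (ρ ^ 2 - ρ)]
  have hcoef : |(kronecker j k * x l + kronecker j l * x k + kronecker k l * x j) /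
      (4 * (s ^ 2) ^ 2) - x j * x k * x l / (8 * (s ^ 2) ^ 3)| ≤
      88 / s ^ 3 * Real.exp (‖x‖ ^ 2 / (8 * s ^ 2)) := calc
    _ ≤ 3 * ‖x‖ / (4 * (s ^ 2) ^ 2) + ‖x‖ ^ 3 / (8 * (s ^ 2) ^ 3) :=
      abs_heatKernelD3_coeff_le j k l ht x
    _ = 1 / s ^ 3 * (3 * (‖x‖ / s) / 4 + (‖x‖ / s) ^ 3 / 8) := by field_simp
    _ ≤ 1 / s ^ 3 * (88 * Real.exp (‖x‖ ^ 2 / (8 * s ^ 2))) := by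
      gcongr
      exact (hpoly _ (by positivity)).trans
        (by gcongr; exact one_add_add_sq_le_exp_norm_sq_div hs x)
    _ = 88 / s ^ 3 * Real.exp (‖x‖ ^ 2 / (8 * s ^ 2)) := by ring
  refine (mul_heatKernel_le ht (by positivity) hcoef).trans_eq ?_
  rw [Real.sqrt_sq hs.le]
  field_simp
  norm_num

/-! ### Integrals in the time variable -/

lemma hasDerivAt_exp_neg_div_mul {A τ : ℝ} (hA : A ≠ 0) (hτ : τ ≠ 0) :
    HasDerivAt (fun τ => Real.exp (-(A / τ)) * ((A * τ)⁻¹ + (A ^ 2)⁻¹))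
      ((τ ^ 3)⁻¹ * Real.exp (-(A / τ))) τ := by
  have hinv : HasDerivAt (fun τ : ℝ => A / τ) _ τ := (hasDerivAt_inv hτ).const_mul A
  have hmul : HasDerivAt (fun τ : ℝ => (A * τ)⁻¹) _ τ :=
    ((hasDerivAt_id τ).const_mul A).fun_inv (mul_ne_zero hA hτ)
  refine (hinv.fun_neg.exp.fun_mul (hmul.add_const ((A ^ 2)⁻¹))).congr_deriv ?_
  simp only [id_eq]
  field_simp
  ring

lemma tendsto_exp_neg_div_mul_atTop {A : ℝ} (hA : 0 < A) :
    Tendsto (fun τ => Real.exp (-(A / τ)) * ((A * τ)⁻¹ + (A ^ 2)⁻¹)) atTop (𝓝 (A ^ 2)⁻¹) := by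
  have hexp : Tendsto (fun τ => Real.exp (-(A / τ))) atTop (𝓝 1) := by
    simpa using ((tendsto_const_nhds (x := A)).div_atTop tendsto_id).neg.rexp
  simpa using hexp.mul ((tendsto_id.const_mul_atTop hA).inv_tendsto_atTop.add_const (A ^ 2)⁻¹)

lemma integrableOn_inv_cube_mul_exp {A s a : ℝ} (hA : 0 < A) (hsa : 0 < s + a) :
    IntegrableOn (fun σ => ((σ + a) ^ 3)⁻¹ * Real.exp (-(A / (σ + a)))) (Set.Ioi s) := by
  have hpos {σ : ℝ} (hσ : s ≤ σ) : 0 < σ + a := by linarith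
  refine integrableOn_Ioi_deriv_of_nonneg'
    (fun σ hσ => (hasDerivAt_exp_neg_div_mul hA.ne' (hpos hσ).ne').comp_add_const σ a)
    (fun σ hσ => ?_)
    ((tendsto_exp_neg_div_mul_atTop hA).comp (tendsto_atTop_add_const_right _ a tendsto_id))
  have := hpos (le_of_lt hσ)
  positivity

lemma integral_inv_cube_mul_exp_le {A s a : ℝ} (hA : 0 < A) (hsa : 0 < s + a) :
    ∫ σ in Set.Ioi s, ((σ + a) ^ 3)⁻¹ * Real.exp (-(A / (σ + a))) ≤ (A ^ 2)⁻¹ := by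
  have hpos {σ : ℝ} (hσ : s ≤ σ) : 0 < σ + a := by linarith
  rw [integral_Ioi_of_hasDerivAt_of_tendsto'
    (fun σ hσ => (hasDerivAt_exp_neg_div_mul hA.ne' (hpos hσ).ne').comp_add_const σ a)
    (integrableOn_inv_cube_mul_exp hA hsa)
    ((tendsto_exp_neg_div_mul_atTop hA).comp (tendsto_atTop_add_const_right _ a tendsto_id))]
  exact sub_le_self _ (by positivity)

/-- Inserting the factor `exp ((s + a) / (8 (σ + a))) ≤ 3` turns the Gaussian decay in `r` into
decay in the parabolic quantity `s + a + r²`. -/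
lemma inv_cube_mul_exp_le {s a r σ : ℝ} (hsa : 0 < s + a) (hσ : s < σ) :
    ((σ + a) ^ 3)⁻¹ * Real.exp (-(r ^ 2 / (8 * (σ + a)))) ≤
      3 * (((σ + a) ^ 3)⁻¹ * Real.exp (-((s + a + r ^ 2) / 8 / (σ + a)))) := by
  have hpos : 0 < σ + a := by linarith
  have hsplit : (s + a + r ^ 2) / 8 / (σ + a) =
      (s + a) / (8 * (σ + a)) + r ^ 2 / (8 * (σ + a)) := by field_simp
  have hle_one : (s + a) / (8 * (σ + a)) ≤ 1 := (div_le_one (by positivity)).2 (by linarith)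
  have hexp : Real.exp (-(r ^ 2 / (8 * (σ + a)))) ≤
      3 * Real.exp (-((s + a + r ^ 2) / 8 / (σ + a))) := calc
    _ ≤ Real.exp (1 + -((s + a + r ^ 2) / 8 / (σ + a))) := Real.exp_le_exp.2 (by linarith)
    _ = Real.exp 1 * Real.exp (-((s + a + r ^ 2) / 8 / (σ + a))) := Real.exp_add _ _
    _ ≤ _ := by gcongr; exact Real.exp_one_lt_three.le
  rw [mul_left_comm]
  gcongr

lemma integrableOn_inv_cube_mul_exp_sq {s a : ℝ} (r : ℝ) (hsa : 0 < s + a) :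
    IntegrableOn (fun σ => ((σ + a) ^ 3)⁻¹ * Real.exp (-(r ^ 2 / (8 * (σ + a)))))
      (Set.Ioi s) := by
  have hA : 0 < (s + a + r ^ 2) / 8 := by positivity
  refine ((integrableOn_inv_cube_mul_exp hA hsa).const_mul 3).mono'
    (by fun_prop : Measurable _).aestronglyMeasurable
    ((ae_restrict_mem measurableSet_Ioi).mono fun σ hσ => ?_)
  have hpos : 0 < σ + a := by linarith [Set.mem_Ioi.1 hσ]
  exact (Real.norm_of_nonneg (by positivity)).trans_le (inv_cube_mul_exp_le hsa hσ)

lemma integral_inv_cube_mul_exp_sq_le {s a : ℝ} (r : ℝ) (hsa : 0 < s + a) :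
    ∫ σ in Set.Ioi s, ((σ + a) ^ 3)⁻¹ * Real.exp (-(r ^ 2 / (8 * (σ + a)))) ≤
      192 * ((s + a + r ^ 2) ^ 2)⁻¹ := by
  have hA : 0 < (s + a + r ^ 2) / 8 := by positivity
  calc ∫ σ in Set.Ioi s, ((σ + a) ^ 3)⁻¹ * Real.exp (-(r ^ 2 / (8 * (σ + a))))
      ≤ ∫ σ in Set.Ioi s, 3 * (((σ + a) ^ 3)⁻¹ * Real.exp (-((s + a + r ^ 2) / 8 / (σ + a)))) :=
        setIntegral_mono_on (integrableOn_inv_cube_mul_exp_sq r hsa)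
          ((integrableOn_inv_cube_mul_exp hA hsa).const_mul 3) measurableSet_Ioi
          fun σ hσ => inv_cube_mul_exp_le hsa hσ
    _ ≤ 3 * (((s + a + r ^ 2) / 8) ^ 2)⁻¹ := by
        rw [integral_const_mul]
        gcongr
        exact integral_inv_cube_mul_exp_le hA hsa
    _ = 192 * ((s + a + r ^ 2) ^ 2)⁻¹ := by rw [div_pow]; field_simp; norm_num

lemma abs_heatKernelD3_add_le (j k l : Fin 3) {s a : ℝ} (hsa : 0 < s + a) (x : E3) :
    ∀ σ ∈ Set.Ioi s, |heatKernelD3 j k l (σ + a) x| ≤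
      11 * (((σ + a) ^ 3)⁻¹ * Real.exp (-(‖x‖ ^ 2 / (8 * (σ + a))))) :=
  fun σ hσ => abs_heatKernelD3_le j k l (by linarith [Set.mem_Ioi.1 hσ]) x

lemma integrableOn_heatKernelD3 (j k l : Fin 3) {s a : ℝ} (hsa : 0 < s + a) (x : E3) :
    IntegrableOn (fun σ => heatKernelD3 j k l (σ + a) x) (Set.Ioi s) := by
  refine ((integrableOn_inv_cube_mul_exp_sq ‖x‖ hsa).const_mul 11).mono' ?_
    ((ae_restrict_mem measurableSet_Ioi).mono (abs_heatKernelD3_add_le j k l hsa x))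
  exact ((measurable_heatKernelD3 j k l).comp
    (by fun_prop : Measurable fun σ : ℝ => (σ + a, x))).aestronglyMeasurable

lemma integral_abs_heatKernelD3_le (j k l : Fin 3) {s a : ℝ} (hsa : 0 < s + a) (x : E3) :
    ∫ σ in Set.Ioi s, |heatKernelD3 j k l (σ + a) x| ≤ 2112 * ((s + a + ‖x‖ ^ 2) ^ 2)⁻¹ := by
  have hmono := setIntegral_mono_on (integrableOn_heatKernelD3 j k l hsa x).abs
    ((integrableOn_inv_cube_mul_exp_sq ‖x‖ hsa).const_mul 11) measurableSet_Ioi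
    (abs_heatKernelD3_add_le j k l hsa x)
  rw [integral_const_mul] at hmono
  linarith [integral_inv_cube_mul_exp_sq_le ‖x‖ hsa]

/-! ### The Newtonian potential as a time integral of the heat flow -/

lemma four_mul_pi_rpow_neg : (4 * π) ^ (-(3 / 2) : ℝ) = (8 * √π ^ 3)⁻¹ := by
  rw [Real.rpow_neg (by positivity), show 4 * π = (2 * √π) ^ (2 : ℝ) by
    rw [Real.rpow_two, mul_pow, Real.sq_sqrt Real.pi_pos.le]; norm_num,
    ← Real.rpow_mul (by positivity)]
  norm_num
  ring

/-- The heat kernel in the form suited to the substitution `y = σ^(-1/2)`. -/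
lemma heatKernel_eq_rpow {σ : ℝ} (hσ : 0 < σ) (z : E3) :
    heatKernel σ z = 2 * (4 * π) ^ (-(3 / 2) : ℝ) * ((|(-(1 / 2) : ℝ)| * σ ^ ((-(1 / 2) : ℝ) - 1)) •
      Real.exp (-(‖z‖ ^ 2 / 4) * (σ ^ (-(1 / 2) : ℝ)) ^ 2)) := by
  have hsq : (σ ^ (-(1 / 2) : ℝ)) ^ 2 = σ⁻¹ := by
    rw [← Real.rpow_natCast, ← Real.rpow_mul hσ.le, ← Real.rpow_neg_one]
    norm_num
  have hexp : -‖z‖ ^ 2 / (4 * σ) = -(‖z‖ ^ 2 / 4) * σ⁻¹ := by field_simp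
  rw [hsq, heatKernel, hexp, Real.mul_rpow (by positivity) hσ.le, abs_neg, abs_of_pos one_half_pos,
    smul_eq_mul, show (-(1 / 2) : ℝ) - 1 = -(3 / 2) by norm_num]
  ring

lemma integral_heatKernel_time {z : E3} (hz : z ≠ 0) :
    ∫ σ in Set.Ioi (0 : ℝ), heatKernel σ z = 1 / (4 * π * ‖z‖) := by
  have hsubst := integral_comp_rpow_Ioi (fun y : ℝ => Real.exp (-(‖z‖ ^ 2 / 4) * y ^ 2))
    (p := -(1 / 2)) (by norm_num)
  have hsqrt : √(π / (‖z‖ ^ 2 / 4)) = 2 * √π / ‖z‖ := by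
    rw [show π / (‖z‖ ^ 2 / 4) = π * (2 / ‖z‖) ^ 2 by field_simp; norm_num,
      Real.sqrt_mul Real.pi_pos.le, Real.sqrt_sq (by positivity)]
    ring
  rw [setIntegral_congr_fun measurableSet_Ioi fun σ hσ => heatKernel_eq_rpow hσ z,
    integral_const_mul, hsubst, integral_gaussian_Ioi, four_mul_pi_rpow_neg, hsqrt]
  rw [show 4 * π * ‖z‖ = 4 * √π ^ 2 * ‖z‖ by rw [Real.sq_sqrt Real.pi_pos.le]]
  field_simp
  norm_num

lemma heatKernel_le_const {t : ℝ} (ht : 0 < t) (x : E3) : heatKernel t x ≤ (8 * √t ^ 3)⁻¹ :=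
  (heatKernel_le ht x).trans <| mul_le_of_le_one_right (by positivity) <|
    Real.exp_le_one_iff.2 (neg_nonpos.2 (by positivity))

lemma integrable_heatKernel_sub_mul {t : ℝ} (ht : 0 < t) (φ : 𝓢(E3, ℝ)) (x : E3) :
    Integrable (fun y => heatKernel t (x - y) * φ y) :=
  ((integrable_heatKernel ht).comp_sub_left x).mul_bdd φ.continuous.aestronglyMeasurable
    (Eventually.of_forall (φ.norm_le_seminorm ℝ))

lemma integral_abs_heatKernel_sub_mul_le_seminorm {t : ℝ} (ht : 0 < t) (φ : 𝓢(E3, ℝ)) (x : E3) :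
    ∫ y, |heatKernel t (x - y) * φ y| ≤ SchwartzMap.seminorm ℝ 0 0 φ := calc
  ∫ y, |heatKernel t (x - y) * φ y|
      ≤ ∫ y, heatKernel t (x - y) * SchwartzMap.seminorm ℝ 0 0 φ := by
        refine integral_mono (integrable_heatKernel_sub_mul ht φ x).abs
          (((integrable_heatKernel ht).comp_sub_left x).mul_const _) fun y => ?_
        simp only [abs_mul, abs_of_pos (heatKernel_pos ht _)]
        exact mul_le_mul_of_nonneg_left (φ.norm_le_seminorm ℝ y) (heatKernel_pos ht _).le
  _ = SchwartzMap.seminorm ℝ 0 0 φ := by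
        rw [integral_mul_const, integral_sub_left_eq_self (heatKernel t) volume x,
          integral_heatKernel ht, one_mul]

lemma integral_abs_heatKernel_sub_mul_le_integral {t : ℝ} (ht : 0 < t) (φ : 𝓢(E3, ℝ)) (x : E3) :
    ∫ y, |heatKernel t (x - y) * φ y| ≤ (8 * √t ^ 3)⁻¹ * ∫ y, |φ y| := by
  rw [← integral_const_mul]
  refine integral_mono (integrable_heatKernel_sub_mul ht φ x).abs
    (φ.integrable.abs.const_mul _) fun y => ?_
  simp only [abs_mul, abs_of_pos (heatKernel_pos ht _)]
  exact mul_le_mul_of_nonneg_right (heatKernel_le_const ht _) (abs_nonneg _)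

lemma integrableOn_inv_sqrt_cube {s : ℝ} (hs : 0 < s) :
    IntegrableOn (fun t : ℝ => (8 * √t ^ 3)⁻¹) (Set.Ioi s) := by
  refine IntegrableOn.congr_fun
    ((integrableOn_Ioi_rpow_of_lt (a := (-(3 / 2) : ℝ)) (by norm_num) hs).const_mul 8⁻¹)
    (fun t ht => ?_) measurableSet_Ioi
  have ht : 0 ≤ t := (hs.trans ht).le
  simp only [mul_inv, Real.sqrt_eq_rpow, ← Real.rpow_natCast, ← Real.rpow_mul ht, Real.rpow_neg ht]
  norm_num

/-- Near `t = 0` the inner integral is bounded by `sup |φ|`, and for `t > 1` it decays like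
`t^(-3/2)`: this is where the dimension being greater than two enters. -/
lemma integrable_heatKernel_sub_mul_prod (φ : 𝓢(E3, ℝ)) (x : E3) :
    Integrable (fun p : ℝ × E3 => heatKernel p.1 (x - p.2) * φ p.2)
      ((volume.restrict (Set.Ioi 0)).prod volume) := by
  have hmeas : AEStronglyMeasurable (fun p : ℝ × E3 => heatKernel p.1 (x - p.2) * φ p.2)
      ((volume.restrict (Set.Ioi 0)).prod volume) :=
    ((measurable_heatKernel.comp (by fun_prop : Measurable fun p : ℝ × E3 => (p.1, x - p.2))).mul
      (φ.continuous.measurable.comp measurable_snd)).aestronglyMeasurable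
  have hmeas_norm : AEStronglyMeasurable (fun t => ∫ y, ‖heatKernel t (x - y) * φ y‖)
      (volume.restrict (Set.Ioi 0)) := hmeas.norm.integral_prod_right'
  refine (integrable_prod_iff hmeas).2 ⟨(ae_restrict_mem measurableSet_Ioi).mono fun t ht =>
    integrable_heatKernel_sub_mul ht φ x, ?_⟩
  rw [← IntegrableOn, ← Set.Ioc_union_Ioi_eq_Ioi (zero_le_one' ℝ)]
  refine IntegrableOn.union ?_ ?_
  · refine Integrable.of_bound (hmeas_norm.mono_set Set.Ioc_subset_Ioi_self)
      (SchwartzMap.seminorm ℝ 0 0 φ) ((ae_restrict_mem measurableSet_Ioc).mono fun t ht => ?_)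
    rw [Real.norm_of_nonneg (integral_nonneg fun _ => norm_nonneg _)]
    exact integral_abs_heatKernel_sub_mul_le_seminorm ht.1 φ x
  · refine ((integrableOn_inv_sqrt_cube one_pos).mul_const (∫ y, |φ y|)).mono'
      (hmeas_norm.mono_set (Set.Ioi_subset_Ioi zero_le_one))
      ((ae_restrict_mem measurableSet_Ioi).mono fun t ht => ?_)
    rw [Real.norm_of_nonneg (integral_nonneg fun _ => norm_nonneg _)]
    exact integral_abs_heatKernel_sub_mul_le_integral (zero_lt_one.trans ht) φ x

lemma integrableOn_heat (φ : 𝓢(E3, ℝ)) (x : E3) :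
    IntegrableOn (fun t => heat t φ x) (Set.Ioi 0) :=
  (integrable_heatKernel_sub_mul_prod φ x).integral_prod_left

lemma invNegLaplacian_eq_integral_heat (φ : 𝓢(E3, ℝ)) (x : E3) :
    invNegLaplacian φ x = ∫ t in Set.Ioi (0 : ℝ), heat t φ x := by
  unfold heat invNegLaplacian
  rw [integral_integral_swap (f := fun (t : ℝ) (y : E3) => heatKernel t (x - y) * φ y)
    (integrable_heatKernel_sub_mul_prod φ x)]
  have hne : ∀ᵐ y : E3, y ≠ x := by simp [ae_iff]
  refine integral_congr_ae ?_
  filter_upwards [hne] with y hy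
  rw [integral_mul_const, integral_heatKernel_time (sub_ne_zero.2 hy.symm)]

lemma lerayDeriv_eq (j k l : Fin 3) (φ : 𝓢(E3, ℝ)) (x : E3) :
    lerayDeriv j k l φ x = kronecker k l * partialDeriv j φ x +
      ∫ t in Set.Ioi (0 : ℝ), heat t (thirdPartial j k l φ) x := by
  rw [lerayDeriv, ← invNegLaplacian_eq_integral_heat, coe_thirdPartial, kronecker, ite_mul,
    one_mul, zero_mul]

/-! ### The Oseen kernel -/

lemma abs_heatKernelD3_le_inv_cube (j k l : Fin 3) {t : ℝ} (ht : 0 < t) (x : E3) :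
    |heatKernelD3 j k l t x| ≤ 11 * (t ^ 3)⁻¹ :=
  (abs_heatKernelD3_le j k l ht x).trans <| mul_le_mul_of_nonneg_left
    (mul_le_of_le_one_right (by positivity) <|
      Real.exp_le_one_iff.2 (neg_nonpos.2 (by positivity))) (by norm_num)

lemma integrableOn_inv_cube {s a : ℝ} (hsa : 0 < s + a) :
    IntegrableOn (fun σ : ℝ => 11 * ((σ + a) ^ 3)⁻¹) (Set.Ioi s) := by
  simpa [IntegrableOn] using (integrableOn_inv_cube_mul_exp_sq 0 hsa).const_mul 11

lemma measurable_heatKernelD3_comp {α : Type*} [MeasurableSpace α] (j k l : Fin 3) {f : α → ℝ}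
    {g : α → E3} (hf : Measurable f) (hg : Measurable g) :
    Measurable (fun a => heatKernelD3 j k l (f a) (g a)) :=
  (measurable_heatKernelD3 j k l).comp (hf.prodMk hg)

lemma continuous_heatKernelD3 (j k l : Fin 3) {t : ℝ} (ht : 0 < t) :
    Continuous (heatKernelD3 j k l t) :=
  coe_thirdPartial_heatKernelSchwartz j k l ht ▸ SchwartzMap.continuous _

lemma oseenKernel_eq (j k l : Fin 3) {t : ℝ} (ht : 0 < t) (x : E3) :
    oseenKernel j k l t x = kronecker k l * partialDeriv j (heatKernel t) x +
      ∫ σ in Set.Ioi (0 : ℝ), heatKernelD3 j k l (σ + t) x := by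
  rw [oseenKernel, ← coe_heatKernelSchwartz ht, lerayDeriv_eq]
  congr 1
  refine setIntegral_congr_fun measurableSet_Ioi fun σ hσ => ?_
  rw [heat_thirdPartial_heatKernel j k l hσ ht, coe_thirdPartial_heatKernelSchwartz]

lemma partialDeriv_heatKernel_neg (j : Fin 3) (t : ℝ) (x : E3) :
    partialDeriv j (heatKernel t) (-x) = -partialDeriv j (heatKernel t) x := by
  rw [partialDeriv_heatKernel, partialDeriv_heatKernel, heatKernel_neg, PiLp.neg_apply]
  ring

lemma oseenKernel_neg (j k l : Fin 3) {t : ℝ} (ht : 0 < t) (x : E3) :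
    oseenKernel j k l t (-x) = -oseenKernel j k l t x := by
  rw [oseenKernel_eq j k l ht, oseenKernel_eq j k l ht, partialDeriv_heatKernel_neg, neg_add,
    mul_neg, ← integral_neg]
  simp_rw [heatKernelD3_neg]

lemma inv_sq_mul_exp_le {t r : ℝ} (ht : 0 < t) :
    (t ^ 2)⁻¹ * Real.exp (-(r ^ 2 / (8 * t))) ≤ 128 * ((t + r ^ 2) ^ 2)⁻¹ := by
  rw [Real.exp_neg, ← mul_inv, ← div_eq_mul_inv, inv_eq_one_div,
    div_le_div_iff₀ (by positivity) (by positivity), one_mul]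
  calc (t + r ^ 2) ^ 2
      ≤ 128 * t ^ 2 + 16 * (t * r ^ 2) + r ^ 4 := by
        nlinarith [mul_nonneg ht.le (sq_nonneg r), sq_nonneg t]
    _ = 128 * (t ^ 2 * (1 + r ^ 2 / (8 * t) + (r ^ 2 / (8 * t)) ^ 2 / 2)) := by field_simp; ring
    _ ≤ 128 * (t ^ 2 * Real.exp (r ^ 2 / (8 * t))) := by
        gcongr
        exact Real.quadratic_le_exp_of_nonneg (by positivity)

lemma abs_oseenKernel_le (j k l : Fin 3) {t : ℝ} (ht : 0 < t) (x : E3) :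
    |oseenKernel j k l t x| ≤ 2240 * ((t + ‖x‖ ^ 2) ^ 2)⁻¹ := by
  have hlocal : |kronecker k l * partialDeriv j (heatKernel t) x| ≤
      128 * ((t + ‖x‖ ^ 2) ^ 2)⁻¹ := calc
    _ ≤ 1 * ((t ^ 2)⁻¹ * Real.exp (-(‖x‖ ^ 2 / (8 * t)))) := by
      rw [abs_mul]
      exact mul_le_mul (abs_kronecker_le_one k l) (abs_partialDeriv_heatKernel_le j ht x)
        (abs_nonneg _) zero_le_one
    _ ≤ _ := (one_mul _).trans_le (inv_sq_mul_exp_le ht)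
  have hnonlocal : |∫ σ in Set.Ioi (0 : ℝ), heatKernelD3 j k l (σ + t) x| ≤
      2112 * ((t + ‖x‖ ^ 2) ^ 2)⁻¹ :=
    abs_integral_le_integral_abs.trans <| by
      simpa using integral_abs_heatKernelD3_le j k l (s := 0) (a := t) (by simpa using ht) x
  rw [oseenKernel_eq j k l ht]
  linarith [abs_add_le (kronecker k l * partialDeriv j (heatKernel t) x)
    (∫ σ in Set.Ioi (0 : ℝ), heatKernelD3 j k l (σ + t) x)]

lemma inv_add_norm_sq_le_bracketWeight {t : ℝ} (ht : 0 < t) (x : E3) :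
    ((t + ‖x‖ ^ 2) ^ 2)⁻¹ ≤ (1 + t⁻¹) ^ 2 * bracketWeight x := by
  have hle : 1 + ‖x‖ ^ 2 ≤ (1 + t⁻¹) * (t + ‖x‖ ^ 2) := by
    have hexpand : (1 + t⁻¹) * (t + ‖x‖ ^ 2) = 1 + ‖x‖ ^ 2 + (t + t⁻¹ * ‖x‖ ^ 2) := by
      field_simp
      ring
    exact hexpand ▸ le_add_of_nonneg_right (by positivity)
  rw [bracketWeight, ← div_eq_mul_inv, inv_eq_one_div,
    div_le_div_iff₀ (by positivity) (by positivity), ← mul_pow, one_mul]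
  gcongr

lemma abs_oseenKernel_le_bracketWeight (j k l : Fin 3) {t : ℝ} (ht : 0 < t) (x : E3) :
    |oseenKernel j k l t x| ≤ 2240 * (1 + t⁻¹) ^ 2 * bracketWeight x := by
  refine (abs_oseenKernel_le j k l ht x).trans ?_
  rw [mul_assoc]
  gcongr
  exact inv_add_norm_sq_le_bracketWeight ht x

lemma exists_measurable_eq_oseenKernel (j k l : Fin 3) :
    ∃ E : ℝ × E3 → ℝ, Measurable E ∧ ∀ t, 0 < t → ∀ x, oseenKernel j k l t x = E (t, x) := by
  refine ⟨fun p => kronecker k l * (-(p.2 j / (2 * p.1)) * heatKernel p.1 p.2) +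
      ∫ σ in Set.Ioi (0 : ℝ), heatKernelD3 j k l (σ + p.1) p.2, ?_, fun t ht x => ?_⟩
  · refine (measurable_const.mul (Measurable.mul (by fun_prop) measurable_heatKernel)).add ?_
    have hD3 : StronglyMeasurable fun q : (ℝ × E3) × ℝ =>
        heatKernelD3 j k l (q.2 + q.1.1) q.1.2 :=
      (measurable_heatKernelD3_comp j k l (by fun_prop) (by fun_prop)).stronglyMeasurable
    exact (hD3.integral_prod_right (ν := volume.restrict (Set.Ioi 0))).measurable
  · rw [oseenKernel_eq j k l ht, partialDeriv_heatKernel]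

lemma continuous_oseenKernel (j k l : Fin 3) {t : ℝ} (ht : 0 < t) :
    Continuous (oseenKernel j k l t) := by
  have hlocal : Continuous (partialDeriv j (heatKernel t)) := by
    rw [← coe_heatKernelSchwartz ht, ← coe_schwartzPartial]
    exact SchwartzMap.continuous _
  rw [funext (oseenKernel_eq j k l ht)]
  refine (continuous_const.mul hlocal).add (continuous_of_dominated
    (fun x => ?_) (fun x => ?_) (integrableOn_inv_cube (s := 0) (by simpa using ht)) ?_)
  · exact (measurable_heatKernelD3_comp j k l (by fun_prop) measurable_const).aestronglyMeasurable
  · exact (ae_restrict_mem measurableSet_Ioi).mono fun σ hσ =>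
      abs_heatKernelD3_le_inv_cube j k l (add_pos hσ ht) x
  · exact (ae_restrict_mem measurableSet_Ioi).mono fun σ hσ =>
      continuous_heatKernelD3 j k l (add_pos hσ ht)

lemma integral_oseenKernel (j k l : Fin 3) {t : ℝ} (ht : 0 < t) :
    ∫ x, oseenKernel j k l t x = 0 := by
  have hodd := integral_neg_eq_self (oseenKernel j k l t) volume
  simp_rw [oseenKernel_neg j k l ht, integral_neg] at hodd
  linarith

/-! ### Convolution with the Oseen kernel -/

lemma heat_schwartzPartial (j : Fin 3) {t : ℝ} (ht : 0 < t) (φ : 𝓢(E3, ℝ)) (x : E3) :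
    heat t (schwartzPartial j φ) x = ∫ y, partialDeriv j (heatKernel t) (x - y) * φ y := by
  rw [← partialDeriv_heat j ht, ← schwartzConv_heatKernelSchwartz ht, partialDeriv_schwartzConv,
    schwartzConv, coe_schwartzPartial, coe_heatKernelSchwartz]

lemma heat_thirdPartial (j k l : Fin 3) {t : ℝ} (ht : 0 < t) (φ : 𝓢(E3, ℝ)) (x : E3) :
    heat t (thirdPartial j k l φ) x = ∫ y, heatKernelD3 j k l t (x - y) * φ y := by
  rw [thirdPartial, ← partialDeriv_heat j ht, ← partialDeriv_heat k ht, ← partialDeriv_heat l ht,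
    ← schwartzConv_heatKernelSchwartz ht, partialDeriv_schwartzConv, partialDeriv_schwartzConv,
    partialDeriv_schwartzConv, schwartzConv]
  simp_rw [← coe_thirdPartial_heatKernelSchwartz j k l ht]
  rfl

lemma integrable_partialDeriv_heatKernel_sub_mul (j : Fin 3) {t : ℝ} (ht : 0 < t) (φ : 𝓢(E3, ℝ))
    (x : E3) : Integrable (fun y => partialDeriv j (heatKernel t) (x - y) * φ y) := by
  rw [← coe_heatKernelSchwartz ht, ← coe_schwartzPartial]
  simpa only [smul_eq_mul, mul_comm] using
    integrable_smul_comp_sub (schwartzPartial j (heatKernelSchwartz ht)) φ x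

lemma integrable_heatKernelD3_sub_mul_prod (j k l : Fin 3) {s a : ℝ} (hsa : 0 < s + a)
    (φ : 𝓢(E3, ℝ)) (x : E3) :
    Integrable (fun p : ℝ × E3 => heatKernelD3 j k l (p.1 + a) (x - p.2) * φ p.2)
      ((volume.restrict (Set.Ioi s)).prod volume) := by
  have hmem : ∀ᵐ p ∂((volume.restrict (Set.Ioi s)).prod (volume : Measure E3)), s < p.1 :=
    Measure.quasiMeasurePreserving_fst.ae (ae_restrict_mem measurableSet_Ioi)
  refine ((integrableOn_inv_cube hsa).mul_prod φ.integrable.abs).mono'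
    ((measurable_heatKernelD3_comp j k l (by fun_prop) (by fun_prop)).mul
      (φ.continuous.measurable.comp (by fun_prop))).aestronglyMeasurable
    (hmem.mono fun p hp => ?_)
  rw [norm_mul]
  exact mul_le_mul_of_nonneg_right (abs_heatKernelD3_le_inv_cube j k l (by linarith) _)
    (norm_nonneg _)

lemma setIntegral_heat_thirdPartial (j k l : Fin 3) {s a : ℝ} (hsa : 0 < s + a) (φ : 𝓢(E3, ℝ))
    (x : E3) :
    ∫ σ in Set.Ioi s, heat (σ + a) (thirdPartial j k l φ) x =
      ∫ y, (∫ σ in Set.Ioi s, heatKernelD3 j k l (σ + a) (x - y)) * φ y := by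
  simp_rw [← integral_mul_const]
  rw [← integral_integral_swap
    (f := fun σ y => heatKernelD3 j k l (σ + a) (x - y) * φ y)
    (integrable_heatKernelD3_sub_mul_prod j k l hsa φ x)]
  exact setIntegral_congr_fun measurableSet_Ioi fun σ hσ =>
    heat_thirdPartial j k l (by linarith [Set.mem_Ioi.1 hσ]) φ x

/-- The function `e^{aΔ} (δ_{kl} ∂_j + (-Δ)⁻¹ ∂_j ∂_k ∂_l) φ`, for `a > 0`. As `a → 0` it serves as
a regularization of `lerayDeriv j k l φ`. -/
def oseenConv (j k l : Fin 3) (a : ℝ) (φ : E3 → ℝ) (x : E3) : ℝ :=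
  ∫ y, oseenKernel j k l a (x - y) * φ y

lemma oseenConv_eq (j k l : Fin 3) {a : ℝ} (ha : 0 < a) (φ : 𝓢(E3, ℝ)) (x : E3) :
    oseenConv j k l a φ x = kronecker k l * heat a (schwartzPartial j φ) x +
      ∫ σ in Set.Ioi (0 : ℝ), heat (σ + a) (thirdPartial j k l φ) x := by
  have hsa : 0 < 0 + a := by simpa using ha
  have hnonlocal : Integrable
      (fun y => (∫ σ in Set.Ioi (0 : ℝ), heatKernelD3 j k l (σ + a) (x - y)) * φ y) := by
    simp_rw [← integral_mul_const]
    exact (integrable_heatKernelD3_sub_mul_prod j k l hsa φ x).integral_prod_right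
  simp_rw [oseenConv, oseenKernel_eq j k l ha, add_mul, mul_assoc]
  rw [integral_add ((integrable_partialDeriv_heatKernel_sub_mul j ha φ x).const_mul _) hnonlocal,
    integral_const_mul, ← heat_schwartzPartial j ha, setIntegral_heat_thirdPartial j k l hsa]

lemma oseenConv_heatKernel (j k l : Fin 3) {a b : ℝ} (ha : 0 < a) (hb : 0 < b) :
    oseenConv j k l a (heatKernel b) = oseenKernel j k l (a + b) := by
  funext x
  rw [← coe_heatKernelSchwartz hb, oseenConv_eq j k l ha, ← partialDeriv_heat j ha,
    coe_heatKernelSchwartz, heat_heatKernel ha hb, oseenKernel_eq j k l (add_pos ha hb)]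
  congr 1
  refine setIntegral_congr_fun measurableSet_Ioi fun σ hσ => ?_
  have hσa : 0 < σ + a := add_pos hσ ha
  rw [heat_thirdPartial_heatKernel j k l hσa hb, coe_thirdPartial_heatKernelSchwartz, add_assoc]

lemma integral_heatKernel_mul_oseenKernel (j k l : Fin 3) {a b : ℝ} (ha : 0 < a) (hb : 0 < b)
    (x y : E3) :
    ∫ z, heatKernel b (x - z) * oseenKernel j k l a (z - y) =
      oseenKernel j k l (a + b) (x - y) := by
  rw [← oseenConv_heatKernel j k l ha hb, oseenConv, ← integral_sub_left_eq_self _ volume x]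
  refine integral_congr_ae (Eventually.of_forall fun z => ?_)
  simp only [sub_sub_cancel, sub_right_comm x z y, mul_comm]

/-! ### Regularization of test functions by the heat flow -/

lemma heatKernel_le_heatKernel_two_mul {a : ℝ} (ha : 0 < a) (z : E3) :
    heatKernel a z ≤ 3 * (heatKernel (2 * a) z * Real.exp (-(‖z‖ ^ 2 / (8 * a)))) := by
  have hconst : (2 : ℝ) ^ (3 / 2 : ℝ) ≤ 3 := by
    have hsq : ((2 : ℝ) ^ (3 / 2 : ℝ)) ^ 2 = 8 := by
      rw [← Real.rpow_natCast, ← Real.rpow_mul (by norm_num)]; norm_num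
    nlinarith [Real.rpow_nonneg (zero_le_two (α := ℝ)) (3 / 2)]
  have hexp : -‖z‖ ^ 2 / (4 * (2 * a)) + -(‖z‖ ^ 2 / (8 * a)) = -‖z‖ ^ 2 / (4 * a) := by
    field_simp; ring
  have heq : heatKernel a z = 2 ^ (3 / 2 : ℝ) *
      (heatKernel (2 * a) z * Real.exp (-(‖z‖ ^ 2 / (8 * a)))) := by
    unfold heatKernel
    rw [show 4 * π * (2 * a) = 2 * (4 * π * a) by ring,
      Real.mul_rpow zero_le_two (by positivity), Real.rpow_neg zero_le_two (3 / 2),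
      mul_assoc _ (Real.exp _) (Real.exp _), ← Real.exp_add, hexp]
    field_simp
  rw [heq]
  gcongr
  exact mul_nonneg (heatKernel_pos (by positivity) z).le (Real.exp_pos _).le

lemma one_add_sq_sq_mul_exp_le {a : ℝ} (ha : 0 < a) (r : ℝ) :
    (1 + r ^ 2) ^ 2 * Real.exp (-(r ^ 2 / (8 * a))) ≤ 128 * (1 + a) ^ 2 := by
  rw [Real.exp_neg, ← div_eq_mul_inv, div_le_iff₀ (Real.exp_pos _)]
  have hquad := Real.quadratic_le_exp_of_nonneg (x := r ^ 2 / (8 * a)) (by positivity)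
  set y := r ^ 2 / (8 * a) with hy
  have hy0 : 0 ≤ y := by positivity
  have hr : r ^ 2 = 8 * a * y := by rw [hy]; field_simp
  have hlin : 1 + r ^ 2 ≤ (1 + a) * (1 + 8 * y) := by rw [hr]; nlinarith
  calc (1 + r ^ 2) ^ 2 ≤ ((1 + a) * (1 + 8 * y)) ^ 2 := by gcongr
    _ = (1 + a) ^ 2 * (1 + 8 * y) ^ 2 := by ring
    _ ≤ (1 + a) ^ 2 * (128 * (1 + y + y ^ 2 / 2)) := by gcongr; nlinarith
    _ ≤ (1 + a) ^ 2 * (128 * Real.exp y) := by gcongr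
    _ = 128 * (1 + a) ^ 2 * Real.exp y := by ring

lemma one_add_norm_sq_sq_mul_heatKernel_le {a : ℝ} (ha : 0 < a) (z : E3) :
    (1 + ‖z‖ ^ 2) ^ 2 * heatKernel a z ≤ 384 * (1 + a) ^ 2 * heatKernel (2 * a) z := by
  have hpos := heatKernel_pos (t := 2 * a) (by positivity) z
  calc (1 + ‖z‖ ^ 2) ^ 2 * heatKernel a z
      ≤ (1 + ‖z‖ ^ 2) ^ 2 * (3 * (heatKernel (2 * a) z * Real.exp (-(‖z‖ ^ 2 / (8 * a))))) := by
        gcongr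
        exact heatKernel_le_heatKernel_two_mul ha z
    _ = 3 * heatKernel (2 * a) z * ((1 + ‖z‖ ^ 2) ^ 2 * Real.exp (-(‖z‖ ^ 2 / (8 * a)))) := by ring
    _ ≤ 3 * heatKernel (2 * a) z * (128 * (1 + a) ^ 2) := by
        exact mul_le_mul_of_nonneg_left (one_add_sq_sq_mul_exp_le ha ‖z‖) (by positivity)
    _ = _ := by ring

lemma heatKernel_sub_mul_bracketWeight_le {a : ℝ} (ha : 0 < a) (x y : E3) :
    heatKernel a (x - y) * bracketWeight y ≤
      1536 * (1 + a) ^ 2 * bracketWeight x * heatKernel (2 * a) (x - y) := by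
  have hweight : bracketWeight y ≤ 4 * (1 + ‖x - y‖ ^ 2) ^ 2 * bracketWeight x := by
    simpa using bracketWeight_sub_le x (x - y)
  calc heatKernel a (x - y) * bracketWeight y
      ≤ heatKernel a (x - y) * (4 * (1 + ‖x - y‖ ^ 2) ^ 2 * bracketWeight x) :=
        mul_le_mul_of_nonneg_left hweight (heatKernel_pos ha _).le
    _ = 4 * bracketWeight x * ((1 + ‖x - y‖ ^ 2) ^ 2 * heatKernel a (x - y)) := by ring
    _ ≤ 4 * bracketWeight x * (384 * (1 + a) ^ 2 * heatKernel (2 * a) (x - y)) :=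
        mul_le_mul_of_nonneg_left (one_add_norm_sq_sq_mul_heatKernel_le ha _)
          (by linarith [bracketWeight_nonneg x])
    _ = _ := by ring

lemma nonneg_of_abs_le_mul_bracketWeight {f : E3 → ℝ} {C : ℝ}
    (hf : ∀ x, |f x| ≤ C * bracketWeight x) : 0 ≤ C :=
  nonneg_of_mul_nonneg_left ((abs_nonneg _).trans (hf 0)) (bracketWeight_pos 0)

lemma abs_heat_le_bracketWeight {f : E3 → ℝ} {C : ℝ} (hf : ∀ x, |f x| ≤ C * bracketWeight x)
    {a : ℝ} (ha : 0 < a) (x : E3) :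
    |heat a f x| ≤ C * (1536 * (1 + a) ^ 2) * bracketWeight x := by
  have h2a : 0 < 2 * a := by positivity
  have hC := nonneg_of_abs_le_mul_bracketWeight hf
  have hpointwise : ∀ y, ‖heatKernel a (x - y) * f y‖ ≤
      C * (1536 * (1 + a) ^ 2) * bracketWeight x * heatKernel (2 * a) (x - y) := fun y => by
    rw [norm_mul, Real.norm_of_nonneg (heatKernel_pos ha _).le]
    calc heatKernel a (x - y) * |f y| ≤ heatKernel a (x - y) * (C * bracketWeight y) :=
          mul_le_mul_of_nonneg_left (hf y) (heatKernel_pos ha _).le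
      _ = C * (heatKernel a (x - y) * bracketWeight y) := by ring
      _ ≤ C * (1536 * (1 + a) ^ 2 * bracketWeight x * heatKernel (2 * a) (x - y)) :=
          mul_le_mul_of_nonneg_left (heatKernel_sub_mul_bracketWeight_le ha x y) hC
      _ = _ := by ring
  refine (norm_integral_le_of_norm_le (((integrable_heatKernel h2a).comp_sub_left x).const_mul _)
    (Eventually.of_forall hpointwise)).trans_eq ?_
  rw [integral_const_mul, integral_sub_left_eq_self (heatKernel (2 * a)) volume x,
    integral_heatKernel h2a, mul_one]

lemma abs_heat_le_seminorm {t : ℝ} (ht : 0 < t) (φ : 𝓢(E3, ℝ)) (x : E3) :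
    |heat t φ x| ≤ SchwartzMap.seminorm ℝ 0 0 φ :=
  (abs_integral_le_integral_abs).trans (integral_abs_heatKernel_sub_mul_le_seminorm ht φ x)

lemma heatKernel_eq_scaling {a : ℝ} (ha : 0 < a) (z : E3) :
    heatKernel a z = (√a)⁻¹ ^ 3 * heatKernel 1 ((√a)⁻¹ • z) := by
  have hsqrt : 0 < √a := Real.sqrt_pos.2 ha
  have hconst : (4 * π * a) ^ (-(3 / 2) : ℝ) = (√a)⁻¹ ^ 3 * (4 * π * 1) ^ (-(3 / 2) : ℝ) := by
    rw [mul_one, Real.mul_rpow (by positivity) ha.le, mul_comm, Real.rpow_neg ha.le,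
      Real.sqrt_eq_rpow, inv_pow, ← Real.rpow_natCast, ← Real.rpow_mul ha.le]
    norm_num
  have hexp : -‖z‖ ^ 2 / (4 * a) = -((√a)⁻¹ * ‖z‖) ^ 2 / (4 * 1) := by
    rw [mul_pow, inv_pow, Real.sq_sqrt ha.le]; field_simp
  rw [heatKernel, heatKernel, hconst, hexp, norm_smul, norm_inv, Real.norm_of_nonneg hsqrt.le,
    mul_assoc]

lemma tendsto_norm_pow_mul_schwartz (n : ℕ) (φ : 𝓢(E3, ℝ)) :
    Tendsto (fun x => ‖x‖ ^ n * φ x) (Bornology.cobounded E3) (𝓝 0) := by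
  obtain ⟨C, -, hC⟩ := φ.decay (n + 1) 0
  have hlim : Tendsto (fun x : E3 => C * ‖x‖⁻¹) (Bornology.cobounded E3) (𝓝 0) := by
    simpa using (tendsto_norm_cobounded_atTop (E := E3)).inv_tendsto_atTop.const_mul C
  refine squeeze_zero_norm' ?_ hlim
  filter_upwards [tendsto_norm_cobounded_atTop.eventually_gt_atTop (0 : ℝ)] with x hx
  have hdecay : ‖x‖ ^ (n + 1) * ‖φ x‖ ≤ C := by simpa using hC x
  rw [norm_mul, norm_pow, norm_norm, ← div_eq_mul_inv, le_div_iff₀ hx]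
  calc _ = ‖x‖ ^ (n + 1) * ‖φ x‖ := by ring
    _ ≤ C := hdecay

lemma tendsto_heat {f : E3 → ℝ} (hf : Integrable f) {x : E3} (hfx : ContinuousAt f x) :
    Tendsto (fun a => heat a f x) (𝓝[>] 0) (𝓝 (f x)) := by
  have hdecay : Tendsto (fun x : E3 => ‖x‖ ^ Module.finrank ℝ E3 * heatKernel 1 x)
      (Bornology.cobounded E3) (𝓝 0) := by
    rw [← coe_heatKernelSchwartz one_pos]
    exact tendsto_norm_pow_mul_schwartz _ _
  have hpeak := tendsto_integral_comp_smul_smul_of_integrable'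
    (fun z => (heatKernel_pos one_pos z).le) (integral_heatKernel one_pos) hdecay hf hfx
  have hscale : Tendsto (fun a : ℝ => (√a)⁻¹) (𝓝[>] 0) atTop := by
    refine tendsto_inv_nhdsGT_zero.comp (tendsto_nhdsWithin_iff.2 ⟨?_, ?_⟩)
    · exact (Real.continuous_sqrt.tendsto' 0 0 Real.sqrt_zero).mono_left nhdsWithin_le_nhds
    · exact eventually_mem_nhdsWithin.mono fun a ha => Real.sqrt_pos.2 ha
  refine (hpeak.comp hscale).congr' ?_
  filter_upwards [eventually_mem_nhdsWithin] with a ha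
  simp only [Function.comp_apply, heat, heatKernel_eq_scaling ha, smul_eq_mul,
    finrank_euclideanSpace_fin]

lemma exists_abs_schwartz_le_bracketWeight (φ : 𝓢(E3, ℝ)) :
    ∃ C, ∀ x, |φ x| ≤ C * bracketWeight x := by
  obtain ⟨C₀, -, hdecay₀⟩ := φ.decay 0 0
  obtain ⟨C₄, -, hdecay₄⟩ := φ.decay 4 0
  refine ⟨2 * C₀ + 2 * C₄, fun x => ?_⟩
  have h0 : |φ x| ≤ C₀ := by simpa using hdecay₀ x
  have h4 : ‖x‖ ^ 4 * |φ x| ≤ C₄ := by simpa using hdecay₄ x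
  unfold bracketWeight
  rw [← div_eq_mul_inv, le_div_iff₀ (by positivity)]
  nlinarith [abs_nonneg (φ x), mul_nonneg (abs_nonneg (φ x)) (sq_nonneg (1 - ‖x‖ ^ 2))]

lemma integrable_abs_schwartz_mul_one_add_norm_sq_sq (φ : 𝓢(E3, ℝ)) :
    Integrable (fun x => |φ x| * (1 + ‖x‖ ^ 2) ^ 2) := by
  refine (((φ.integrable_pow_mul (μ := volume) 0).add
    ((φ.integrable_pow_mul (μ := volume) 2).const_mul 2)).add
    (φ.integrable_pow_mul (μ := volume) 4)).congr (Eventually.of_forall fun x => ?_)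
  simp only [Pi.add_apply, Real.norm_eq_abs]
  ring

/-! ### The regularized symbols -/

lemma integrableOn_heat_add {a : ℝ} (ha : 0 < a) (φ : 𝓢(E3, ℝ)) (x : E3) :
    IntegrableOn (fun σ => heat (σ + a) φ x) (Set.Ioi 0) := by
  have hshift := ((measurePreserving_add_right (volume : Measure ℝ) a).integrableOn_comp_preimage
    (measurableEmbedding_addRight a) (f := fun σ => heat σ φ x) (s := Set.Ioi a)).2
    ((integrableOn_heat φ x).mono_set (Set.Ioi_subset_Ioi ha.le))
  rwa [Set.preimage_add_const_Ioi, sub_self] at hshift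

lemma setIntegral_Ioi_comp_add_right {E : Type*} [NormedAddCommGroup E] [NormedSpace ℝ E]
    (f : ℝ → E) (a b : ℝ) : ∫ σ in Set.Ioi b, f (σ + a) = ∫ σ in Set.Ioi (b + a), f σ := by
  rw [← (measurePreserving_add_right (volume : Measure ℝ) a).setIntegral_preimage_emb
    (measurableEmbedding_addRight a) f, Set.preimage_add_const_Ioi, add_sub_cancel_right]

lemma setIntegral_Ioi_eq_Ioc_add_Ioi {E : Type*} [NormedAddCommGroup E] [NormedSpace ℝ E]
    {f : ℝ → E} {a b : ℝ} (hab : a ≤ b) (hf : IntegrableOn f (Set.Ioi a)) :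
    ∫ σ in Set.Ioi a, f σ = (∫ σ in Set.Ioc a b, f σ) + ∫ σ in Set.Ioi b, f σ := by
  rw [← Set.Ioc_union_Ioi_eq_Ioi hab, setIntegral_union (Set.Ioc_disjoint_Ioi le_rfl)
    measurableSet_Ioi (hf.mono_set Set.Ioc_subset_Ioi_self)
    (hf.mono_set (Set.Ioi_subset_Ioi hab))]

lemma tendsto_setIntegral_Ioi_heat_add (φ : 𝓢(E3, ℝ)) (x : E3) :
    Tendsto (fun a => ∫ σ in Set.Ioi 0, heat (σ + a) φ x) (𝓝[>] 0)
      (𝓝 (∫ σ in Set.Ioi 0, heat σ φ x)) := by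
  have hinitial : Tendsto (fun a => ∫ σ in Set.Ioc 0 a, heat σ φ x) (𝓝[>] 0) (𝓝 0) := by
    have hlim : Tendsto (fun a => SchwartzMap.seminorm ℝ 0 0 φ * a) (𝓝[>] 0) (𝓝 0) :=
      ((continuous_const.mul continuous_id).tendsto' 0 0 (by simp)).mono_left nhdsWithin_le_nhds
    refine squeeze_zero_norm' ?_ hlim
    filter_upwards [eventually_mem_nhdsWithin] with a ha
    simpa [Measure.real, (Set.mem_Ioi.1 ha).le] using norm_setIntegral_le_of_norm_le_const
      (μ := volume) (s := Set.Ioc 0 a) (f := fun σ => heat σ φ x) (by simp)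
      fun σ hσ => abs_heat_le_seminorm hσ.1 φ x
  have hdiff := (tendsto_const_nhds (x := ∫ σ in Set.Ioi 0, heat σ φ x)).sub hinitial
  rw [sub_zero] at hdiff
  refine hdiff.congr' ?_
  filter_upwards [eventually_mem_nhdsWithin] with a ha
  rw [setIntegral_Ioi_comp_add_right (fun σ => heat σ φ x), zero_add,
    setIntegral_Ioi_eq_Ioc_add_Ioi (Set.mem_Ioi.1 ha).le (integrableOn_heat φ x),
    add_sub_cancel_left]

lemma tendsto_oseenConv (j k l : Fin 3) (φ : 𝓢(E3, ℝ)) (x : E3) :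
    Tendsto (fun a => oseenConv j k l a φ x) (𝓝[>] 0) (𝓝 (lerayDeriv j k l φ x)) := by
  have hlocal : Tendsto (fun a => heat a (schwartzPartial j φ) x) (𝓝[>] 0)
      (𝓝 (partialDeriv j φ x)) := by
    rw [← coe_schwartzPartial]
    exact tendsto_heat (SchwartzMap.integrable _) (SchwartzMap.continuous _).continuousAt
  rw [lerayDeriv_eq]
  refine ((hlocal.const_mul _).add (tendsto_setIntegral_Ioi_heat_add _ x)).congr' ?_
  filter_upwards [eventually_mem_nhdsWithin] with a ha
  exact (oseenConv_eq j k l ha φ x).symm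

lemma abs_setIntegral_heatKernelD3_sub_le (j k l : Fin 3) {a : ℝ} (ha : 0 < a) (x y : E3) :
    |∫ σ in Set.Ioi (1 : ℝ), heatKernelD3 j k l (σ + a) (x - y)| ≤
      2112 * (4 * (1 + ‖y‖ ^ 2) ^ 2 * bracketWeight x) := by
  have hweight : ((1 + a + ‖x - y‖ ^ 2) ^ 2)⁻¹ ≤ bracketWeight (x - y) := by
    unfold bracketWeight
    gcongr
    linarith
  calc _ ≤ ∫ σ in Set.Ioi (1 : ℝ), |heatKernelD3 j k l (σ + a) (x - y)| :=
        abs_integral_le_integral_abs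
    _ ≤ 2112 * ((1 + a + ‖x - y‖ ^ 2) ^ 2)⁻¹ :=
        integral_abs_heatKernelD3_le j k l (by linarith) (x - y)
    _ ≤ _ := by
        gcongr
        exact hweight.trans (bracketWeight_sub_le x y)

lemma abs_setIntegral_Ioi_one_heat_thirdPartial_le (j k l : Fin 3) (φ : 𝓢(E3, ℝ)) {a : ℝ}
    (ha : 0 < a) (x : E3) :
    |∫ σ in Set.Ioi (1 : ℝ), heat (σ + a) (thirdPartial j k l φ) x| ≤
      2112 * 4 * (∫ y, |φ y| * (1 + ‖y‖ ^ 2) ^ 2) * bracketWeight x := by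
  rw [setIntegral_heat_thirdPartial j k l (by linarith) φ x]
  have hpointwise : ∀ y, ‖(∫ σ in Set.Ioi (1 : ℝ), heatKernelD3 j k l (σ + a) (x - y)) * φ y‖ ≤
      2112 * 4 * bracketWeight x * (|φ y| * (1 + ‖y‖ ^ 2) ^ 2) := fun y => by
    rw [norm_mul]
    calc _ ≤ 2112 * (4 * (1 + ‖y‖ ^ 2) ^ 2 * bracketWeight x) * |φ y| :=
          mul_le_mul_of_nonneg_right (abs_setIntegral_heatKernelD3_sub_le j k l ha x y)
            (abs_nonneg _)
      _ = _ := by ring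
  refine (norm_integral_le_of_norm_le
    ((integrable_abs_schwartz_mul_one_add_norm_sq_sq φ).const_mul _)
    (Eventually.of_forall hpointwise)).trans_eq ?_
  rw [integral_const_mul]
  ring

lemma abs_setIntegral_Ioc_heat_le {φ : 𝓢(E3, ℝ)} {C : ℝ}
    (hφ : ∀ x, |φ x| ≤ C * bracketWeight x) {a : ℝ} (ha : 0 < a) (ha1 : a ≤ 1) (x : E3) :
    |∫ σ in Set.Ioc (0 : ℝ) 1, heat (σ + a) φ x| ≤ C * (1536 * 3 ^ 2) * bracketWeight x := by
  have hC := nonneg_of_abs_le_mul_bracketWeight hφ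
  have hw := bracketWeight_nonneg x
  have hbound : ∀ σ ∈ Set.Ioc (0 : ℝ) 1,
      ‖heat (σ + a) φ x‖ ≤ C * (1536 * 3 ^ 2) * bracketWeight x := fun σ ⟨hσ0, hσ1⟩ => by
    refine (abs_heat_le_bracketWeight hφ (add_pos hσ0 ha) x).trans ?_
    gcongr
    linarith
  simpa [Measure.real] using norm_setIntegral_le_of_norm_le_const (μ := volume) (by simp) hbound

lemma exists_abs_oseenConv_le (j k l : Fin 3) (φ : 𝓢(E3, ℝ)) :
    ∃ C, ∀ a, 0 < a → a ≤ 1 → ∀ x, |oseenConv j k l a φ x| ≤ C * bracketWeight x := by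
  obtain ⟨C₁, hφ₁⟩ := exists_abs_schwartz_le_bracketWeight (schwartzPartial j φ)
  obtain ⟨C₃, hφ₃⟩ := exists_abs_schwartz_le_bracketWeight (thirdPartial j k l φ)
  refine ⟨C₁ * (1536 * 2 ^ 2) + C₃ * (1536 * 3 ^ 2) +
    2112 * 4 * ∫ y, |φ y| * (1 + ‖y‖ ^ 2) ^ 2, fun a ha ha1 x => ?_⟩
  have hC₁ := nonneg_of_abs_le_mul_bracketWeight hφ₁
  have hw := bracketWeight_nonneg x
  have hlocal : |kronecker k l * heat a (schwartzPartial j φ) x| ≤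
      C₁ * (1536 * 2 ^ 2) * bracketWeight x := by
    rw [abs_mul]
    calc _ ≤ 1 * (C₁ * (1536 * (1 + a) ^ 2) * bracketWeight x) :=
          mul_le_mul (abs_kronecker_le_one k l) (abs_heat_le_bracketWeight hφ₁ ha x)
            (abs_nonneg _) zero_le_one
      _ ≤ 1 * (C₁ * (1536 * 2 ^ 2) * bracketWeight x) := by gcongr; linarith
      _ = _ := one_mul _
  have hnear := abs_setIntegral_Ioc_heat_le hφ₃ ha ha1 x
  have hfar := abs_setIntegral_Ioi_one_heat_thirdPartial_le j k l φ ha x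
  rw [oseenConv_eq j k l ha, setIntegral_Ioi_eq_Ioc_add_Ioi zero_le_one
    (integrableOn_heat_add ha _ x), ← add_assoc]
  refine (abs_add_three _ _ _).trans ?_
  linarith

lemma exists_abs_lerayDeriv_le (j k l : Fin 3) (φ : 𝓢(E3, ℝ)) :
    ∃ C, ∀ x, |lerayDeriv j k l φ x| ≤ C * bracketWeight x := by
  obtain ⟨C, hC⟩ := exists_abs_oseenConv_le j k l φ
  refine ⟨C, fun x => le_of_tendsto (tendsto_oseenConv j k l φ x).abs ?_⟩
  filter_upwards [Ioc_mem_nhdsGT zero_lt_one] with a ha using hC a ha.1 ha.2 x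

/-! ### Pairing kernels with weighted integrable functions -/

/-- Functions that are integrable against the weight `(1 + |x|²)⁻²`, the rate of decay of the Oseen
kernel. Products of two components of a `WeightedL2` field are of this kind. -/
def WeightedL1 (f : E3 → ℝ) : Prop := Integrable fun x => f x * bracketWeight x

lemma aestronglyMeasurable_of_integrable_mul_bracketWeight {X : Type*} [MeasurableSpace X]
    {μ : Measure X} {f : X → ℝ} {w : X → E3} (hw : AEStronglyMeasurable w μ)
    (hf : Integrable (fun x => f x * bracketWeight (w x)) μ) : AEStronglyMeasurable f μ := by
  refine (hf.1.mul ((continuous_bracketWeight.inv₀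
    fun y => (bracketWeight_pos y).ne').comp_aestronglyMeasurable hw)).congr
      (Eventually.of_forall fun x => ?_)
  exact mul_inv_cancel_right₀ (bracketWeight_pos (w x)).ne' _

lemma WeightedL1.aestronglyMeasurable {P : E3 → ℝ} (hP : WeightedL1 P) :
    AEStronglyMeasurable P :=
  aestronglyMeasurable_of_integrable_mul_bracketWeight aestronglyMeasurable_id hP

lemma weightedL1_of_integrable {f : E3 → ℝ} (hf : Integrable f) : WeightedL1 f :=
  hf.mul_bdd (c := 1) continuous_bracketWeight.aestronglyMeasurable
    (Eventually.of_forall fun x => by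
      rw [Real.norm_of_nonneg (bracketWeight_nonneg x)]
      exact bracketWeight_le_one x)

lemma weightedL1_const (c : ℝ) : WeightedL1 fun _ => c :=
  (integrable_bracketWeight volume (by simp)).const_mul c

lemma WeightedL1.integrable_mul {P g : E3 → ℝ} {C : ℝ} (hP : WeightedL1 P)
    (hg : AEStronglyMeasurable g) (hgC : ∀ x, |g x| ≤ C * bracketWeight x) :
    Integrable fun x => P x * g x := by
  refine (hP.abs.const_mul C).mono' (hP.aestronglyMeasurable.mul hg)
    (Eventually.of_forall fun x => ?_)
  rw [norm_mul, abs_mul, abs_of_pos (bracketWeight_pos x)]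
  calc ‖P x‖ * ‖g x‖ ≤ |P x| * (C * bracketWeight x) :=
        mul_le_mul_of_nonneg_left (hgC x) (abs_nonneg _)
    _ = _ := by ring

lemma WeightedL1.tendsto_integral_mul {P g : E3 → ℝ} {C : ℝ} {ι : Type*} {𝓕 : Filter ι}
    [𝓕.IsCountablyGenerated] {F : ι → E3 → ℝ} (hP : WeightedL1 P)
    (hF : ∀ᶠ i in 𝓕, AEStronglyMeasurable (F i) ∧ ∀ x, |F i x| ≤ C * bracketWeight x)
    (hlim : ∀ x, Tendsto (fun i => F i x) 𝓕 (𝓝 (g x))) :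
    Tendsto (fun i => ∫ x, P x * F i x) 𝓕 (𝓝 (∫ x, P x * g x)) := by
  refine tendsto_integral_filter_of_dominated_convergence (fun x => C * |P x * bracketWeight x|)
    (hF.mono fun i hi => hP.aestronglyMeasurable.mul hi.1)
    (hF.mono fun i hi => Eventually.of_forall fun x => ?_) (hP.abs.const_mul C)
    (Eventually.of_forall fun x => (hlim x).const_mul _)
  rw [norm_mul, abs_mul, abs_of_pos (bracketWeight_pos x)]
  calc ‖P x‖ * ‖F i x‖ ≤ |P x| * (C * bracketWeight x) :=
        mul_le_mul_of_nonneg_left (hi.2 x) (abs_nonneg _)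
    _ = _ := by ring

section Kernel

variable {K : E3 → ℝ} {C : ℝ}

lemma abs_comp_sub_le_bracketWeight (hK : ∀ z, |K z| ≤ C * bracketWeight z) (x y : E3) :
    |K (x - y)| ≤ 4 * C * (1 + ‖x‖ ^ 2) ^ 2 * bracketWeight y := by
  have hC := nonneg_of_abs_le_mul_bracketWeight hK
  calc |K (x - y)| ≤ C * bracketWeight (x - y) := hK _
    _ = C * bracketWeight (y - x) := by rw [← bracketWeight_neg, neg_sub]
    _ ≤ C * (4 * (1 + ‖x‖ ^ 2) ^ 2 * bracketWeight y) := by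
        gcongr
        exact bracketWeight_sub_le y x
    _ = _ := by ring

variable {P : E3 → ℝ}

lemma WeightedL1.integrable_kernel_mul (hP : WeightedL1 P) (hKc : Continuous K)
    (hK : ∀ z, |K z| ≤ C * bracketWeight z) (x : E3) :
    Integrable (fun y => K (x - y) * P y) := by
  simpa only [mul_comm] using hP.integrable_mul (g := fun y => K (x - y))
    (hKc.comp (by fun_prop)).aestronglyMeasurable (abs_comp_sub_le_bracketWeight hK x)

lemma WeightedL1.continuous_kernel_integral (hP : WeightedL1 P) (hKc : Continuous K)
    (hK : ∀ z, |K z| ≤ C * bracketWeight z) : Continuous (fun x => ∫ y, K (x - y) * P y) := by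
  have hC := nonneg_of_abs_le_mul_bracketWeight hK
  refine continuous_iff_continuousAt.2 fun x₀ => ?_
  simp_rw [mul_comm (K _)]
  refine hP.tendsto_integral_mul (C := 4 * C * (1 + (‖x₀‖ + 1) ^ 2) ^ 2) ?_
    fun y => (hKc.comp (by fun_prop : Continuous fun x : E3 => x - y)).continuousAt
  filter_upwards [Metric.ball_mem_nhds x₀ one_pos] with x hx
  refine ⟨(hKc.comp (by fun_prop)).aestronglyMeasurable,
    fun y => (abs_comp_sub_le_bracketWeight hK x y).trans ?_⟩
  have hnorm : ‖x‖ ≤ ‖x₀‖ + 1 := by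
    linarith [norm_le_norm_add_norm_sub' x x₀, mem_ball_iff_norm.1 hx]
  have hw := bracketWeight_nonneg y
  gcongr

lemma WeightedL1.integrable_schwartz_mul_kernel_prod (hP : WeightedL1 P) (hKc : Continuous K)
    (hK : ∀ z, |K z| ≤ C * bracketWeight z) (φ : 𝓢(E3, ℝ)) :
    Integrable (fun p : E3 × E3 => φ p.1 * (K (p.1 - p.2) * P p.2)) := by
  refine (((integrable_abs_schwartz_mul_one_add_norm_sq_sq φ).const_mul (4 * C)).mul_prod
    hP.abs).mono' ((φ.continuous.comp continuous_fst).aestronglyMeasurable.mul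
      ((hKc.comp (by fun_prop)).aestronglyMeasurable.mul hP.aestronglyMeasurable.comp_snd))
    (Eventually.of_forall fun p => ?_)
  rw [norm_mul, norm_mul, abs_mul, abs_of_pos (bracketWeight_pos p.2)]
  calc _ ≤ |φ p.1| * ((4 * C * (1 + ‖p.1‖ ^ 2) ^ 2 * bracketWeight p.2) * |P p.2|) :=
        mul_le_mul_of_nonneg_left (mul_le_mul_of_nonneg_right
          (abs_comp_sub_le_bracketWeight hK p.1 p.2) (abs_nonneg _)) (abs_nonneg _)
    _ = _ := by ring

lemma WeightedL1.integral_schwartz_mul_kernel_integral (hP : WeightedL1 P) (hKc : Continuous K)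
    (hK : ∀ z, |K z| ≤ C * bracketWeight z) (hKodd : ∀ z, K (-z) = -K z) (φ : 𝓢(E3, ℝ)) :
    ∫ x, φ x * ∫ y, K (x - y) * P y = -∫ y, P y * ∫ x, K (y - x) * φ x := by
  have hswap := integral_integral_swap (f := fun x y => φ x * (K (x - y) * P y))
    (hP.integrable_schwartz_mul_kernel_prod hKc hK φ)
  simp_rw [integral_const_mul] at hswap
  rw [hswap, ← integral_neg]
  congr 1 with y
  rw [← mul_neg, ← integral_neg, ← integral_const_mul]
  congr 1 with x
  rw [← neg_sub y x, hKodd]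
  ring

end Kernel

section HeatKernel

variable {t : ℝ} {f : E3 → ℝ}

lemma exists_abs_heatKernel_le_bracketWeight (ht : 0 < t) :
    ∃ C, ∀ z, |heatKernel t z| ≤ C * bracketWeight z :=
  coe_heatKernelSchwartz ht ▸ exists_abs_schwartz_le_bracketWeight (heatKernelSchwartz ht)

lemma WeightedL1.integrable_heatKernel_mul (hf : WeightedL1 f) (ht : 0 < t) (x : E3) :
    Integrable (fun y => heatKernel t (x - y) * f y) :=
  (exists_abs_heatKernel_le_bracketWeight ht).elim fun _ hC =>
    hf.integrable_kernel_mul (continuous_heatKernel ht) hC x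

lemma WeightedL1.continuous_heat (hf : WeightedL1 f) (ht : 0 < t) : Continuous (heat t f) :=
  (exists_abs_heatKernel_le_bracketWeight ht).elim fun _ hC =>
    hf.continuous_kernel_integral (continuous_heatKernel ht) hC

end HeatKernel

lemma continuous_oseenConv (j k l : Fin 3) {a : ℝ} (ha : 0 < a) {f : E3 → ℝ} (hf : WeightedL1 f) :
    Continuous (oseenConv j k l a f) :=
  hf.continuous_kernel_integral (continuous_oseenKernel j k l ha)
    (abs_oseenKernel_le_bracketWeight j k l ha)

lemma aestronglyMeasurable_lerayDeriv (j k l : Fin 3) (φ : 𝓢(E3, ℝ)) :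
    AEStronglyMeasurable (lerayDeriv j k l φ) := by
  obtain ⟨a, -, hpos, ha⟩ := exists_seq_strictAnti_tendsto (0 : ℝ)
  exact aestronglyMeasurable_of_tendsto_ae atTop
    (fun n => (continuous_oseenConv j k l (hpos n)
      (weightedL1_of_integrable φ.integrable)).aestronglyMeasurable)
    (Eventually.of_forall fun x => (tendsto_oseenConv j k l φ x).comp
      (tendsto_nhdsWithin_iff.2 ⟨ha, Eventually.of_forall hpos⟩))

lemma tendsto_integral_mul_oseenConv (j k l : Fin 3) {P : E3 → ℝ} (hP : WeightedL1 P)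
    (φ : 𝓢(E3, ℝ)) :
    Tendsto (fun a => ∫ y, P y * oseenConv j k l a φ y) (𝓝[>] 0)
      (𝓝 (∫ y, P y * lerayDeriv j k l φ y)) := by
  obtain ⟨C, hC⟩ := exists_abs_oseenConv_le j k l φ
  refine hP.tendsto_integral_mul (C := C) ?_ (tendsto_oseenConv j k l φ)
  filter_upwards [Ioc_mem_nhdsGT zero_lt_one] with a ha
  exact ⟨(continuous_oseenConv j k l ha.1
    (weightedL1_of_integrable φ.integrable)).aestronglyMeasurable, hC a ha.1 ha.2⟩

lemma sum_integral_lerayDeriv_eq_zero (l : Fin 3) {P : Fin 3 → Fin 3 → E3 → ℝ}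
    (hP : ∀ j k, WeightedL1 (P j k))
    (hzero : ∃ᶠ a in 𝓝[>] 0, ∀ x, ∑ j, ∑ k, oseenConv j k l a (P j k) x = 0) (φ : 𝓢(E3, ℝ)) :
    ∑ j, ∑ k, ∫ y, P j k y * lerayDeriv j k l φ y = 0 := by
  have hlim : Tendsto (fun a => ∑ j, ∑ k, ∫ y, P j k y * oseenConv j k l a φ y) (𝓝[>] 0)
      (𝓝 (∑ j, ∑ k, ∫ y, P j k y * lerayDeriv j k l φ y)) :=
    tendsto_finsetSum _ fun j _ => tendsto_finsetSum _ fun k _ =>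
      tendsto_integral_mul_oseenConv j k l (hP j k) φ
  refine (isClosed_singleton (x := (0 : ℝ))).mem_of_frequently_of_tendsto
    ((hzero.and_eventually eventually_mem_nhdsWithin).mono fun a ⟨hzero, ha⟩ => ?_) hlim
  have hdual : ∀ j k, ∫ x, φ x * oseenConv j k l a (P j k) x =
      -∫ y, P j k y * oseenConv j k l a φ y := fun j k =>
    (hP j k).integral_schwartz_mul_kernel_integral (continuous_oseenKernel j k l ha)
      (abs_oseenKernel_le_bracketWeight j k l ha) (fun z => oseenKernel_neg j k l ha z) φ
  have hint : ∀ j k, Integrable fun x => φ x * oseenConv j k l a (P j k) x := fun j k => by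
    simpa only [oseenConv, integral_const_mul] using
      ((hP j k).integrable_schwartz_mul_kernel_prod (continuous_oseenKernel j k l ha)
        (abs_oseenKernel_le_bracketWeight j k l ha) φ).integral_prod_left
  have htest : ∫ x, φ x * ∑ j, ∑ k, oseenConv j k l a (P j k) x = 0 := by simp [hzero]
  simp_rw [Finset.mul_sum] at htest
  rw [integral_finsetSum _ fun j _ => integrable_finsetSum _ fun k _ => hint j k] at htest
  simp_rw [integral_finsetSum _ fun k _ => hint _ k, hdual, Finset.sum_neg_distrib] at htest
  exact neg_eq_zero.1 htest

lemma abs_partialDeriv_heatKernel_le_bracketWeight (j : Fin 3) {t : ℝ} (ht : 0 < t) (x : E3) :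
    |partialDeriv j (heatKernel t) x| ≤ 128 * (1 + t⁻¹) ^ 2 * bracketWeight x := by
  calc _ ≤ (t ^ 2)⁻¹ * Real.exp (-(‖x‖ ^ 2 / (8 * t))) := abs_partialDeriv_heatKernel_le j ht x
    _ ≤ 128 * ((t + ‖x‖ ^ 2) ^ 2)⁻¹ := inv_sq_mul_exp_le ht
    _ ≤ 128 * ((1 + t⁻¹) ^ 2 * bracketWeight x) := by
        gcongr
        exact inv_add_norm_sq_le_bracketWeight ht x
    _ = _ := by ring

lemma continuous_partialDeriv_heatKernel (j : Fin 3) {t : ℝ} (ht : 0 < t) :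
    Continuous (partialDeriv j (heatKernel t)) := by
  rw [← coe_heatKernelSchwartz ht, ← coe_schwartzPartial]
  exact SchwartzMap.continuous _

lemma tendsto_integral_mul_heat {f : E3 → ℝ} (hf : WeightedL1 f) (φ : 𝓢(E3, ℝ)) :
    Tendsto (fun a => ∫ y, f y * heat a φ y) (𝓝[>] 0) (𝓝 (∫ y, f y * φ y)) := by
  obtain ⟨C, hC⟩ := exists_abs_schwartz_le_bracketWeight φ
  have hC0 := nonneg_of_abs_le_mul_bracketWeight hC
  refine hf.tendsto_integral_mul (C := C * (1536 * 2 ^ 2)) ?_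
    fun x => tendsto_heat φ.integrable φ.continuous.continuousAt
  filter_upwards [Ioc_mem_nhdsGT zero_lt_one] with a ha
  refine ⟨?_, fun x => (abs_heat_le_bracketWeight hC ha.1 x).trans ?_⟩
  · exact ((weightedL1_of_integrable φ.integrable).continuous_heat ha.1).aestronglyMeasurable
  · have hw := bracketWeight_nonneg x
    have ha0 := ha.1
    gcongr
    linarith [ha.2]

lemma integral_partialDeriv_eq_zero_of_heatKernel (r : Fin 3) {f : E3 → ℝ} (hf : WeightedL1 f)
    (hzero : ∃ᶠ a in 𝓝[>] 0, ∀ x, ∫ y, partialDeriv r (heatKernel a) (x - y) * f y = 0)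
    (φ : 𝓢(E3, ℝ)) : ∫ y, f y * partialDeriv r φ y = 0 := by
  rw [← coe_schwartzPartial]
  refine (isClosed_singleton (x := (0 : ℝ))).mem_of_frequently_of_tendsto
    ((hzero.and_eventually eventually_mem_nhdsWithin).mono fun a ⟨hzero, ha⟩ => ?_)
    (tendsto_integral_mul_heat hf (schwartzPartial r φ))
  have hdual := hf.integral_schwartz_mul_kernel_integral (continuous_partialDeriv_heatKernel r ha)
    (abs_partialDeriv_heatKernel_le_bracketWeight r ha)
    (fun z => partialDeriv_heatKernel_neg r a z) φ
  simp_rw [hzero, mul_zero, integral_zero, ← heat_schwartzPartial r ha φ] at hdual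
  exact neg_eq_zero.1 hdual.symm

lemma oseenConv_const (j k l : Fin 3) {a : ℝ} (ha : 0 < a) (c : ℝ) (x : E3) :
    oseenConv j k l a (fun _ => c) x = 0 := by
  rw [oseenConv, integral_mul_const, integral_sub_left_eq_self (oseenKernel j k l a) volume x,
    integral_oseenKernel j k l ha, zero_mul]

lemma integral_lerayDeriv (j k l : Fin 3) (φ : 𝓢(E3, ℝ)) : ∫ y, lerayDeriv j k l φ y = 0 := by
  have hlim := tendsto_integral_mul_oseenConv j k l (weightedL1_const 1) φ
  simp_rw [one_mul] at hlim
  refine tendsto_nhds_unique (hlim.congr' ?_) tendsto_const_nhds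
  filter_upwards [eventually_mem_nhdsWithin] with a ha
  have hdual := (weightedL1_const 1).integral_schwartz_mul_kernel_integral
    (continuous_oseenKernel j k l ha) (abs_oseenKernel_le_bracketWeight j k l ha)
    (fun z => oseenKernel_neg j k l ha z) φ
  change ∫ x, φ x * oseenConv j k l a (fun _ => 1) x =
    -∫ y, 1 * oseenConv j k l a φ y at hdual
  simpa only [oseenConv_const j k l ha, mul_zero, integral_zero, one_mul, zero_eq_neg] using hdual

/-! ### Functions of time with vanishing primitive -/

section Primitive

variable {F : Type*} [NormedAddCommGroup F] [NormedSpace ℝ F] [CompleteSpace F] {g : ℝ → F}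
  {a b : ℝ}

lemma ae_eq_zero_of_ae_intervalIntegral_eq_zero (hg : IntervalIntegrable g volume a b)
    (h : ∀ᵐ t, t ∈ Set.Ioo a b → ∫ s in a..t, g s = 0) :
    ∀ᵐ s, s ∈ Set.Ioo a b → g s = 0 := by
  have hcont : ContinuousOn (fun t => ∫ s in a..t, g s) (Set.Ioo a b) :=
    (intervalIntegral.continuousOn_primitive_interval' hg Set.left_mem_uIcc).mono
      (Set.Ioo_subset_Icc_self.trans Set.Icc_subset_uIcc)
  have hzero : Set.EqOn (fun t => ∫ s in a..t, g s) (fun _ => 0) (Set.Ioo a b) :=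
    Measure.eqOn_Ioo_of_ae_eq volume ((ae_restrict_iff' measurableSet_Ioo).2 h) hcont
      continuousOn_const
  filter_upwards [hg.ae_hasDerivAt_integral] with s hs hmem
  have hderiv := hs (Set.Icc_subset_uIcc (Set.Ioo_subset_Icc_self hmem)) a Set.left_mem_uIcc
  exact hderiv.unique ((hasDerivAt_const s 0).congr_of_eventuallyEq
    (hzero.eventuallyEq_of_mem (isOpen_Ioo.mem_nhds hmem)))

lemma ae_eq_zero_of_ae_setIntegral_Ioo_eq_zero
    (h : ∀ᵐ t ∂volume.restrict (Set.Ioo a b),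
      IntegrableOn g (Set.Ioo a t) ∧ ∫ s in Set.Ioo a t, g s = 0) :
    ∀ᵐ s ∂volume.restrict (Set.Ioo a b), g s = 0 := by
  rw [ae_restrict_iff' measurableSet_Ioo] at h ⊢
  refine ae_of_mem_of_ae_of_mem_inter_Ioo fun _ c _ hc _ => ?_
  have hne : (ae (volume.restrict (Set.Ioo c b))).NeBot := by
    rw [ae_restrict_neBot]
    simp [hc.2]
  obtain ⟨d, ⟨hcd, hdb⟩, hd⟩ := ((ae_restrict_mem measurableSet_Ioo).and
    (ae_restrict_of_ae (s := Set.Ioo c b) h)).exists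
  have hint := (hd ⟨hc.1.trans hcd, hdb⟩).1
  have hgd : IntervalIntegrable g volume a d :=
    (intervalIntegrable_iff_integrableOn_Ioo_of_le (hc.1.trans hcd).le).2 hint
  have hgc := ae_eq_zero_of_ae_intervalIntegral_eq_zero hgd (by
    filter_upwards [h] with t ht hat
    rw [intervalIntegral.integral_of_le hat.1.le, integral_Ioc_eq_integral_Ioo]
    exact (ht ⟨hat.1, hat.2.trans hdb⟩).2)
  filter_upwards [hgc] with s hs hmem
  exact hs ⟨hmem.1.1, hmem.2.2.trans hcd⟩

end Primitive

/-! ### Regularized Duhamel integrals -/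

lemma inv_add_norm_sq_sq_eq {E : Type*} [NormedAddCommGroup E] [NormedSpace ℝ E] {τ : ℝ}
    (hτ : 0 < τ) (z : E) :
    ((τ + ‖z‖ ^ 2) ^ 2)⁻¹ = (τ ^ 2)⁻¹ * bracketWeight ((√τ)⁻¹ • z) := by
  rw [bracketWeight, norm_smul, mul_pow, norm_inv, Real.norm_of_nonneg (Real.sqrt_nonneg τ),
    inv_pow, Real.sq_sqrt hτ.le]
  field_simp

lemma integrable_inv_add_norm_sq_sq {τ : ℝ} (hτ : 0 < τ) :
    Integrable fun z : E3 => ((τ + ‖z‖ ^ 2) ^ 2)⁻¹ := by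
  simp_rw [inv_add_norm_sq_sq_eq hτ]
  exact ((integrable_bracketWeight volume (by simp)).comp_smul
    (inv_ne_zero (Real.sqrt_pos.2 hτ).ne')).const_mul _

lemma integral_inv_add_norm_sq_sq {τ : ℝ} (hτ : 0 < τ) :
    ∫ z : E3, ((τ + ‖z‖ ^ 2) ^ 2)⁻¹ =
      τ ^ (-(1 / 2) : ℝ) * ∫ z : E3, bracketWeight z := by
  simp_rw [inv_add_norm_sq_sq_eq hτ]
  rw [integral_const_mul, Measure.integral_comp_inv_smul volume bracketWeight (√τ),
    finrank_euclideanSpace, Fintype.card_fin, smul_eq_mul, abs_of_pos (by positivity), ← mul_assoc,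
    Real.rpow_neg hτ.le, ← Real.sqrt_eq_rpow]
  congr 1
  nth_rewrite 1 [← Real.sq_sqrt hτ.le]
  field_simp

lemma one_add_norm_sq_sq_mul_heatKernel_sub_le {b : ℝ} (hb : 0 < b) (x' x : E3) :
    (1 + ‖x‖ ^ 2) ^ 2 * heatKernel b (x' - x) ≤
      1536 * (1 + ‖x'‖ ^ 2) ^ 2 * (1 + b) ^ 2 * heatKernel (2 * b) (x' - x) := by
  have hpos := heatKernel_pos hb (x' - x)
  have hsq := one_add_norm_sq_le_mul x x'
  rw [norm_sub_rev] at hsq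
  calc _ ≤ (2 * (1 + ‖x'‖ ^ 2) * (1 + ‖x' - x‖ ^ 2)) ^ 2 * heatKernel b (x' - x) := by gcongr
    _ = 4 * (1 + ‖x'‖ ^ 2) ^ 2 * ((1 + ‖x' - x‖ ^ 2) ^ 2 * heatKernel b (x' - x)) := by ring
    _ ≤ 4 * (1 + ‖x'‖ ^ 2) ^ 2 * (384 * (1 + b) ^ 2 * heatKernel (2 * b) (x' - x)) :=
        mul_le_mul_of_nonneg_left (one_add_norm_sq_sq_mul_heatKernel_le hb _) (by positivity)
    _ = _ := by ring

lemma inv_add_norm_sq_sq_le {τ : ℝ} (hτ : 0 < τ) (z : E3) :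
    ((τ + ‖z‖ ^ 2) ^ 2)⁻¹ ≤ bracketWeight z * (2 + 2 * ((τ + ‖z‖ ^ 2) ^ 2)⁻¹) := by
  set m := τ + ‖z‖ ^ 2
  have hm : 0 < m := by positivity
  have hsq : (1 + ‖z‖ ^ 2) ^ 2 ≤ 2 * m ^ 2 + 2 := by
    have : (1 + ‖z‖ ^ 2) ^ 2 ≤ (1 + m) ^ 2 := by
      gcongr
      exact le_add_of_nonneg_left hτ.le
    linarith [sq_nonneg (m - 1)]
  rw [bracketWeight, inv_mul_eq_div, le_div_iff₀ (by positivity), inv_mul_eq_div,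
    div_le_iff₀ (by positivity)]
  calc _ ≤ 2 * m ^ 2 + 2 := hsq
    _ = _ := by field_simp

lemma abs_oseenKernel_sub_le (j k l : Fin 3) {τ : ℝ} (hτ : 0 < τ) (x y : E3) :
    |oseenKernel j k l τ (x - y)| ≤
      17920 * (1 + ‖x‖ ^ 2) ^ 2 * bracketWeight y * (1 + ((τ + ‖x - y‖ ^ 2) ^ 2)⁻¹) := by
  have hweight : bracketWeight (x - y) ≤ 4 * (1 + ‖x‖ ^ 2) ^ 2 * bracketWeight y := by
    rw [← bracketWeight_neg, neg_sub]
    exact bracketWeight_sub_le y x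
  calc _ ≤ 2240 * ((τ + ‖x - y‖ ^ 2) ^ 2)⁻¹ := abs_oseenKernel_le j k l hτ (x - y)
    _ ≤ 2240 * (bracketWeight (x - y) * (2 + 2 * ((τ + ‖x - y‖ ^ 2) ^ 2)⁻¹)) := by
        gcongr
        exact inv_add_norm_sq_sq_le hτ _
    _ ≤ 2240 * (4 * (1 + ‖x‖ ^ 2) ^ 2 * bracketWeight y *
          (2 + 2 * ((τ + ‖x - y‖ ^ 2) ^ 2)⁻¹)) := by gcongr
    _ = _ := by ring

lemma exists_abs_heatKernel_mul_oseenKernel_le {b : ℝ} (hb : 0 < b) (x' : E3) :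
    ∃ c₁ c₂, ∀ (j k l : Fin 3) (τ : ℝ), 0 < τ → ∀ x y,
      |heatKernel b (x' - x) * oseenKernel j k l τ (x - y)| ≤
        bracketWeight y * (c₁ * heatKernel (2 * b) (x' - x) +
          c₂ * ((τ + ‖x - y‖ ^ 2) ^ 2)⁻¹) := by
  set D := 17920 * (1536 * (1 + ‖x'‖ ^ 2) ^ 2 * (1 + b) ^ 2) with hD
  have h2b : 0 < 2 * b := by positivity
  refine ⟨D, D * (8 * √(2 * b) ^ 3)⁻¹, fun j k l τ hτ x y => ?_⟩
  have hpos := heatKernel_pos hb (x' - x)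
  have hy := bracketWeight_nonneg y
  have hconst := heatKernel_le_const h2b (x' - x)
  rw [abs_mul, abs_of_pos hpos]
  calc _ ≤ heatKernel b (x' - x) * (17920 * (1 + ‖x‖ ^ 2) ^ 2 * bracketWeight y *
          (1 + ((τ + ‖x - y‖ ^ 2) ^ 2)⁻¹)) := by
        gcongr
        exact abs_oseenKernel_sub_le j k l hτ x y
    _ = 17920 * bracketWeight y * (1 + ((τ + ‖x - y‖ ^ 2) ^ 2)⁻¹) *
          ((1 + ‖x‖ ^ 2) ^ 2 * heatKernel b (x' - x)) := by ring
    _ ≤ 17920 * bracketWeight y * (1 + ((τ + ‖x - y‖ ^ 2) ^ 2)⁻¹) *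
          (1536 * (1 + ‖x'‖ ^ 2) ^ 2 * (1 + b) ^ 2 * heatKernel (2 * b) (x' - x)) :=
        mul_le_mul_of_nonneg_left (one_add_norm_sq_sq_mul_heatKernel_sub_le hb x' x)
          (by positivity)
    _ = bracketWeight y * (D * heatKernel (2 * b) (x' - x) +
          D * heatKernel (2 * b) (x' - x) * ((τ + ‖x - y‖ ^ 2) ^ 2)⁻¹) := by
        rw [hD]
        ring
    _ ≤ _ := by gcongr

lemma exists_integral_abs_heatKernel_mul_oseenKernel_le {b : ℝ} (hb : 0 < b) (x' : E3) :
    ∃ c₁ c₂, ∀ (j k l : Fin 3) (τ : ℝ), 0 < τ → ∀ y,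
      Integrable (fun x => heatKernel b (x' - x) * oseenKernel j k l τ (x - y)) ∧
      ∫ x, |heatKernel b (x' - x) * oseenKernel j k l τ (x - y)| ≤
        bracketWeight y * (c₁ + c₂ * τ ^ (-(1 / 2) : ℝ)) := by
  obtain ⟨c₁, c₂, hle⟩ := exists_abs_heatKernel_mul_oseenKernel_le hb x'
  have h2b : 0 < 2 * b := by positivity
  refine ⟨c₁, c₂ * ∫ z : E3, bracketWeight z, fun j k l τ hτ y => ?_⟩
  have hheat : Integrable fun x => c₁ * heatKernel (2 * b) (x' - x) :=
    ((integrable_heatKernel h2b).comp_sub_left x').const_mul _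
  have hinv : Integrable fun x => c₂ * ((τ + ‖x - y‖ ^ 2) ^ 2)⁻¹ :=
    ((integrable_inv_add_norm_sq_sq hτ).comp_sub_right y).const_mul _
  have hint : Integrable fun x => heatKernel b (x' - x) * oseenKernel j k l τ (x - y) :=
    ((hheat.add hinv).const_mul (bracketWeight y)).mono'
      (((continuous_heatKernel hb).comp (by fun_prop)).mul
        ((continuous_oseenKernel j k l hτ).comp (by fun_prop))).aestronglyMeasurable
      (Eventually.of_forall fun x => hle j k l τ hτ x y)
  refine ⟨hint, (integral_mono hint.abs ((hheat.add hinv).const_mul (bracketWeight y))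
    fun x => hle j k l τ hτ x y).trans_eq ?_⟩
  simp only [Pi.add_apply]
  rw [integral_const_mul, integral_add hheat hinv, integral_const_mul, integral_const_mul,
    integral_sub_left_eq_self (heatKernel (2 * b)) volume x', integral_heatKernel h2b,
    integral_sub_right_eq_self (fun z : E3 => ((τ + ‖z‖ ^ 2) ^ 2)⁻¹) y,
    integral_inv_add_norm_sq_sq hτ]
  ring

/-- Lebesgue measure on the slab `(0, t) × ℝ³`. -/
abbrev slabMeasure (t : ℝ) : Measure (ℝ × E3) := (volume.restrict (Set.Ioo 0 t)).prod volume

lemma ae_slabMeasure_mem (t : ℝ) : ∀ᵐ p ∂slabMeasure t, p.1 ∈ Set.Ioo 0 t :=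
  Measure.quasiMeasurePreserving_fst.ae (ae_restrict_mem measurableSet_Ioo)

/-- The scalar Duhamel integral `∫₀ᵗ e^{(t-s)Δ} (δ_{kl} ∂_j + (-Δ)⁻¹ ∂_j ∂_k ∂_l) P(s) ds`; the
`l`-th component of `duhamel u v` is the sum over `j` and `k` of these with `P = u_j v_k`. -/
def duhamelTerm (j k l : Fin 3) (P : ℝ → E3 → ℝ) (t : ℝ) (x : E3) : ℝ :=
  ∫ s in Set.Ioo 0 t, oseenConv j k l (t - s) (P s) x

section DuhamelTerm

variable {P : ℝ → E3 → ℝ} {t T : ℝ}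

lemma integrable_abs_mul_bracketWeight_mul_rpow (c₁ : ℝ) {c₂ : ℝ}
    (hP : Integrable (fun p : ℝ × E3 => P p.1 p.2 * bracketWeight p.2) (slabMeasure t))
    (hsing : IntegrableOn
      (fun s => (∫ y, |P s y * bracketWeight y|) * (t - s) ^ (-(1 / 2) : ℝ)) (Set.Ioo 0 t)) :
    Integrable (fun p : ℝ × E3 => |P p.1 p.2 * bracketWeight p.2| *
      (c₁ + c₂ * (t - p.1) ^ (-(1 / 2) : ℝ))) (slabMeasure t) := by
  have hrpow : Measurable fun p : ℝ × E3 => (t - p.1) ^ (-(1 / 2) : ℝ) := by fun_prop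
  have hmeas : AEStronglyMeasurable (fun p : ℝ × E3 =>
      |P p.1 p.2 * bracketWeight p.2| * (t - p.1) ^ (-(1 / 2) : ℝ)) (slabMeasure t) :=
    hP.1.norm.mul hrpow.aestronglyMeasurable
  have hterm : Integrable (fun p : ℝ × E3 =>
      |P p.1 p.2 * bracketWeight p.2| * (t - p.1) ^ (-(1 / 2) : ℝ)) (slabMeasure t) := by
    refine (integrable_prod_iff hmeas).2 ⟨?_, ?_⟩
    · filter_upwards [hP.prod_right_ae] with s hs
      exact hs.abs.mul_const _
    · refine hsing.congr ?_
      filter_upwards [ae_restrict_mem measurableSet_Ioo] with s hs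
      have hnonneg : 0 ≤ (t - s) ^ (-(1 / 2) : ℝ) := Real.rpow_nonneg (sub_nonneg.2 hs.2.le) _
      simp only [norm_mul, Real.norm_eq_abs, abs_abs, abs_mul]
      rw [integral_mul_const, abs_of_nonneg hnonneg]
  refine ((hP.abs.const_mul c₁).add (hterm.const_mul c₂)).congr (Eventually.of_forall fun p => ?_)
  simp only [Pi.add_apply]
  ring

variable (j k l : Fin 3)

lemma aestronglyMeasurable_heatKernel_mul_oseenKernel_mul {b : ℝ} (hb : 0 < b) (x' : E3)
    (hP : AEStronglyMeasurable (fun p : ℝ × E3 => P p.1 p.2) (slabMeasure t)) :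
    AEStronglyMeasurable (fun q : (ℝ × E3) × E3 => heatKernel b (x' - q.2) *
        oseenKernel j k l (t - q.1.1) (q.2 - q.1.2) * P q.1.1 q.1.2)
      ((slabMeasure t).prod volume) := by
  obtain ⟨E, hEm, hE⟩ := exists_measurable_eq_oseenKernel j k l
  have hker : Measurable fun q : (ℝ × E3) × E3 =>
      heatKernel b (x' - q.2) * E (t - q.1.1, q.2 - q.1.2) :=
    ((continuous_heatKernel hb).measurable.comp (by fun_prop)).mul
      (hEm.comp (Measurable.prodMk (by fun_prop) (by fun_prop)))
  refine (hker.aestronglyMeasurable.mul (hP.comp_fst (ν := (volume : Measure E3)))).congr ?_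
  filter_upwards [Measure.quasiMeasurePreserving_fst.ae (ae_slabMeasure_mem t)] with q hq
  simp only [Pi.mul_apply]
  rw [hE _ (sub_pos.2 hq.2)]

lemma integrable_heatKernel_mul_oseenKernel_mul {b : ℝ} (hb : 0 < b) (x' : E3)
    (hP : Integrable (fun p : ℝ × E3 => P p.1 p.2 * bracketWeight p.2) (slabMeasure t))
    (hsing : IntegrableOn
      (fun s => (∫ y, |P s y * bracketWeight y|) * (t - s) ^ (-(1 / 2) : ℝ)) (Set.Ioo 0 t)) :
    Integrable (fun q : (ℝ × E3) × E3 => heatKernel b (x' - q.2) *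
        oseenKernel j k l (t - q.1.1) (q.2 - q.1.2) * P q.1.1 q.1.2)
      ((slabMeasure t).prod volume) := by
  obtain ⟨c₁, c₂, hbound⟩ := exists_integral_abs_heatKernel_mul_oseenKernel_le hb x'
  have hmeas := aestronglyMeasurable_heatKernel_mul_oseenKernel_mul j k l hb x'
    (aestronglyMeasurable_of_integrable_mul_bracketWeight
      measurable_snd.aestronglyMeasurable hP)
  refine (integrable_prod_iff hmeas).2 ⟨?_, ?_⟩
  · filter_upwards [ae_slabMeasure_mem t] with p hp
    exact (hbound j k l (t - p.1) (sub_pos.2 hp.2) p.2).1.mul_const (P p.1 p.2)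
  refine (integrable_abs_mul_bracketWeight_mul_rpow c₁ (c₂ := c₂) hP hsing).mono'
    hmeas.norm.integral_prod_right' ?_
  filter_upwards [ae_slabMeasure_mem t] with p hp
  rw [Real.norm_of_nonneg (integral_nonneg fun _ => norm_nonneg _)]
  simp_rw [norm_mul _ (P p.1 p.2), integral_mul_const, Real.norm_eq_abs]
  calc _ ≤ bracketWeight p.2 * (c₁ + c₂ * (t - p.1) ^ (-(1 / 2) : ℝ)) * |P p.1 p.2| :=
        mul_le_mul_of_nonneg_right (hbound j k l (t - p.1) (sub_pos.2 hp.2) p.2).2 (abs_nonneg _)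
    _ = _ := by
        rw [abs_mul, abs_of_pos (bracketWeight_pos p.2)]
        ring

lemma heat_duhamelTerm (htT : t < T) (x' : E3)
    (hP : Integrable (fun p : ℝ × E3 => P p.1 p.2 * bracketWeight p.2) (slabMeasure t))
    (hsing : IntegrableOn
      (fun s => (∫ y, |P s y * bracketWeight y|) * (t - s) ^ (-(1 / 2) : ℝ)) (Set.Ioo 0 t)) :
    Integrable (fun x => heatKernel (T - t) (x' - x) * duhamelTerm j k l P t x) ∧
    IntegrableOn (fun s => oseenConv j k l (T - s) (P s) x') (Set.Ioo 0 t) ∧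
    heat (T - t) (duhamelTerm j k l P t) x' =
      ∫ s in Set.Ioo 0 t, oseenConv j k l (T - s) (P s) x' := by
  have hb : 0 < T - t := sub_pos.2 htT
  have hint := integrable_heatKernel_mul_oseenKernel_mul j k l hb x' hP hsing
  have hinner : (fun x => ∫ p : ℝ × E3, heatKernel (T - t) (x' - x) *
        oseenKernel j k l (t - p.1) (x - p.2) * P p.1 p.2 ∂slabMeasure t) =ᵐ[volume]
      fun x => heatKernel (T - t) (x' - x) * duhamelTerm j k l P t x := by
    filter_upwards [hint.prod_left_ae] with x hx
    simp_rw [mul_assoc] at hx ⊢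
    rw [integral_const_mul, integral_prod]
    · rfl
    · exact (integrable_const_mul_iff (heatKernel_pos hb (x' - x)).ne'.isUnit _).1 hx
  have houter : (fun p : ℝ × E3 => ∫ x, heatKernel (T - t) (x' - x) *
        oseenKernel j k l (t - p.1) (x - p.2) * P p.1 p.2) =ᵐ[slabMeasure t]
      fun p => oseenKernel j k l (T - p.1) (x' - p.2) * P p.1 p.2 := by
    filter_upwards [ae_slabMeasure_mem t] with p hp
    rw [integral_mul_const, integral_heatKernel_mul_oseenKernel j k l (sub_pos.2 hp.2) hb,
      sub_add_sub_cancel']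
  have hker := hint.integral_prod_left.congr houter
  refine ⟨hint.integral_prod_right.congr hinner, hker.integral_prod_left, ?_⟩
  calc _ = _ := (integral_congr_ae hinner).symm
    _ = _ := (integral_integral_swap hint).symm
    _ = _ := integral_congr_ae houter
    _ = _ := integral_prod _ hker

end DuhamelTerm

lemma ae_integrableOn_mul_rpow {p : ℝ → ℝ} {T : ℝ} (hT : 0 < T)
    (hp : IntegrableOn p (Set.Ioo 0 T)) :
    ∀ᵐ t ∂volume.restrict (Set.Ioo 0 T),
      IntegrableOn (fun s => p s * (t - s) ^ (-(1 / 2) : ℝ)) (Set.Ioo 0 t) := by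
  have hrpow : IntegrableOn (fun τ : ℝ => τ ^ (-(1 / 2) : ℝ)) (Set.Ioo 0 T) :=
    (intervalIntegral.integrableOn_Ioo_rpow_iff hT).2 (by norm_num)
  have hconv := ((integrable_indicator_iff measurableSet_Ioo).2 hp).ae_convolution_exists
    (ContinuousLinearMap.mul ℝ ℝ) ((integrable_indicator_iff measurableSet_Ioo).2 hrpow)
  rw [ae_restrict_iff' measurableSet_Ioo]
  filter_upwards [hconv] with t ht htT
  refine ht.integrableOn.congr_fun (fun s hs => ?_) measurableSet_Ioo
  simp only [ContinuousLinearMap.mul_apply']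
  rw [Set.indicator_of_mem (show s ∈ Set.Ioo 0 T from ⟨hs.1, hs.2.trans htT.2⟩),
    Set.indicator_of_mem (show t - s ∈ Set.Ioo 0 T from
      ⟨sub_pos.2 hs.2, (sub_lt_self t hs.1).trans htT.2⟩)]

lemma ae_Ioi_of_forall_ae_Ioo_rat {p : ℝ → ℚ → Prop}
    (h : ∀ q : ℚ, 0 < (q : ℝ) → ∀ᵐ s ∂volume.restrict (Set.Ioo 0 (q : ℝ)), p s q) :
    ∀ᵐ s ∂volume.restrict (Set.Ioi (0 : ℝ)), ∀ q : ℚ, s < (q : ℝ) → p s q := by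
  refine ae_all_iff.2 fun q => (ae_restrict_iff' measurableSet_Ioi).2 ?_
  rcases le_or_gt (q : ℝ) 0 with hq | hq
  · exact Eventually.of_forall fun s hs hsq => absurd (hs.trans hsq) hq.not_gt
  · filter_upwards [(ae_restrict_iff' measurableSet_Ioo).1 (h q hq)] with s hs h0 hsq
    exact hs ⟨h0, hsq⟩

section VanishingDuhamel

variable (l : Fin 3) {P : Fin 3 → Fin 3 → ℝ → E3 → ℝ}
  (hP : ∀ T, 0 < T → ∀ j k,
    Integrable (fun p : ℝ × E3 => P j k p.1 p.2 * bracketWeight p.2) (slabMeasure T))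
  (hduhamel : ∀ t, 0 < t → ∀ᵐ x : E3, ∑ j, ∑ k, duhamelTerm j k l (P j k) t x = 0)

include hP hduhamel

/-- Applying `e^{(T-t)Δ}` to a vanishing Duhamel integral up to time `t` shows that the primitive of
`s ↦ ∑ e^{(T-s)Δ} (…) P(s)` vanishes on `(0, T)`. -/
lemma ae_sum_oseenConv_eq_zero {T : ℝ} (hT : 0 < T) (x' : E3) :
    ∀ᵐ s ∂volume.restrict (Set.Ioo 0 T), ∑ j, ∑ k, oseenConv j k l (T - s) (P j k s) x' = 0 := by
  apply ae_eq_zero_of_ae_setIntegral_Ioo_eq_zero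
  have hsing : ∀ᵐ t ∂volume.restrict (Set.Ioo 0 T), ∀ j k, IntegrableOn
      (fun s => (∫ y, |P j k s y * bracketWeight y|) * (t - s) ^ (-(1 / 2) : ℝ)) (Set.Ioo 0 t) :=
    ae_all_iff.2 fun j => ae_all_iff.2 fun k =>
      ae_integrableOn_mul_rpow hT (hP T hT j k).integral_norm_prod_left
  filter_upwards [hsing, ae_restrict_mem measurableSet_Ioo] with t ht hmem
  have hreg := fun j k => heat_duhamelTerm j k l hmem.2 x' (hP t hmem.1 j k) (ht j k)
  refine ⟨integrable_finsetSum _ fun j _ => integrable_finsetSum _ fun k _ => (hreg j k).2.1, ?_⟩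
  rw [integral_finsetSum _ fun j _ => integrable_finsetSum _ fun k _ => (hreg j k).2.1]
  simp_rw [integral_finsetSum _ fun k _ => (hreg _ k).2.1, ← (hreg _ _).2.2, heat,
    ← integral_finsetSum _ fun k _ => (hreg _ k).1]
  rw [← integral_finsetSum _ fun j _ => integrable_finsetSum _ fun k _ => (hreg j k).1]
  refine integral_eq_zero_of_ae ?_
  filter_upwards [hduhamel t hmem.1] with x hx
  simp_rw [← Finset.mul_sum]
  rw [hx, mul_zero, Pi.zero_apply]

omit hduhamel in
lemma ae_weightedL1 : ∀ᵐ s ∂volume.restrict (Set.Ioi (0 : ℝ)), ∀ j k, WeightedL1 (P j k s) := by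
  refine ae_all_iff.2 fun j => ae_all_iff.2 fun k => ?_
  have hrat := ae_Ioi_of_forall_ae_Ioo_rat (p := fun s _ => WeightedL1 (P j k s))
    fun q hq => (hP q hq j k).prod_right_ae
  filter_upwards [hrat] with s hs
  obtain ⟨q, hq⟩ := exists_rat_gt s
  exact hs q hq

lemma ae_frequently_sum_oseenConv_eq_zero : ∀ᵐ s ∂volume.restrict (Set.Ioi (0 : ℝ)),
    ∃ᶠ a in 𝓝[>] (0 : ℝ), ∀ x, ∑ j, ∑ k, oseenConv j k l a (P j k s) x = 0 := by
  have hdense := ae_Ioi_of_forall_ae_Ioo_rat (p := fun s q => ∀ i : ℕ,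
    ∑ j, ∑ k, oseenConv j k l (q - s) (P j k s) (TopologicalSpace.denseSeq E3 i) = 0)
    fun q hq => ae_all_iff.2 fun i => ae_sum_oseenConv_eq_zero l hP hduhamel hq _
  filter_upwards [hdense, ae_weightedL1 hP] with s hs hPs
  refine (nhdsGT_basis (0 : ℝ)).frequently_iff.2 fun ε hε => ?_
  obtain ⟨q, hsq, hqε⟩ := exists_rat_btwn (lt_add_of_pos_right s hε)
  have hpos : 0 < (q : ℝ) - s := sub_pos.2 hsq
  refine ⟨q - s, ⟨hpos, by linarith⟩, fun x => ?_⟩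
  have hcont : Continuous fun x => ∑ j, ∑ k, oseenConv j k l (q - s) (P j k s) x :=
    continuous_finsetSum _ fun j _ => continuous_finsetSum _ fun k _ =>
      continuous_oseenConv j k l hpos (hPs j k)
  exact congrFun ((TopologicalSpace.denseRange_denseSeq E3).equalizer hcont
    (continuous_const (y := (0 : ℝ))) (funext fun i => hs q hsq i)) x

end VanishingDuhamel

/-! ### Weighted square integrable fields -/

lemma abs_apply_mul_apply_le (a : E3) (j k : Fin 3) : |a j * a k| ≤ ‖a‖ ^ 2 := by
  rw [abs_mul, sq]
  exact mul_le_mul (abs_coord_le_norm a j) (abs_coord_le_norm a k) (abs_nonneg _) (norm_nonneg _)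

lemma norm_apply_mul_apply_mul_bracketWeight_le (a x : E3) (j k : Fin 3) :
    ‖a j * a k * bracketWeight x‖ ≤ 4 * (‖a‖ ^ 2 / (1 + ‖x‖) ^ 4) := by
  rw [Real.norm_eq_abs, abs_mul, abs_of_pos (bracketWeight_pos x)]
  exact (mul_le_mul_of_nonneg_right (abs_apply_mul_apply_le a j k) (bracketWeight_nonneg x)).trans
    (norm_sq_mul_bracketWeight_le a x)

lemma aestronglyMeasurable_coord {X : Type*} [MeasurableSpace X] {μ : Measure X} {f : X → E3}
    (hf : AEStronglyMeasurable f μ) (j : Fin 3) : AEStronglyMeasurable (fun p => f p j) μ :=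
  (EuclideanSpace.proj (𝕜 := ℝ) j).continuous.comp_aestronglyMeasurable hf

namespace WeightedL2

variable {v : E3 → E3}

lemma weightedL1_norm_sq (hv : WeightedL2 v) : WeightedL1 fun x => ‖v x‖ ^ 2 := by
  refine (hv.integrable.const_mul 4).mono'
    ((hv.aestronglyMeasurable.norm.pow 2).mul continuous_bracketWeight.aestronglyMeasurable)
    (Eventually.of_forall fun x => ?_)
  rw [Real.norm_of_nonneg (mul_nonneg (sq_nonneg _) (bracketWeight_nonneg x))]
  exact norm_sq_mul_bracketWeight_le _ _

lemma weightedL1_mul (hv : WeightedL2 v) (j k : Fin 3) : WeightedL1 fun x => v x j * v x k :=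
  (hv.integrable.const_mul 4).mono'
    (((aestronglyMeasurable_coord hv.aestronglyMeasurable j).mul
      (aestronglyMeasurable_coord hv.aestronglyMeasurable k)).mul
      continuous_bracketWeight.aestronglyMeasurable)
    (Eventually.of_forall fun _ => norm_apply_mul_apply_mul_bracketWeight_le _ _ _ _)

lemma weightedL1_norm (hv : WeightedL2 v) : WeightedL1 fun x => ‖v x‖ := by
  refine ((integrable_bracketWeight volume (by simp)).add hv.weightedL1_norm_sq).mono'
    (hv.aestronglyMeasurable.norm.mul continuous_bracketWeight.aestronglyMeasurable)
    (Eventually.of_forall fun x => ?_)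
  have hw := bracketWeight_nonneg x
  rw [Real.norm_of_nonneg (mul_nonneg (norm_nonneg _) hw), Pi.add_apply]
  have hsq : ‖v x‖ ≤ 1 + ‖v x‖ ^ 2 := by nlinarith [sq_nonneg (‖v x‖ - 1)]
  calc _ ≤ (1 + ‖v x‖ ^ 2) * bracketWeight x := mul_le_mul_of_nonneg_right hsq hw
    _ = _ := by ring

lemma weightedL1_coord (hv : WeightedL2 v) (l : Fin 3) : WeightedL1 fun x => v x l := by
  refine hv.weightedL1_norm.mono' ((aestronglyMeasurable_coord hv.aestronglyMeasurable l).mul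
    continuous_bracketWeight.aestronglyMeasurable) (Eventually.of_forall fun x => ?_)
  rw [norm_mul, Real.norm_of_nonneg (bracketWeight_nonneg x)]
  exact mul_le_mul_of_nonneg_right (abs_coord_le_norm _ _) (bracketWeight_nonneg x)

end WeightedL2

lemma InPathSpace.integrable_mul_bracketWeight {u : ℝ → E3 → E3} (hu : InPathSpace u) {t : ℝ}
    (ht : 0 < t) (j k : Fin 3) :
    Integrable (fun p : ℝ × E3 => u p.1 p.2 j * u p.1 p.2 k * bracketWeight p.2)
      (slabMeasure t) := by
  have hle : slabMeasure t ≤ (volume.restrict (Set.Ioi 0)).prod volume :=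
    Measure.prod_mono (Measure.restrict_mono_set _ Set.Ioo_subset_Ioi_self) le_rfl
  have hm := hu.aestronglyMeasurable.mono_measure hle
  exact ((hu.integrable t ht).const_mul 4).mono'
    (((aestronglyMeasurable_coord hm j).mul (aestronglyMeasurable_coord hm k)).mul
      (continuous_bracketWeight.comp continuous_snd).aestronglyMeasurable)
    (Eventually.of_forall fun p => norm_apply_mul_apply_mul_bracketWeight_le _ _ _ _)

/-! ### The Leray term of the heat flow -/

lemma sq_integral_mul_le_integral_mul_sq {X : Type*} [MeasurableSpace X] {μ : Measure X}
    {w f : X → ℝ} (hw : 0 ≤ w) (hwint : Integrable w μ) (hwone : ∫ y, w y ∂μ = 1)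
    (hf : Integrable (fun y => w y * f y) μ) (hfsq : Integrable (fun y => w y * f y ^ 2) μ) :
    (∫ y, w y * f y ∂μ) ^ 2 ≤ ∫ y, w y * f y ^ 2 ∂μ := by
  set m := ∫ y, w y * f y ∂μ with hm
  have hvar : 0 ≤ ∫ y, w y * (f y - m) ^ 2 ∂μ :=
    integral_nonneg fun y => mul_nonneg (hw y) (sq_nonneg _)
  have hexpand : ∫ y, w y * (f y - m) ^ 2 ∂μ =
      ∫ y, w y * f y ^ 2 ∂μ - 2 * m * ∫ y, w y * f y ∂μ + m ^ 2 * ∫ y, w y ∂μ := by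
    rw [← integral_const_mul (2 * m), ← integral_const_mul (m ^ 2),
      ← integral_sub hfsq (hf.const_mul _)]
    refine Eq.trans (integral_congr_ae (Eventually.of_forall fun y => ?_))
      (integral_add (hfsq.sub (hf.const_mul (2 * m))) (hwint.const_mul (m ^ 2)))
    simp only
    ring
  rw [hexpand, hwone, ← hm] at hvar
  linarith

lemma heatKernel_le_of_mem_Ioo {t₀ t : ℝ} (ht₀ : 0 < t₀) (ht : t ∈ Set.Ioo (t₀ / 2) (2 * t₀))
    (z : E3) : heatKernel t z ≤ 8 * heatKernel (2 * t₀) z := by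
  have hfour : (4 : ℝ) ^ (-(3 / 2) : ℝ) = 1 / 8 := by
    rw [show (4 : ℝ) = 2 ^ (2 : ℝ) by norm_num, ← Real.rpow_mul (by norm_num)]
    norm_num
  have hscale : (4 * π * (2 * t₀)) ^ (-(3 / 2) : ℝ) =
      1 / 8 * (4 * π * (t₀ / 2)) ^ (-(3 / 2) : ℝ) := by
    rw [← hfour, ← Real.mul_rpow (by norm_num) (by positivity)]
    congr 1
    ring
  have htpos : 0 < t := (half_pos ht₀).trans ht.1
  have hpow : (4 * π * t) ^ (-(3 / 2) : ℝ) ≤ (4 * π * (t₀ / 2)) ^ (-(3 / 2) : ℝ) :=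
    Real.rpow_le_rpow_of_nonpos (by positivity)
      (mul_le_mul_of_nonneg_left ht.1.le (by positivity)) (by norm_num)
  have hexp : Real.exp (-(‖z‖ ^ 2) / (4 * t)) ≤ Real.exp (-(‖z‖ ^ 2) / (4 * (2 * t₀))) := by
    rw [Real.exp_le_exp, neg_div, neg_div, neg_le_neg_iff]
    have := ht.2.le
    gcongr
  calc heatKernel t z
      ≤ (4 * π * (t₀ / 2)) ^ (-(3 / 2) : ℝ) * Real.exp (-(‖z‖ ^ 2) / (4 * (2 * t₀))) :=
        mul_le_mul hpow hexp (Real.exp_pos _).le (by positivity)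
    _ = 8 * heatKernel (2 * t₀) z := by
        rw [heatKernel, hscale]
        ring

lemma sq_heat_le_heat_sq {f : E3 → ℝ} {t : ℝ} (hf : WeightedL1 f)
    (hfsq : WeightedL1 fun y => f y ^ 2) (ht : 0 < t) (x : E3) :
    heat t f x ^ 2 ≤ heat t (fun y => f y ^ 2) x :=
  sq_integral_mul_le_integral_mul_sq (fun y => (heatKernel_pos ht (x - y)).le)
    ((integrable_heatKernel ht).comp_sub_left x)
    (by rw [integral_sub_left_eq_self (heatKernel t) volume x, integral_heatKernel ht])
    (hf.integrable_heatKernel_mul ht x) (hfsq.integrable_heatKernel_mul ht x)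

lemma WeightedL1.heat {f : E3 → ℝ} {t : ℝ} (hf : WeightedL1 f) (ht : 0 < t) :
    WeightedL1 (heat t f) := by
  have hmaj := hf.abs.convolution_integrand (ContinuousLinearMap.mul ℝ ℝ)
    (integrable_heatKernel (mul_pos two_pos ht))
  have hint : Integrable (fun p : E3 × E3 => heatKernel t (p.1 - p.2) * f p.2 * bracketWeight p.1)
      (volume.prod volume) := by
    refine (hmaj.const_mul (1536 * (1 + t) ^ 2)).mono'
      ((((continuous_heatKernel ht).comp (by fun_prop)).aestronglyMeasurable.mul
        hf.aestronglyMeasurable.comp_snd).mul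
        (continuous_bracketWeight.comp continuous_fst).aestronglyMeasurable)
      (Eventually.of_forall fun p => ?_)
    have hswap := heatKernel_sub_mul_bracketWeight_le ht p.2 p.1
    rw [← neg_sub p.1 p.2, heatKernel_neg, heatKernel_neg] at hswap
    rw [norm_mul, norm_mul, Real.norm_of_nonneg (heatKernel_pos ht _).le,
      Real.norm_of_nonneg (bracketWeight_nonneg _), Real.norm_eq_abs,
      ContinuousLinearMap.mul_apply', abs_mul, abs_of_pos (bracketWeight_pos p.2)]
    calc _ = |f p.2| * (heatKernel t (p.1 - p.2) * bracketWeight p.1) := by ring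
      _ ≤ |f p.2| * (1536 * (1 + t) ^ 2 * bracketWeight p.2 * heatKernel (2 * t) (p.1 - p.2)) :=
          mul_le_mul_of_nonneg_left hswap (abs_nonneg _)
      _ = _ := by ring
  refine hint.integral_prod_left.congr (Eventually.of_forall fun x => ?_)
  exact integral_mul_const (bracketWeight x) _

lemma WeightedL1.abs {f : E3 → ℝ} (hf : WeightedL1 f) : WeightedL1 fun x => |f x| :=
  (Integrable.abs hf).congr (Eventually.of_forall fun x => by
    simp only [abs_mul, abs_of_pos (bracketWeight_pos x)])

lemma continuousAt_heat {f : E3 → ℝ} (hf : WeightedL1 f) {t₀ : ℝ} (ht₀ : 0 < t₀) (x : E3) :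
    ContinuousAt (fun t => heat t f x) t₀ := by
  have hmem : ∀ᶠ t in 𝓝 t₀, t ∈ Set.Ioo (t₀ / 2) (2 * t₀) :=
    Ioo_mem_nhds (by linarith) (by linarith)
  refine continuousAt_of_dominated
    (bound := fun y => 8 * (heatKernel (2 * t₀) (x - y) * |f y|)) ?_ ?_
    ((hf.abs.integrable_heatKernel_mul (by positivity) x).const_mul 8)
    (Eventually.of_forall fun y => ContinuousAt.mul ?_ continuousAt_const)
  · filter_upwards [hmem] with t ht
    exact (hf.integrable_heatKernel_mul ((half_pos ht₀).trans ht.1) x).1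
  · filter_upwards [hmem] with t ht
    refine Eventually.of_forall fun y => ?_
    rw [norm_mul, Real.norm_of_nonneg (heatKernel_pos ((half_pos ht₀).trans ht.1) _).le,
      Real.norm_eq_abs, ← mul_assoc]
    exact mul_le_mul_of_nonneg_right (heatKernel_le_of_mem_Ioo ht₀ ht _) (abs_nonneg _)
  · unfold heatKernel
    refine ContinuousAt.mul (ContinuousAt.rpow_const (by fun_prop) (Or.inl (by positivity))) ?_
    exact (continuousAt_const.div (by fun_prop) (by positivity)).rexp

lemma abs_heatVec_le {v : E3 → E3} {t₀ t : ℝ} (hv : WeightedL2 v) (ht₀ : 0 < t₀)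
    (ht : t ∈ Set.Ioo (t₀ / 2) (2 * t₀)) (x : E3) (i : Fin 3) :
    |heatVec t v x i| ≤ 8 * heat (2 * t₀) (fun y => ‖v y‖) x := by
  have hint := hv.weightedL1_norm.integrable_heatKernel_mul (mul_pos two_pos ht₀) x
  rw [heat, ← integral_const_mul, ← Real.norm_eq_abs]
  refine norm_integral_le_of_norm_le (hint.const_mul 8) (Eventually.of_forall fun y => ?_)
  rw [norm_mul, Real.norm_of_nonneg (heatKernel_pos ((half_pos ht₀).trans ht.1) _).le, ← mul_assoc]
  exact mul_le_mul (heatKernel_le_of_mem_Ioo ht₀ ht _) (abs_coord_le_norm _ _) (norm_nonneg _)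
    (mul_nonneg (by norm_num) (heatKernel_pos (mul_pos two_pos ht₀) _).le)

lemma abs_heatVec_mul_heatVec_le {v : E3 → E3} {t₀ t : ℝ} (hv : WeightedL2 v) (ht₀ : 0 < t₀)
    (ht : t ∈ Set.Ioo (t₀ / 2) (2 * t₀)) (x : E3) (j k : Fin 3) :
    |heatVec t v x j * heatVec t v x k| ≤ 64 * heat (2 * t₀) (fun y => ‖v y‖ ^ 2) x := by
  have hj := abs_heatVec_le hv ht₀ ht x j
  have hk := abs_heatVec_le hv ht₀ ht x k
  calc _ ≤ 8 * heat (2 * t₀) (fun y => ‖v y‖) x * (8 * heat (2 * t₀) (fun y => ‖v y‖) x) := by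
        rw [abs_mul]
        exact mul_le_mul hj hk (abs_nonneg _) ((abs_nonneg _).trans hj)
    _ = 64 * heat (2 * t₀) (fun y => ‖v y‖) x ^ 2 := by ring
    _ ≤ _ := mul_le_mul_of_nonneg_left (sq_heat_le_heat_sq hv.weightedL1_norm
        hv.weightedL1_norm_sq (mul_pos two_pos ht₀) x) (by norm_num)

lemma continuousAt_lerayBilinear_heatVec {v : E3 → E3} (hv : WeightedL2 v) (l : Fin 3)
    (φ : 𝓢(E3, ℝ)) {t₀ : ℝ} (ht₀ : 0 < t₀) :
    ContinuousAt (fun t => lerayBilinear (heatVec t v) (heatVec t v) l φ) t₀ := by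
  have hmem : ∀ᶠ t in 𝓝 t₀, t ∈ Set.Ioo (t₀ / 2) (2 * t₀) :=
    Ioo_mem_nhds (by linarith) (by linarith)
  refine Tendsto.neg (tendsto_finsetSum _ fun j _ => tendsto_finsetSum _ fun k _ => ?_)
  obtain ⟨C, hC⟩ := exists_abs_lerayDeriv_le j k l φ
  refine continuousAt_of_dominated (bound := fun x => 64 * C *
    (heat (2 * t₀) (fun y => ‖v y‖ ^ 2) x * bracketWeight x)) ?_ ?_
    ((hv.weightedL1_norm_sq.heat (mul_pos two_pos ht₀)).const_mul _)
    (Eventually.of_forall fun x => ((continuousAt_heat (hv.weightedL1_coord j) ht₀ x).mul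
      (continuousAt_heat (hv.weightedL1_coord k) ht₀ x)).mul continuousAt_const)
  · filter_upwards [hmem] with t ht
    have htpos : 0 < t := (half_pos ht₀).trans ht.1
    exact (((hv.weightedL1_coord j).continuous_heat htpos).mul
      ((hv.weightedL1_coord k).continuous_heat htpos)).aestronglyMeasurable.mul
      (aestronglyMeasurable_lerayDeriv j k l φ)
  · filter_upwards [hmem] with t ht
    refine Eventually.of_forall fun x => ?_
    have hprod := abs_heatVec_mul_heatVec_le hv ht₀ ht x j k
    rw [norm_mul]
    calc _ ≤ 64 * heat (2 * t₀) (fun y => ‖v y‖ ^ 2) x * (C * bracketWeight x) :=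
          mul_le_mul hprod (hC x) (abs_nonneg _) ((abs_nonneg _).trans hprod)
      _ = _ := by ring

lemma lerayBilinear_congr {v w : E3 → E3} (h : v =ᵐ[volume] w) (l : Fin 3) (φ : 𝓢(E3, ℝ)) :
    lerayBilinear v v l φ = lerayBilinear w w l φ := by
  unfold lerayBilinear
  congr! 3 with j - k -
  exact integral_congr_ae (h.mono fun x hx => by simp only [hx])

lemma IsMildSolution.ae_eq_heatVec_of_duhamel_eq_zero {u₀ : E3 → E3} {u : ℝ → E3 → E3}
    (hu : IsMildSolution u₀ u) {t : ℝ} (ht : 0 < t)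
    (h : ∀ l, ∀ᵐ x : E3, duhamel u u t x l = 0) : u t =ᵐ[volume] heatVec t u₀ := by
  filter_upwards [hu.integral_equation t ht, ae_all_iff.2 h] with x hx hx'
  rw [hx, show duhamel u u t x = 0 from PiLp.ext hx', sub_zero]

theorem IsMildSolution.isBeltramiType {u₀ : E3 → E3} {u : ℝ → E3 → E3} (hu : IsMildSolution u₀ u)
    (h : ∀ l t, 0 < t → ∀ᵐ x : E3, duhamel u u t x l = 0) : IsBeltramiType u₀ := by
  refine ⟨hu.data_solenoidal, fun t ht l φ => ?_⟩
  have hae : ∀ᵐ s ∂volume.restrict (Set.Ioi (0 : ℝ)),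
      lerayBilinear (heatVec s u₀) (heatVec s u₀) l φ = 0 := by
    filter_upwards [ae_frequently_sum_oseenConv_eq_zero l (P := fun j k s y => u s y j * u s y k)
      (fun T hT j k => hu.inPathSpace.integrable_mul_bracketWeight hT j k) (h l),
      ae_restrict_mem measurableSet_Ioi] with s hs hspos
    rw [← lerayBilinear_congr (hu.ae_eq_heatVec_of_duhamel_eq_zero hspos fun l => h l s hspos),
      lerayBilinear, sum_integral_lerayDeriv_eq_zero l (P := fun j k y => u s y j * u s y k)
        (fun j k => (hu.inPathSpace.weightedL2 s hspos).weightedL1_mul j k) hs φ, neg_zero]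
  exact Measure.eqOn_open_of_ae_eq hae isOpen_Ioi
    (fun s hs => (continuousAt_lerayBilinear_heatVec hu.data_weightedL2 l φ hs).continuousWithinAt)
    continuousOn_const ht

lemma heat_const {f : E3 → ℝ} {c : ℝ} (h : ∀ᵐ x, f x = c) {t : ℝ} (ht : 0 < t) (x : E3) :
    heat t f x = c := by
  calc heat t f x = ∫ y, heatKernel t (x - y) * c :=
        integral_congr_ae (h.mono fun y hy => by simp only [hy])
    _ = c := by
        rw [integral_mul_const, integral_sub_left_eq_self (heatKernel t) volume x,
          integral_heatKernel ht, one_mul]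

lemma heatVec_const {v : E3 → E3} {c : E3} (h : ∀ᵐ x, v x = c) {t : ℝ} (ht : 0 < t) (x : E3) :
    heatVec t v x = c :=
  PiLp.ext fun l => heat_const (h.mono fun y hy => by simp only [hy]) ht x

lemma isBeltramiType_of_const {v : E3 → E3} (hv : IsSolenoidal v) {c : E3}
    (h : ∀ᵐ x, v x = c) : IsBeltramiType v := by
  refine ⟨hv, fun t ht l φ => ?_⟩
  simp_rw [lerayBilinear, heatVec_const h ht, integral_const_mul, integral_lerayDeriv, mul_zero,
    Finset.sum_const_zero, neg_zero]

/-! ### Characters of the reflection group -/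

lemma reflectSign_add (α α' β : Fin 3 → ZMod 2) :
    reflectSign (α + α') β = reflectSign α β * reflectSign α' β := by
  unfold reflectSign
  rw [← Finset.prod_mul_distrib]
  refine Finset.prod_congr rfl fun i _ => ?_
  rw [Pi.add_apply, ZMod.val_add, pow_mul, ← neg_one_pow_eq_pow_mod_two, ← pow_mul, add_mul,
    pow_add]

lemma reflectSign_zero (β : Fin 3 → ZMod 2) : reflectSign 0 β = 1 := by
  simp [reflectSign]

lemma reflectSign_mul_self (α β : Fin 3 → ZMod 2) : reflectSign α β * reflectSign α β = 1 := by
  rw [← reflectSign_add, CharTwo.add_self_eq_zero, reflectSign_zero]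

lemma reflectSign_basicType (j : Fin 3) (β : Fin 3 → ZMod 2) :
    reflectSign (basicType j) β = (-1) ^ (β j).val := by
  unfold reflectSign basicType
  rw [Fintype.prod_eq_single j fun i hi => by simp [hi]]
  simp [ZMod.val_one]

lemma sum_neg_one_pow_val_mul_val (a : ZMod 2) :
    ∑ b : ZMod 2, (-1 : ℝ) ^ (a.val * b.val) = if a = 0 then 2 else 0 := by
  rw [show (Finset.univ : Finset (ZMod 2)) = {0, 1} from rfl, Finset.sum_pair zero_ne_one]
  obtain rfl | rfl : a = 0 ∨ a = 1 := by decide +revert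
  · norm_num
  · simp [ZMod.val_one]

lemma sum_reflectSign (α : Fin 3 → ZMod 2) :
    ∑ β, reflectSign α β = if α = 0 then 8 else 0 := by
  have hprod := Finset.prod_univ_sum (fun _ : Fin 3 => (Finset.univ : Finset (ZMod 2)))
    (fun i b => (-1 : ℝ) ^ ((α i).val * b.val))
  rw [Fintype.piFinset_univ] at hprod
  simp_rw [reflectSign, ← hprod, sum_neg_one_pow_val_mul_val]
  split_ifs with h
  · norm_num [h]
  · obtain ⟨i, hi⟩ := Function.ne_iff.1 h
    exact Finset.prod_eq_zero (Finset.mem_univ i) (if_neg hi)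

lemma sum_reflectSign_mul (α δ : Fin 3 → ZMod 2) :
    ∑ β, reflectSign δ β * reflectSign α β = if α = δ then 8 else 0 := by
  simp_rw [← reflectSign_add, sum_reflectSign, CharTwo.add_eq_zero, eq_comm]

lemma sum_ite_eq_zero_of_sum_reflectSign_mul_eq_zero {ι : Type*} [Fintype ι] {c : ι → ℝ}
    {a : ι → Fin 3 → ZMod 2} (h : ∀ β, ∑ i, reflectSign (a i) β * c i = 0)
    (δ : Fin 3 → ZMod 2) : ∑ i, (if a i = δ then c i else 0) = 0 := by
  have hproj : ∑ β, reflectSign δ β * ∑ i, reflectSign (a i) β * c i = 0 :=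
    Finset.sum_eq_zero fun β _ => by rw [h, mul_zero]
  simp_rw [Finset.mul_sum, ← mul_assoc] at hproj
  rw [Finset.sum_comm] at hproj
  simp_rw [← Finset.sum_mul, sum_reflectSign_mul, ite_mul, zero_mul, ← mul_ite_zero,
    ← Finset.mul_sum] at hproj
  exact (mul_eq_zero.1 hproj).resolve_left (by norm_num)

/-! ### Reflections -/

lemma reflect_apply (β : Fin 3 → ZMod 2) (x : E3) (i : Fin 3) :
    reflect β x i = reflectSign (basicType i) β * x i := by
  rw [reflectSign_basicType]
  rfl

lemma reflect_reflect (β : Fin 3 → ZMod 2) (x : E3) : reflect β (reflect β x) = x := by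
  ext i
  rw [reflect_apply, reflect_apply, ← mul_assoc, reflectSign_mul_self, one_mul]

lemma norm_reflect (β : Fin 3 → ZMod 2) (x : E3) : ‖reflect β x‖ = ‖x‖ := by
  simp_rw [EuclideanSpace.norm_eq, reflect_apply, norm_mul, mul_pow, ← norm_pow,
    sq (reflectSign _ _), reflectSign_mul_self, norm_one, one_mul]

/-- The reflection `reflect β`, bundled as a linear isometry in order to change variables in
integrals and to act on test functions. -/
def reflectIso (β : Fin 3 → ZMod 2) : E3 ≃ₗᵢ[ℝ] E3 where
  toFun := reflect β
  invFun := reflect β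
  left_inv := reflect_reflect β
  right_inv := reflect_reflect β
  map_add' x y := by
    ext i
    simp only [reflect_apply, PiLp.add_apply, mul_add]
  map_smul' c x := by
    ext i
    simp only [reflect_apply, PiLp.smul_apply, RingHom.id_apply, smul_eq_mul, mul_left_comm]
  norm_map' := norm_reflect β

lemma reflect_sub (β : Fin 3 → ZMod 2) (x y : E3) :
    reflect β (x - y) = reflect β x - reflect β y :=
  map_sub (reflectIso β) x y

lemma measurePreserving_reflect (β : Fin 3 → ZMod 2) :
    MeasurePreserving (reflect β) (volume : Measure E3) volume :=
  (reflectIso β).measurePreserving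

lemma integral_reflect (β : Fin 3 → ZMod 2) (f : E3 → ℝ) :
    ∫ x, f (reflect β x) = ∫ x, f x :=
  (measurePreserving_reflect β).integral_comp
    (reflectIso β).toHomeomorph.measurableEmbedding f

lemma reflect_basisVec (β : Fin 3 → ZMod 2) (j : Fin 3) :
    reflect β (EuclideanSpace.single j 1) =
      reflectSign (basicType j) β • (EuclideanSpace.single j 1 : E3) := by
  ext i
  rw [reflect_apply]
  by_cases h : i = j
  · subst h
    simp
  · simp [h]

lemma heatKernel_reflect (β : Fin 3 → ZMod 2) (t : ℝ) (x : E3) :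
    heatKernel t (reflect β x) = heatKernel t x := by
  rw [heatKernel, norm_reflect, heatKernel]

lemma kronecker_mul_reflectSign (β : Fin 3 → ZMod 2) (j k : Fin 3) :
    kronecker j k * (reflectSign (basicType j) β * reflectSign (basicType k) β) =
      kronecker j k := by
  unfold kronecker
  split_ifs with h
  · rw [h, reflectSign_mul_self, one_mul]
  · rw [zero_mul]

lemma heatKernelD3_reflect (β : Fin 3 → ZMod 2) (j k l : Fin 3) (t : ℝ) (x : E3) :
    heatKernelD3 j k l t (reflect β x) =
      reflectSign (basicType j + basicType k + basicType l) β * heatKernelD3 j k l t x := by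
  unfold heatKernelD3
  rw [heatKernel_reflect, reflectSign_add, reflectSign_add, reflect_apply, reflect_apply,
    reflect_apply]
  have hjk := kronecker_mul_reflectSign β j k
  have hjl := kronecker_mul_reflectSign β j l
  have hkl := kronecker_mul_reflectSign β k l
  generalize reflectSign (basicType j) β = a at *
  generalize reflectSign (basicType k) β = b at *
  generalize reflectSign (basicType l) β = c at *
  linear_combination (-(c * x l) / (4 * t ^ 2) * heatKernel t x) * hjk +
    (-(b * x k) / (4 * t ^ 2) * heatKernel t x) * hjl +
    (-(a * x j) / (4 * t ^ 2) * heatKernel t x) * hkl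

lemma oseenKernel_reflect (β : Fin 3 → ZMod 2) (j k l : Fin 3) {t : ℝ} (ht : 0 < t) (x : E3) :
    oseenKernel j k l t (reflect β x) =
      reflectSign (basicType j + basicType k + basicType l) β * oseenKernel j k l t x := by
  rw [oseenKernel_eq j k l ht, oseenKernel_eq j k l ht]
  simp_rw [heatKernelD3_reflect]
  rw [integral_const_mul, partialDeriv_heatKernel, partialDeriv_heatKernel, heatKernel_reflect,
    reflectSign_add, reflectSign_add, reflect_apply]
  have hkl := kronecker_mul_reflectSign β k l
  generalize reflectSign (basicType j) β = a at *
  generalize reflectSign (basicType k) β = b at *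
  generalize reflectSign (basicType l) β = c at *
  linear_combination (a * x j / (2 * t) * heatKernel t x) * hkl

/-! ### Symmetries of functions -/

namespace HasSymmetry

variable {f g : E3 → ℝ} {α α' : Fin 3 → ZMod 2}

lemma congr (hf : HasSymmetry f α) (h : f =ᵐ[volume] g) : HasSymmetry g α := fun β => by
  filter_upwards [hf β, h, (measurePreserving_reflect β).quasiMeasurePreserving.ae h]
    with x hfx hx hβx
  rw [← hx, ← hβx, hfx]

lemma mul (hf : HasSymmetry f α) (hg : HasSymmetry g α') :
    HasSymmetry (fun x => f x * g x) (α + α') := fun β => by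
  filter_upwards [hf β, hg β] with x hfx hgx
  rw [hfx, hgx, reflectSign_add, mul_mul_mul_comm]

lemma sub (hf : HasSymmetry f α) (hg : HasSymmetry g α) :
    HasSymmetry (fun x => f x - g x) α := fun β => by
  filter_upwards [hf β, hg β] with x hfx hgx
  rw [hfx, hgx, mul_sub]

lemma sum {ι : Type*} [Fintype ι] {f : ι → E3 → ℝ} (hf : ∀ i, HasSymmetry (f i) α) :
    HasSymmetry (fun x => ∑ i, f i x) α := fun β => by
  filter_upwards [ae_all_iff.2 fun i => hf i β] with x hx
  simp_rw [Finset.mul_sum, hx]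

end HasSymmetry

lemma HasSymmetryType.congr {v w : E3 → E3} {α : Fin 3 → Fin 3 → ZMod 2}
    (hv : HasSymmetryType v α) (h : v =ᵐ[volume] w) : HasSymmetryType w α := fun l =>
  (hv l).congr (h.mono fun x hx => by simp only [hx])

lemma ae_sum_ite_eq_zero_of_hasSymmetry_sum {ι : Type*} [Fintype ι] {f : ι → E3 → ℝ}
    {a : ι → Fin 3 → ZMod 2} (hf : ∀ i, HasSymmetry (f i) (a i)) {α δ : Fin 3 → ZMod 2}
    (h : HasSymmetry (fun x => ∑ i, f i x) α) (hδ : δ ≠ α) :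
    ∀ᵐ x, ∑ i, (if a i = δ then f i x else 0) = 0 := by
  filter_upwards [ae_all_iff.2 fun β => ae_all_iff.2 fun i => hf i β, ae_all_iff.2 h] with x hx hsum
  have hcancel := sum_ite_eq_zero_of_sum_reflectSign_mul_eq_zero (ι := Option ι)
    (c := fun o => o.elim (-∑ i, f i x) (fun i => f i x)) (a := fun o => o.elim α a)
    (fun β => by
      have hβ := hsum β
      simp_rw [hx] at hβ
      simp [Fintype.sum_option, hβ]) δ
  simp only [Fintype.sum_option, Option.elim_none, hδ.symm, if_false, zero_add,
    Option.elim_some] at hcancel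
  exact (Finset.sum_congr rfl fun i _ => by by_cases hi : a i = δ <;> simp [hi]).trans hcancel

lemma integral_kernel_reflect_sub_mul {K : E3 → ℝ} {κ α β : Fin 3 → ZMod 2} {f : E3 → ℝ}
    (hK : ∀ x, K (reflect β x) = reflectSign κ β * K x) (hf : HasSymmetry f α) (x : E3) :
    ∫ y, K (reflect β x - y) * f y = reflectSign (κ + α) β * ∫ y, K (x - y) * f y := by
  rw [← integral_reflect β, ← integral_const_mul]
  refine integral_congr_ae ?_
  filter_upwards [hf β] with y hy
  rw [← reflect_sub, hK, hy, reflectSign_add, mul_mul_mul_comm]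

lemma HasSymmetry.heat {f : E3 → ℝ} {α : Fin 3 → ZMod 2} (hf : HasSymmetry f α) (t : ℝ) :
    HasSymmetry (heat t f) α := fun β => Eventually.of_forall fun x => by
  have hinv := integral_kernel_reflect_sub_mul (K := heatKernel t) (κ := 0) (β := β)
    (fun x => by rw [heatKernel_reflect, reflectSign_zero, one_mul]) hf x
  rwa [zero_add] at hinv

lemma HasSymmetry.duhamelTerm {j k l : Fin 3} {P : ℝ → E3 → ℝ} {α : Fin 3 → ZMod 2} {t : ℝ}
    (hP : ∀ s ∈ Set.Ioo 0 t, HasSymmetry (P s) α) :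
    HasSymmetry (duhamelTerm j k l P t) (basicType j + basicType k + basicType l + α) :=
  fun β => Eventually.of_forall fun x => by
    unfold NavierStokes.duhamelTerm
    rw [← integral_const_mul]
    exact setIntegral_congr_fun measurableSet_Ioo fun s hs => integral_kernel_reflect_sub_mul
      (fun x => oseenKernel_reflect β j k l (sub_pos.2 hs.2) x) (hP s hs) x

/-! ### Symmetries and the divergence -/

/-- The test function `φ(reflect β x)`. -/
def reflectTest (β : Fin 3 → ZMod 2) (φ : 𝓢(E3, ℝ)) : 𝓢(E3, ℝ) :=
  SchwartzMap.compCLMOfContinuousLinearEquiv ℝ (reflectIso β).toContinuousLinearEquiv φ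

lemma reflectTest_apply (β : Fin 3 → ZMod 2) (φ : 𝓢(E3, ℝ)) (x : E3) :
    reflectTest β φ x = φ (reflect β x) := rfl

lemma partialDeriv_reflectTest (β : Fin 3 → ZMod 2) (φ : 𝓢(E3, ℝ)) (l : Fin 3) (x : E3) :
    partialDeriv l (reflectTest β φ) x =
      reflectSign (basicType l) β * partialDeriv l φ (reflect β x) := by
  have hchain : fderiv ℝ (reflectTest β φ) x =
      (fderiv ℝ φ (reflect β x)).comp ((reflectIso β).toContinuousLinearEquiv : E3 →L[ℝ] E3) :=
    (reflectIso β).toContinuousLinearEquiv.comp_right_fderiv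
  rw [partialDeriv, hchain]
  change fderiv ℝ φ (reflect β x) (reflect β (basisVec l)) = _
  rw [reflect_basisVec, map_smul, smul_eq_mul, partialDeriv]

lemma WeightedL1.integrable_mul_partialDeriv {f : E3 → ℝ} (hf : WeightedL1 f) (l : Fin 3)
    (φ : 𝓢(E3, ℝ)) : Integrable fun y => f y * partialDeriv l φ y := by
  obtain ⟨C, hC⟩ := exists_abs_schwartz_le_bracketWeight (schwartzPartial l φ)
  rw [← coe_schwartzPartial]
  exact hf.integrable_mul (schwartzPartial l φ).continuous.aestronglyMeasurable hC

lemma IsSolenoidal.sum_integral_mul_partialDeriv_eq_zero {v : E3 → E3} (hdiv : IsSolenoidal v)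
    (hv : WeightedL2 v) (φ : 𝓢(E3, ℝ)) : ∑ l, ∫ x, v x l * partialDeriv l φ x = 0 := by
  rw [← integral_finsetSum _ fun l _ => (hv.weightedL1_coord l).integrable_mul_partialDeriv l φ]
  exact hdiv φ

lemma IsSolenoidal.integral_partialDeriv_eq_zero {v : E3 → E3} (hdiv : IsSolenoidal v)
    (hv : WeightedL2 v) {α : Fin 3 → Fin 3 → ZMod 2} (hα : HasSymmetryType v α) {r : Fin 3}
    (hr : ∀ l, l ≠ r → α l + basicType l ≠ α r + basicType r) (φ : 𝓢(E3, ℝ)) :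
    ∫ x, v x r * partialDeriv r φ x = 0 := by
  have hcancel := sum_ite_eq_zero_of_sum_reflectSign_mul_eq_zero
    (c := fun l => ∫ x, v x l * partialDeriv l φ x) (a := fun l => α l + basicType l)
    (fun β => ?_) (α r + basicType r)
  · rw [Finset.sum_eq_single r (fun l _ hl => if_neg (hr l hl)) (by simp)] at hcancel
    simpa using hcancel
  · rw [← hdiv.sum_integral_mul_partialDeriv_eq_zero hv (reflectTest β φ)]
    refine Finset.sum_congr rfl fun l _ => ?_
    rw [← integral_reflect β (fun x => v x l * partialDeriv l (reflectTest β φ) x),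
      ← integral_const_mul]
    refine integral_congr_ae ((hα l β).mono fun x hx => ?_)
    simp only [hx, partialDeriv_reflectTest, reflect_reflect, reflectSign_add]
    ring

/-! ### Functions with a vanishing derivative -/

lemma WeightedL1.locallyIntegrable {f : E3 → ℝ} (hf : WeightedL1 f) : LocallyIntegrable f := by
  have h := (locallyIntegrableOn_univ.2 (Integrable.locallyIntegrable hf)).mul_continuousOn
    (continuous_bracketWeight.inv₀ fun y => (bracketWeight_pos y).ne').continuousOn
    isOpen_univ.isLocallyClosed
  rw [locallyIntegrableOn_univ] at h
  refine h.congr (Eventually.of_forall fun y => ?_)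
  simp only [Pi.inv_apply, mul_inv_cancel_right₀ (bracketWeight_pos y).ne']

lemma norm_mul_comp_sub_le {K : E3 → ℝ} {D R : ℝ} (hK : ∀ x, |K x| ≤ D * bracketWeight x)
    (f : E3 → ℝ) {c : E3} (hc : ‖c‖ ≤ R) (y : E3) :
    ‖f y * K (y - c)‖ ≤ D * (4 * (1 + R ^ 2) ^ 2) * |f y * bracketWeight y| := by
  have hD := nonneg_of_abs_le_mul_bracketWeight hK
  have hy := bracketWeight_nonneg y
  rw [norm_mul, abs_mul, abs_of_nonneg hy]
  calc ‖f y‖ * |K (y - c)|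
      ≤ |f y| * (D * (4 * (1 + ‖c‖ ^ 2) ^ 2 * bracketWeight y)) :=
        mul_le_mul_of_nonneg_left
          ((hK _).trans (mul_le_mul_of_nonneg_left (bracketWeight_sub_le y c) hD)) (abs_nonneg _)
    _ ≤ |f y| * (D * (4 * (1 + R ^ 2) ^ 2 * bracketWeight y)) := by gcongr
    _ = _ := by ring

lemma WeightedL1.hasDerivAt_integral_mul_translate {f : E3 → ℝ} (hf : WeightedL1 f) (r : Fin 3)
    (φ : 𝓢(E3, ℝ)) (s₀ : ℝ) :
    HasDerivAt (fun s : ℝ => ∫ y, f y * φ (y - s • basisVec r))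
      (∫ y, f y * -partialDeriv r φ (y - s₀ • basisVec r)) s₀ := by
  obtain ⟨C, hC⟩ := exists_abs_schwartz_le_bracketWeight φ
  obtain ⟨C', hC'⟩ := exists_abs_schwartz_le_bracketWeight (schwartzPartial r φ)
  have hm := hf.aestronglyMeasurable
  have hnorm : ∀ s ∈ Metric.ball s₀ 1, ‖s • basisVec r‖ ≤ |s₀| + 1 := fun s hs => by
    rw [norm_smul, PiLp.norm_single, norm_one, mul_one, Real.norm_eq_abs]
    linarith [abs_sub_abs_le_abs_sub s s₀, mem_ball_iff_norm.1 hs, Real.norm_eq_abs (s - s₀)]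
  have hmeas (s : ℝ) : AEStronglyMeasurable fun y => f y * φ (y - s • basisVec r) :=
    hm.mul (φ.continuous.comp (by fun_prop)).aestronglyMeasurable
  rw [← coe_schwartzPartial]
  refine (hasDerivAt_integral_of_dominated_loc_of_deriv_le
    (bound := fun y => C' * (4 * (1 + (|s₀| + 1) ^ 2) ^ 2) * |f y * bracketWeight y|)
    (F' := fun s y => f y * -schwartzPartial r φ (y - s • basisVec r))
    (Metric.ball_mem_nhds s₀ one_pos) (Eventually.of_forall hmeas) ?_ ?_ ?_ ?_ ?_).2
  · exact ((Integrable.abs hf).const_mul _).mono' (hmeas s₀) (Eventually.of_forall fun y =>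
      norm_mul_comp_sub_le hC f (hnorm s₀ (Metric.mem_ball_self one_pos)) y)
  · exact hm.mul ((schwartzPartial r φ).continuous.comp (by fun_prop)).neg.aestronglyMeasurable
  · refine Eventually.of_forall fun y s hs => ?_
    rw [mul_neg, norm_neg]
    exact norm_mul_comp_sub_le hC' f (hnorm s hs) y
  · exact (Integrable.abs hf).const_mul _
  · refine Eventually.of_forall fun y s _ => HasDerivAt.const_mul _ ?_
    have hline : HasDerivAt (fun s : ℝ => y - s • basisVec r) (-basisVec r) s := by
      simpa using ((hasDerivAt_id s).smul_const (basisVec r)).const_sub y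
    have hchain := (φ.differentiable (y - s • basisVec r)).hasFDerivAt.comp_hasDerivAt s hline
    rw [map_neg] at hchain
    rwa [coe_schwartzPartial]

lemma WeightedL1.integral_mul_comp_sub_single {f : E3 → ℝ} (hf : WeightedL1 f) {r : Fin 3}
    (hzero : ∀ φ : 𝓢(E3, ℝ), ∫ y, f y * partialDeriv r φ y = 0) (φ : 𝓢(E3, ℝ)) (h : ℝ) :
    ∫ y, f y * φ (y - EuclideanSpace.single r h) = ∫ y, f y * φ y := by
  have htranslate (c y : E3) :
      partialDeriv r φ (y - c) = partialDeriv r (φ.compSubConstCLM ℝ c) y :=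
    congrArg (fun L : E3 →L[ℝ] ℝ => L (basisVec r)) (fderiv_comp_sub (f := φ) (x := y) c).symm
  have hderiv (s : ℝ) : HasDerivAt (fun s : ℝ => ∫ y, f y * φ (y - s • basisVec r)) 0 s := by
    have hd := hf.hasDerivAt_integral_mul_translate r φ s
    simp_rw [mul_neg, integral_neg, htranslate, hzero, neg_zero] at hd
    exact hd
  have hsmul : h • basisVec r = EuclideanSpace.single r h := by
    ext i
    simp
  simpa [hsmul] using is_const_of_deriv_eq_zero (fun s => (hderiv s).differentiableAt)
    (fun s => (hderiv s).deriv) h 0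

lemma WeightedL1.comp_add_right {f : E3 → ℝ} (hf : WeightedL1 f) (c : E3) :
    WeightedL1 fun y => f (y + c) := by
  refine ((Integrable.comp_add_right hf c).abs.const_mul (4 * (1 + ‖c‖ ^ 2) ^ 2)).mono'
    ((hf.aestronglyMeasurable.comp_measurePreserving
      (measurePreserving_add_right volume c)).mul continuous_bracketWeight.aestronglyMeasurable)
    (Eventually.of_forall fun y => ?_)
  have hw := bracketWeight_sub_le (y + c) c
  rw [add_sub_cancel_right] at hw
  rw [norm_mul, abs_mul, abs_of_pos (bracketWeight_pos _),
    Real.norm_of_nonneg (bracketWeight_nonneg y)]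
  calc ‖f (y + c)‖ * bracketWeight y
      ≤ ‖f (y + c)‖ * (4 * (1 + ‖c‖ ^ 2) ^ 2 * bracketWeight (y + c)) :=
        mul_le_mul_of_nonneg_left hw (norm_nonneg _)
    _ = _ := by rw [Real.norm_eq_abs]; ring

lemma independentOf_of_integral_partialDeriv {f : E3 → ℝ} (hf : WeightedL1 f) {r : Fin 3}
    (hzero : ∀ φ : 𝓢(E3, ℝ), ∫ y, f y * partialDeriv r φ y = 0) : IndependentOf f r := by
  intro h
  refine ae_eq_of_integral_contDiff_smul_eq (hf.comp_add_right _).locallyIntegrable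
    hf.locallyIntegrable fun g hg hgc => ?_
  have htest := hf.integral_mul_comp_sub_single hzero (hgc.toSchwartzMap hg) h
  rw [← integral_add_right_eq_self _ (EuclideanSpace.single r h)] at htest
  simpa [mul_comm (g _)] using htest

/-! ### Fields with a constant component -/

lemma integrable_heatKernelD3_sub_mul_weightedL1_prod (j k l : Fin 3) {f : E3 → ℝ}
    (hf : WeightedL1 f) {a : ℝ} (ha : 0 < a) (x : E3) :
    Integrable (fun p : ℝ × E3 => heatKernelD3 j k l (p.1 + a) (x - p.2) * f p.2)
      ((volume.restrict (Set.Ioi 0)).prod volume) := by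
  have hm : AEStronglyMeasurable
      (fun p : ℝ × E3 => heatKernelD3 j k l (p.1 + a) (x - p.2) * f p.2)
      ((volume.restrict (Set.Ioi 0)).prod volume) :=
    (measurable_heatKernelD3_comp j k l (by fun_prop) (by fun_prop)).aestronglyMeasurable.mul
      hf.aestronglyMeasurable.comp_snd
  rw [integrable_prod_iff' hm]
  refine ⟨Eventually.of_forall fun y =>
    (integrableOn_heatKernelD3 j k l (by simpa using ha) (x - y)).mul_const (f y), ?_⟩
  have hkernel := abs_comp_sub_le_bracketWeight (C := 2112 * (1 + a⁻¹) ^ 2)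
    (K := fun z => ∫ σ in Set.Ioi (0 : ℝ), |heatKernelD3 j k l (σ + a) z|) (fun z => by
      rw [abs_of_nonneg (integral_nonneg fun _ => abs_nonneg _), mul_assoc]
      refine (integral_abs_heatKernelD3_le j k l (by simpa using ha) z).trans ?_
      rw [zero_add]
      gcongr
      exact inv_add_norm_sq_le_bracketWeight ha z) x
  have hmK : AEStronglyMeasurable
      fun y => ∫ σ in Set.Ioi (0 : ℝ), |heatKernelD3 j k l (σ + a) (x - y)| :=
    (measurable_heatKernelD3_comp (α := E3 × ℝ) j k l (f := fun p => p.2 + a)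
      (g := fun p => x - p.1) (by fun_prop)
        (by fun_prop)).abs.stronglyMeasurable.integral_prod_right'.aestronglyMeasurable
  refine (hf.integrable_mul hmK hkernel).norm.congr (Eventually.of_forall fun y => ?_)
  simp only [norm_mul, Real.norm_eq_abs, integral_mul_const]
  rw [abs_of_nonneg (integral_nonneg fun _ => abs_nonneg _), mul_comm]

/-- Under the integral over `σ`, the sum over `k` is the divergence of `v` tested against the
Schwartz function `∂_r ∂_l G_{σ+a}(x - ·)`. -/
lemma IsSolenoidal.sum_integral_heatKernelD3_eq_zero {v : E3 → E3} (hdiv : IsSolenoidal v)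
    (hv : WeightedL2 v) (r l : Fin 3) {a : ℝ} (ha : 0 < a) (x : E3) :
    ∑ k, ∫ y, (∫ σ in Set.Ioi (0 : ℝ), heatKernelD3 k r l (σ + a) (x - y)) * v y k = 0 := by
  have hint k := integrable_heatKernelD3_sub_mul_weightedL1_prod k r l (hv.weightedL1_coord k) ha x
  have hswap k : ∫ y, (∫ σ in Set.Ioi (0 : ℝ), heatKernelD3 k r l (σ + a) (x - y)) * v y k =
      ∫ σ in Set.Ioi (0 : ℝ), ∫ y, heatKernelD3 k r l (σ + a) (x - y) * v y k := by
    simp_rw [← integral_mul_const]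
    exact (integral_integral_swap (f := fun (σ : ℝ) y =>
      heatKernelD3 k r l (σ + a) (x - y) * v y k) (hint k)).symm
  simp_rw [hswap]
  rw [← integral_finsetSum _ fun k _ => (hint k).integral_prod_left]
  refine setIntegral_eq_zero_of_forall_eq_zero fun σ hσ => ?_
  have hpos : 0 < σ + a := add_pos hσ ha
  have hpartial k y : partialDeriv k (compConstSub x
      (schwartzPartial r (schwartzPartial l (heatKernelSchwartz hpos)))) y =
        -heatKernelD3 k r l (σ + a) (x - y) := by
    rw [← coe_thirdPartial_heatKernelSchwartz k r l hpos, thirdPartial, coe_schwartzPartial k]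
    exact partialDeriv_comp_sub k
      (schwartzPartial r (schwartzPartial l (heatKernelSchwartz hpos))) x y
  have htest := hdiv.sum_integral_mul_partialDeriv_eq_zero hv (compConstSub x
    (schwartzPartial r (schwartzPartial l (heatKernelSchwartz hpos))))
  simp_rw [hpartial, mul_neg, integral_neg, Finset.sum_neg_distrib, neg_eq_zero] at htest
  simpa only [mul_comm] using htest

lemma sum_ite_xor_eq_sum_add (r : Fin 3) (f : Fin 3 → Fin 3 → ℝ) :
    ∑ j, ∑ k, (if ¬(j = r ↔ k = r) then f j k else 0) =
      ∑ k, (if k = r then 0 else f r k + f k r) := by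
  fin_cases r <;> simp [Fin.sum_univ_three] <;> ring

lemma oseenConv_const_mul (j k l : Fin 3) (a c : ℝ) (f : E3 → ℝ) (x : E3) :
    oseenConv j k l a (fun y => c * f y) x = c * oseenConv j k l a f x := by
  simp only [oseenConv, mul_left_comm _ c, integral_const_mul]

lemma oseenConv_congr (j k l : Fin 3) (a : ℝ) {f g : E3 → ℝ} (h : f =ᵐ[volume] g) :
    oseenConv j k l a f = oseenConv j k l a g :=
  funext fun _ => integral_congr_ae (h.mono fun y hy => by simp only [hy])

section ConstantComponent

variable {v : E3 → E3} {r l : Fin 3} {a : ℝ}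

lemma oseenKernel_of_ne (hlr : l ≠ r) (k : Fin 3) (ha : 0 < a) (x : E3) :
    oseenKernel k r l a x = ∫ σ in Set.Ioi (0 : ℝ), heatKernelD3 k r l (σ + a) x := by
  simp [oseenKernel_eq k r l ha, kronecker, hlr.symm]

lemma oseenKernel_swap_of_ne (hlr : l ≠ r) (k : Fin 3) (ha : 0 < a) (x : E3) :
    oseenKernel r k l a x =
      kronecker k l * partialDeriv r (heatKernel a) x + oseenKernel k r l a x := by
  simp_rw [oseenKernel_of_ne hlr k ha, oseenKernel_eq r k l ha, heatKernelD3_swap r k l]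

lemma IsSolenoidal.sum_oseenConv_eq_zero (hdiv : IsSolenoidal v) (hv : WeightedL2 v) (hlr : l ≠ r)
    (ha : 0 < a) (x : E3) : ∑ k, oseenConv k r l a (fun y => v y k) x = 0 := by
  simp_rw [oseenConv, oseenKernel_of_ne hlr _ ha]
  exact hdiv.sum_integral_heatKernelD3_eq_zero hv r l ha x

lemma oseenConv_swap_of_ne (hlr : l ≠ r) (k : Fin 3) {f : E3 → ℝ} (hf : WeightedL1 f) (ha : 0 < a)
    (x : E3) :
    oseenConv r k l a f x = kronecker k l * (∫ y, partialDeriv r (heatKernel a) (x - y) * f y) +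
      oseenConv k r l a f x := by
  have hD := hf.integrable_kernel_mul (continuous_partialDeriv_heatKernel r ha)
    (abs_partialDeriv_heatKernel_le_bracketWeight r ha) x
  have hK := hf.integrable_kernel_mul (continuous_oseenKernel k r l ha)
    (abs_oseenKernel_le_bracketWeight k r l ha) x
  simp_rw [oseenConv, oseenKernel_swap_of_ne hlr k ha, add_mul, mul_assoc]
  rw [integral_add (hD.const_mul _) hK, integral_const_mul]

/-- With `v_r = c`, the terms linear in the remaining components sum to `c ∂_r v_l` by
incompressibility; the terms with `k = r` are those of a constant function. -/
lemma IsSolenoidal.sum_oseenConv_mixed_eq (hdiv : IsSolenoidal v) (hv : WeightedL2 v) (hlr : l ≠ r)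
    {c : ℝ} (hc : ∀ᵐ y, v y r = c) (ha : 0 < a) (x : E3) :
    ∑ j, ∑ k, oseenConv j k l a (fun y => if ¬(j = r ↔ k = r) then v y j * v y k else 0) x =
      c * ∫ y, partialDeriv r (heatKernel a) (x - y) * v y l := by
  have hite j k :
      oseenConv j k l a (fun y => if ¬(j = r ↔ k = r) then v y j * v y k else 0) x =
        if ¬(j = r ↔ k = r) then oseenConv j k l a (fun y => v y j * v y k) x else 0 := by
    split_ifs
    · exact oseenConv_const j k l ha 0 x
    · rfl
  have hterm k : (if k = r then 0 else oseenConv r k l a (fun y => v y r * v y k) x +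
      oseenConv k r l a (fun y => v y k * v y r) x) =
        c * (kronecker k l * (∫ y, partialDeriv r (heatKernel a) (x - y) * v y k)) +
          2 * c * oseenConv k r l a (fun y => v y k) x := by
    split_ifs with hk
    · subst hk
      rw [oseenConv_congr k k l a hc, oseenConv_const k k l ha]
      simp [kronecker, hlr.symm]
    · rw [oseenConv_congr r k l a (g := fun y => c * v y k) (hc.mono fun y hy => by simp only [hy]),
        oseenConv_congr k r l a (g := fun y => c * v y k)
          (hc.mono fun y hy => by simp only [hy, mul_comm]),
        oseenConv_const_mul, oseenConv_const_mul,
        oseenConv_swap_of_ne hlr k (hv.weightedL1_coord k) ha]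
      ring
  simp_rw [hite, sum_ite_xor_eq_sum_add, hterm, Finset.sum_add_distrib, ← Finset.mul_sum,
    hdiv.sum_oseenConv_eq_zero hv hlr ha]
  simp [kronecker]

end ConstantComponent

/-! ### Symmetry types preserved by the flow -/

/-- The deviation, in component `l`, of the symmetry type `α` from the basic type `(e₁, e₂, e₃)`.
The contribution of `u_j u_k` to the `l`-th component of `B(u, u)` has the symmetry of a monomial of
type `e_l + defect α j + defect α k`, to be compared with `α l = e_l + defect α l`. -/
def defect (α : Fin 3 → Fin 3 → ZMod 2) (l : Fin 3) : Fin 3 → ZMod 2 :=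
  α l + basicType l

lemma defect_eq_zero_iff {α : Fin 3 → Fin 3 → ZMod 2} {l : Fin 3} :
    defect α l = 0 ↔ α l = basicType l := CharTwo.add_eq_zero

lemma defect_add_defect {α : Fin 3 → Fin 3 → ZMod 2} {r : Fin 3} {g : Fin 3 → ZMod 2}
    (hg : ∀ l, l ≠ r → defect α l = g) (j k : Fin 3) :
    defect α j + defect α k = if (j = r ↔ k = r) then 0 else defect α r + g := by
  by_cases hj : j = r <;> by_cases hk : k = r <;>
    simp [hj, hk, hg, CharTwo.add_self_eq_zero, add_comm]

lemma forall_eq_or_exists_exceptional_or_injective {X : Type*} (γ : Fin 3 → X) :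
    (∃ g, ∀ l, γ l = g) ∨ (∃ r g, γ r ≠ g ∧ ∀ l, l ≠ r → γ l = g) ∨ Function.Injective γ := by
  by_cases h₀₁ : γ 0 = γ 1
  · by_cases h₂₀ : γ 2 = γ 0
    · exact Or.inl ⟨γ 0, by simp [Fin.forall_fin_succ, *]⟩
    · exact Or.inr (Or.inl ⟨2, γ 0, h₂₀, by simp [Fin.forall_fin_succ, *]⟩)
  by_cases h₀₂ : γ 0 = γ 2
  · exact Or.inr (Or.inl ⟨1, γ 0, Ne.symm h₀₁, by simp [Fin.forall_fin_succ, *]⟩)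
  by_cases h₁₂ : γ 1 = γ 2
  · exact Or.inr (Or.inl ⟨0, γ 1, h₀₁, by simp [Fin.forall_fin_succ, *]⟩)
  · refine Or.inr (Or.inr fun a b => ?_)
    fin_cases a <;> fin_cases b <;> grind

lemma IsConstant.mul {f g : E3 → ℝ} (hf : IsConstant f) (hg : IsConstant g) :
    IsConstant fun x => f x * g x := by
  obtain ⟨c, hc⟩ := hf
  obtain ⟨d, hd⟩ := hg
  exact ⟨c * d, by filter_upwards [hc, hd] with x hfx hgx; rw [hfx, hgx]⟩

lemma HasSymmetry.of_ae_eq_zero {f : E3 → ℝ} (hf : ∀ᵐ x, f x = 0) (α : Fin 3 → ZMod 2) :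
    HasSymmetry f α := fun β => by
  filter_upwards [hf, (measurePreserving_reflect β).quasiMeasurePreserving.ae hf] with x hx hβx
  rw [hx, hβx, mul_zero]

lemma HasSymmetry.eq_zero_of_ae_eq_const {f : E3 → ℝ} {α : Fin 3 → ZMod 2} {c : ℝ}
    (hf : HasSymmetry f α) (hc : ∀ᵐ x, f x = c) (hα : α ≠ 0) : c = 0 := by
  have hβ β : c = reflectSign α β * c := by
    obtain ⟨x, hfx, hx, hβx⟩ := ((hf β).and (hc.and
      ((measurePreserving_reflect β).quasiMeasurePreserving.ae hc))).exists
    rwa [hx, hβx] at hfx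
  have hsum : ∑ _β : Fin 3 → ZMod 2, c = 0 := by
    rw [Finset.sum_congr rfl fun β _ => hβ β, ← Finset.sum_mul, sum_reflectSign, if_neg hα,
      zero_mul]
  simpa using hsum

/-- The summand of `B(u, u)_l` that comes from `u_j u_k`. -/
abbrev duhamelSummand (u : ℝ → E3 → E3) (j k l : Fin 3) (t : ℝ) (x : E3) : ℝ :=
  duhamelTerm j k l (fun s y => u s y j * u s y k) t x

lemma duhamel_apply (u : ℝ → E3 → E3) (t : ℝ) (x : E3) (l : Fin 3) :
    duhamel u u t x l = ∑ j, ∑ k, duhamelSummand u j k l t x := rfl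

lemma HasSymmetryType.duhamelSummand {u : ℝ → E3 → E3} {α : Fin 3 → Fin 3 → ZMod 2} {t : ℝ}
    (h : ∀ s, 0 < s → HasSymmetryType (u s) α) (j k l : Fin 3) :
    HasSymmetry (duhamelSummand u j k l t) (basicType l + (defect α j + defect α k)) := by
  have hsym : HasSymmetry (NavierStokes.duhamelSummand u j k l t)
      (basicType j + basicType k + basicType l + (α j + α k)) :=
    HasSymmetry.duhamelTerm fun s hs => (h s hs.1 j).mul (h s hs.1 k)
  convert hsym using 1
  simp only [defect]
  abel

lemma duhamelSummand_eq_zero {u : ℝ → E3 → E3} {j k : Fin 3}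
    (h : ∀ᵐ s ∂volume.restrict (Set.Ioi (0 : ℝ)), IsConstant fun y => u s y j * u s y k)
    (l : Fin 3) (t : ℝ) (x : E3) : duhamelSummand u j k l t x = 0 := by
  refine integral_eq_zero_of_ae ?_
  filter_upwards [ae_restrict_of_ae_restrict_of_subset Set.Ioo_subset_Ioi_self h,
    ae_restrict_mem measurableSet_Ioo] with s ⟨c, hc⟩ hst
  rw [oseenConv_congr j k l _ hc, oseenConv_const j k l (sub_pos.2 hst.2), Pi.zero_apply]

/-- The part of `B(u, u)_l` that comes from `u_r²` and from the products of the two components other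
than `u_r`. -/
def duhamelDiagonal (u : ℝ → E3 → E3) (r l : Fin 3) (t : ℝ) (x : E3) : ℝ :=
  ∑ j, ∑ k, if (j = r ↔ k = r) then duhamelSummand u j k l t x else 0

/-- The part of `B(u, u)_l` that comes from the products of `u_r` with the other two components. -/
def duhamelMixed (u : ℝ → E3 → E3) (r l : Fin 3) (t : ℝ) (x : E3) : ℝ :=
  ∑ j, ∑ k, if ¬(j = r ↔ k = r) then duhamelSummand u j k l t x else 0

lemma duhamel_eq_diagonal_add_mixed (u : ℝ → E3 → E3) (r l : Fin 3) (t : ℝ) (x : E3) :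
    duhamel u u t x l = duhamelDiagonal u r l t x + duhamelMixed u r l t x := by
  simp_rw [duhamel_apply, duhamelDiagonal, duhamelMixed, ← Finset.sum_add_distrib, ite_not]
  congr! 2 with j - k -
  split_ifs <;> simp

lemma duhamelMixed_eq_zero {u : ℝ → E3 → E3} {r : Fin 3}
    (h : ∀ᵐ s ∂volume.restrict (Set.Ioi (0 : ℝ)),
      (∀ᵐ y, u s y r = 0) ∨ ∀ l, IsConstant fun y => u s y l) (l : Fin 3) (t : ℝ) (x : E3) :
    duhamelMixed u r l t x = 0 := by
  refine Finset.sum_eq_zero fun j _ => Finset.sum_eq_zero fun k _ => ?_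
  split_ifs with hjk
  · rfl
  refine duhamelSummand_eq_zero ?_ l t x
  filter_upwards [h] with s hs
  rcases hs with hzero | hconst
  · refine ⟨0, hzero.mono fun y hy => ?_⟩
    obtain rfl | rfl : j = r ∨ k = r := by tauto
    · simp only [hy, zero_mul]
    · simp only [hy, mul_zero]
  · exact (hconst j).mul (hconst k)

lemma isBeltramiType_of_isConstant {v : E3 → E3} (hv : IsSolenoidal v)
    (h : ∀ l, IsConstant fun x => v x l) : IsBeltramiType v := by
  choose c hc using h
  exact isBeltramiType_of_const hv (c := WithLp.toLp 2 c)
    ((ae_all_iff.2 hc).mono fun x hx => PiLp.ext hx)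

namespace IsMildSolution

variable {u₀ : E3 → E3} {u : ℝ → E3 → E3} {α : Fin 3 → Fin 3 → ZMod 2} {r : Fin 3} {c : ℝ → ℝ}
  {g : Fin 3 → ZMod 2}

lemma weightedL2 (hu : IsMildSolution u₀ u) {t : ℝ} (ht : 0 ≤ t) : WeightedL2 (u t) := by
  rcases ht.eq_or_lt with rfl | ht
  · exact ⟨hu.data_weightedL2.1.congr hu.initial.symm,
      hu.data_weightedL2.2.congr (hu.initial.mono fun x hx => by simp only [hx])⟩
  · exact hu.inPathSpace.weightedL2 t ht

lemma isSolenoidal (hu : IsMildSolution u₀ u) {t : ℝ} (ht : 0 ≤ t) : IsSolenoidal (u t) := by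
  rcases ht.eq_or_lt with rfl | ht
  · exact fun φ => (integral_congr_ae (hu.initial.mono fun x hx => by simp only [hx])).trans
      (hu.data_solenoidal φ)
  · exact hu.solenoidal t ht

lemma isConstant_apply (hu : IsMildSolution u₀ u) {t : ℝ} (ht : 0 ≤ t)
    (hα : HasSymmetryType (u t) α) (hdim : NotTwoAndHalfDimensional (u t))
    (hr : ∀ l, l ≠ r → defect α l ≠ defect α r) : IsConstant fun x => u t x r := by
  by_cases hzero : ∀ᵐ x, u t x r = 0
  · exact ⟨0, hzero⟩
  · exact hdim r hzero r (independentOf_of_integral_partialDeriv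
      ((hu.weightedL2 ht).weightedL1_coord r)
      ((hu.isSolenoidal ht).integral_partialDeriv_eq_zero (hu.weightedL2 ht) hα hr))

lemma ae_sum_group_eq_zero (hu : IsMildSolution u₀ u)
    (hα : ∀ t, 0 ≤ t → HasSymmetryType (u t) α) {l : Fin 3} {δ : Fin 3 → ZMod 2}
    (hδ : δ ≠ defect α l) {t : ℝ} (ht : 0 < t) :
    ∀ᵐ x, ∑ j, ∑ k,
      (if defect α j + defect α k = δ then duhamelSummand u j k l t x else 0) = 0 := by
  have hlinear : HasSymmetry (fun x => heat t (fun y => u₀ y l) x - u t x l) (α l) :=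
    (((hα 0 le_rfl).congr hu.initial l).heat t).sub (hα t ht.le l)
  have hsum : HasSymmetry
      (fun x => ∑ i : Fin 3 × Fin 3, duhamelSummand u i.1 i.2 l t x) (α l) := by
    refine hlinear.congr ?_
    filter_upwards [hu.integral_equation t ht] with x hx
    simp only [hx, PiLp.sub_apply, duhamel_apply, heatVec, sub_sub_cancel, Fintype.sum_prod_type]
  have hne : basicType l + δ ≠ α l := fun h => hδ <| by
    rw [defect, ← h, add_right_comm, CharTwo.add_self_eq_zero, zero_add]
  simpa only [add_right_inj, Fintype.sum_prod_type] using ae_sum_ite_eq_zero_of_hasSymmetry_sum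
    (fun i : Fin 3 × Fin 3 => HasSymmetryType.duhamelSummand (fun s hs => hα s hs.le) i.1 i.2 l)
    hsum hne

lemma isBeltramiType_of_defect_eq (hu : IsMildSolution u₀ u)
    (hα : ∀ t, 0 ≤ t → HasSymmetryType (u t) α) (hg : ∀ l, defect α l = g) (hg0 : g ≠ 0) :
    IsBeltramiType u₀ := by
  refine hu.isBeltramiType fun l t ht => ?_
  filter_upwards [hu.ae_sum_group_eq_zero hα (l := l) (hg l ▸ hg0.symm) ht] with x hx
  simpa only [hg, CharTwo.add_self_eq_zero, if_true, ← duhamel_apply] using hx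

lemma ae_duhamelDiagonal_eq_zero (hu : IsMildSolution u₀ u)
    (hα : ∀ t, 0 ≤ t → HasSymmetryType (u t) α) (hrg : defect α r ≠ g)
    (hg : ∀ l, l ≠ r → defect α l = g) {l : Fin 3} (hl : defect α l ≠ 0) {t : ℝ} (ht : 0 < t) :
    ∀ᵐ x, duhamelDiagonal u r l t x = 0 := by
  have hne : defect α r + g ≠ 0 := fun h => hrg (CharTwo.add_eq_zero.1 h)
  filter_upwards [hu.ae_sum_group_eq_zero hα hl.symm ht] with x hx
  rw [duhamelDiagonal, ← hx]
  congr! 4 with j - k -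
  simp [defect_add_defect hg, hne]

lemma ae_duhamelMixed_eq_zero (hu : IsMildSolution u₀ u)
    (hα : ∀ t, 0 ≤ t → HasSymmetryType (u t) α) (hrg : defect α r ≠ g)
    (hg : ∀ l, l ≠ r → defect α l = g) {l : Fin 3} (hl : defect α l ≠ defect α r + g) {t : ℝ}
    (ht : 0 < t) : ∀ᵐ x, duhamelMixed u r l t x = 0 := by
  have hne : defect α r + g ≠ 0 := fun h => hrg (CharTwo.add_eq_zero.1 h)
  filter_upwards [hu.ae_sum_group_eq_zero hα hl.symm ht] with x hx
  rw [duhamelMixed, ← hx]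
  congr! 4 with j - k -
  simp [defect_add_defect hg, hne.symm]

lemma ae_duhamel_apply_eq_sub (hu : IsMildSolution u₀ u)
    (hc : ∀ t, 0 ≤ t → ∀ᵐ x, u t x r = c t) {t : ℝ} (ht : 0 < t) :
    ∀ᵐ x, duhamel u u t x r = c 0 - c t := by
  have hdata : ∀ᵐ x, u₀ x r = c 0 := by
    filter_upwards [hu.initial, hc 0 le_rfl] with x hx hcx
    rw [← hx, hcx]
  filter_upwards [hu.integral_equation t ht, hc t ht.le] with x hx hcx
  rw [hx, PiLp.sub_apply, heatVec, PiLp.toLp_apply, heat_const hdata ht] at hcx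
  linarith

lemma ae_isConstant_apply_of_mixed (hu : IsMildSolution u₀ u)
    (hdim : ∀ t : ℝ, 0 ≤ t → NotTwoAndHalfDimensional (u t))
    (hc : ∀ t, 0 ≤ t → ∀ᵐ x, u t x r = c t) {l : Fin 3} (hlr : l ≠ r)
    (hmixed : ∀ t, 0 < t → ∀ᵐ x, duhamelMixed u r l t x = 0) :
    ∀ᵐ s ∂volume.restrict (Set.Ioi (0 : ℝ)), c s ≠ 0 → IsConstant fun y => u s y l := by
  have hfrequently := ae_frequently_sum_oseenConv_eq_zero l
    (P := fun j k s y => if ¬(j = r ↔ k = r) then u s y j * u s y k else 0)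
    (fun T hT j k => ?_) (fun t ht => (hmixed t ht).mono fun x hx => ?_)
  · filter_upwards [hfrequently, ae_restrict_mem measurableSet_Ioi] with s hs hspos hcs
    have hs0 : 0 ≤ s := le_of_lt hspos
    have hw := hu.weightedL2 hs0
    have hconv : ∃ᶠ a in 𝓝[>] (0 : ℝ),
        ∀ x, ∫ y, partialDeriv r (heatKernel a) (x - y) * u s y l = 0 := by
      refine (hs.and_eventually self_mem_nhdsWithin).mono fun a ⟨hzero, ha⟩ x => ?_
      have hx := hzero x
      rw [(hu.isSolenoidal hs0).sum_oseenConv_mixed_eq hw hlr (hc s hs0) ha x] at hx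
      exact (mul_eq_zero.1 hx).resolve_left hcs
    refine hdim s hs0 r (fun hzero => hcs ?_) l (independentOf_of_integral_partialDeriv
      (hw.weightedL1_coord l)
      (integral_partialDeriv_eq_zero_of_heatKernel r (hw.weightedL1_coord l) hconv))
    obtain ⟨x, hx, hcx⟩ := (hzero.and (hc s hs0)).exists
    rw [← hcx, hx]
  · split_ifs
    · simp only [zero_mul]
      exact integrable_zero _ _ _
    · exact hu.inPathSpace.integrable_mul_bracketWeight hT j k
  · refine Eq.trans ?_ hx
    rw [duhamelMixed]
    congr! 2 with j - k -
    split_ifs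
    · simp [duhamelTerm, oseenConv]
    · rfl

/-- The mixed part of the nonlinear term forces `c ∂_r u_l = 0` for `l ≠ r`. -/
lemma ae_isConstant_of_mixed (hu : IsMildSolution u₀ u)
    (hdim : ∀ t : ℝ, 0 ≤ t → NotTwoAndHalfDimensional (u t))
    (hc : ∀ t, 0 ≤ t → ∀ᵐ x, u t x r = c t)
    (hmixed : ∀ l, l ≠ r → ∀ t, 0 < t → ∀ᵐ x, duhamelMixed u r l t x = 0) :
    ∀ᵐ s ∂volume.restrict (Set.Ioi (0 : ℝ)), c s ≠ 0 → ∀ l, IsConstant fun y => u s y l := by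
  have hothers : ∀ᵐ s ∂volume.restrict (Set.Ioi (0 : ℝ)), ∀ l, l ≠ r → c s ≠ 0 →
      IsConstant fun y => u s y l :=
    ae_all_iff.2 fun l => eventually_imp_distrib_left.2 fun hlr =>
      hu.ae_isConstant_apply_of_mixed hdim hc hlr (hmixed l hlr)
  filter_upwards [hothers, ae_restrict_mem measurableSet_Ioi] with s hs hspos hcs l
  by_cases hlr : l = r
  · exact hlr ▸ ⟨c s, hc s (le_of_lt hspos)⟩
  · exact hs l hlr hcs

lemma isBeltramiType_of_constant_component (hu : IsMildSolution u₀ u)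
    (hα : ∀ t, 0 ≤ t → HasSymmetryType (u t) α)
    (hdim : ∀ t : ℝ, 0 ≤ t → NotTwoAndHalfDimensional (u t)) (hr : defect α r ≠ 0)
    (hothers : ∀ l, l ≠ r → defect α l = 0) (hc : ∀ t, 0 ≤ t → ∀ᵐ x, u t x r = c t)
    (hc0 : c 0 ≠ 0) : IsBeltramiType u₀ := by
  have hconst := hu.ae_isConstant_of_mixed hdim hc fun l hlr t ht =>
    hu.ae_duhamelMixed_eq_zero hα hr hothers (by rw [hothers l hlr, add_zero]; exact hr.symm) ht
  have hmixed : ∀ l t x, duhamelMixed u r l t x = 0 := by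
    refine duhamelMixed_eq_zero ?_
    filter_upwards [hconst, ae_restrict_mem measurableSet_Ioi] with s hs hspos
    refine or_iff_not_imp_left.2 fun hne => hs fun hcs => hne ?_
    exact hcs ▸ hc s (le_of_lt hspos)
  have hct : ∀ t, 0 < t → c t = c 0 := fun t ht => by
    obtain ⟨x, hx, hdiag⟩ := ((hu.ae_duhamel_apply_eq_sub hc ht).and
      (hu.ae_duhamelDiagonal_eq_zero hα hr hothers hr ht)).exists
    rw [duhamel_eq_diagonal_add_mixed u r, hdiag, hmixed, add_zero] at hx
    exact (sub_eq_zero.1 hx.symm).symm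
  refine hu.isBeltramiType fun l t _ => Eventually.of_forall fun x => ?_
  rw [duhamel_apply]
  refine Finset.sum_eq_zero fun j _ => Finset.sum_eq_zero fun k _ =>
    duhamelSummand_eq_zero ?_ l t x
  filter_upwards [hconst, ae_restrict_mem measurableSet_Ioi] with s hs hspos
  have hcs : c s ≠ 0 := by rwa [hct s hspos]
  exact (hs hcs j).mul (hs hcs k)

lemma isBeltramiType_of_zero_component (hu : IsMildSolution u₀ u)
    (hα : ∀ t, 0 ≤ t → HasSymmetryType (u t) α) (hr : defect α r = 0) (hg0 : g ≠ 0)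
    (hg : ∀ l, l ≠ r → defect α l = g) (hzero : ∀ t, 0 ≤ t → ∀ᵐ x, u t x r = 0) :
    IsBeltramiType u₀ := by
  refine hu.isBeltramiType fun l t ht => ?_
  by_cases hlr : l = r
  · subst hlr
    simpa using hu.ae_duhamel_apply_eq_sub (c := fun _ => 0) hzero ht
  have hl : defect α l ≠ 0 := by rwa [hg l hlr]
  filter_upwards [hu.ae_duhamelDiagonal_eq_zero hα (by rwa [hr, ne_comm]) hg hl ht] with x hx
  rw [duhamel_eq_diagonal_add_mixed u r, hx, zero_add]
  refine duhamelMixed_eq_zero ?_ l t x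
  filter_upwards [ae_restrict_mem measurableSet_Ioi] with s hs
  exact Or.inl (hzero s (le_of_lt hs))

lemma basic_or_beltrami_of_exceptional (hu : IsMildSolution u₀ u)
    (hα : ∀ t, 0 ≤ t → HasSymmetryType (u t) α)
    (hdim : ∀ t : ℝ, 0 ≤ t → NotTwoAndHalfDimensional (u t)) (hrg : defect α r ≠ g)
    (hg : ∀ l, l ≠ r → defect α l = g) :
    HasSymmetryType u₀ basicType ∨ IsBeltramiType u₀ := by
  have hα₀ : HasSymmetryType u₀ α := (hα 0 le_rfl).congr hu.initial
  have hconst : ∀ t, 0 ≤ t → IsConstant fun x => u t x r := fun t ht =>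
    hu.isConstant_apply ht (hα t ht) (hdim t ht) fun l hlr => by rw [hg l hlr]; exact hrg.symm
  choose! c hc using hconst
  rcases eq_or_ne g 0 with rfl | hg0
  · rcases eq_or_ne (c 0) 0 with hc0 | hc0
    · refine Or.inl fun l => ?_
      by_cases hlr : l = r
      · subst hlr
        refine HasSymmetry.of_ae_eq_zero ?_ _
        filter_upwards [hu.initial, hc 0 le_rfl] with x hx hcx
        rw [← hx, hcx, hc0]
      · exact defect_eq_zero_iff.1 (hg l hlr) ▸ hα₀ l
    · exact Or.inr (hu.isBeltramiType_of_constant_component hα hdim hrg hg hc hc0)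
  right
  by_cases hr : defect α r = 0
  · refine hu.isBeltramiType_of_zero_component hα hr hg0 hg fun t ht => ?_
    have hct : c t = 0 := (hα t ht r).eq_zero_of_ae_eq_const (hc t ht)
      (by simp [defect_eq_zero_iff.1 hr, basicType])
    exact hct ▸ hc t ht
  · refine hu.isBeltramiType fun l t ht => ?_
    have hl : defect α l ≠ 0 ∧ defect α l ≠ defect α r + g := by
      by_cases hlr : l = r
      · subst hlr
        exact ⟨hr, fun h => hg0 (left_eq_add.1 h)⟩
      · rw [hg l hlr]
        exact ⟨hg0, fun h => hr (right_eq_add.1 h)⟩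
    filter_upwards [hu.ae_duhamelDiagonal_eq_zero hα hrg hg hl.1 ht,
      hu.ae_duhamelMixed_eq_zero hα hrg hg hl.2 ht] with x hdiag hmixed
    rw [duhamel_eq_diagonal_add_mixed u r, hdiag, hmixed, add_zero]

theorem basic_or_beltrami (hu : IsMildSolution u₀ u) (hα : ∀ t, 0 ≤ t → HasSymmetryType (u t) α)
    (hdim : ∀ t : ℝ, 0 ≤ t → NotTwoAndHalfDimensional (u t)) :
    HasSymmetryType u₀ basicType ∨ IsBeltramiType u₀ := by
  have hα₀ : HasSymmetryType u₀ α := (hα 0 le_rfl).congr hu.initial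
  rcases forall_eq_or_exists_exceptional_or_injective (defect α) with
    ⟨g, hg⟩ | ⟨r, g, hrg, hg⟩ | hinj
  · rcases eq_or_ne g 0 with rfl | hg0
    · exact Or.inl fun l => defect_eq_zero_iff.1 (hg l) ▸ hα₀ l
    · exact Or.inr (hu.isBeltramiType_of_defect_eq hα hg hg0)
  · exact hu.basic_or_beltrami_of_exceptional hα hdim hrg hg
  · refine Or.inr (isBeltramiType_of_isConstant hu.data_solenoidal fun l => ?_)
    obtain ⟨c, hc⟩ := hu.isConstant_apply le_rfl (hα 0 le_rfl) (hdim 0 le_rfl)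
      fun l hlr => hinj.ne hlr
    refine ⟨c, ?_⟩
    filter_upwards [hc, hu.initial] with x hcx hx
    rw [← hx, hcx]

end IsMildSolution

/-! ### Persistence of the symmetry -/

lemma ae_eq_of_integral_mul_schwartz_eq {f g : E3 → ℝ} (hf : WeightedL1 f) (hg : WeightedL1 g)
    (h : ∀ φ : 𝓢(E3, ℝ), ∫ x, f x * φ x = ∫ x, g x * φ x) : f =ᵐ[volume] g := by
  refine ae_eq_of_integral_contDiff_smul_eq hf.locallyIntegrable hg.locallyIntegrable
    fun φ hφ hφc => ?_
  simp_rw [smul_eq_mul, mul_comm (φ _)]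
  exact h (hφc.toSchwartzMap hφ)

lemma WeightedL1.comp_reflect {f : E3 → ℝ} (hf : WeightedL1 f) (β : Fin 3 → ZMod 2) :
    WeightedL1 fun x => f (reflect β x) :=
  ((measurePreserving_reflect β).integrable_comp_of_integrable hf).congr
    (Eventually.of_forall fun x => by simp only [Function.comp_apply, bracketWeight, norm_reflect])

lemma HasSymmetry.of_tendsto {p : ℕ → E3 → ℝ} {f : E3 → ℝ} {α : Fin 3 → ZMod 2}
    (hf : WeightedL1 f) (hp : ∀ n, HasSymmetry (p n) α)
    (h : ∀ φ : 𝓢(E3, ℝ), Tendsto (fun n => ∫ x, p n x * φ x) atTop (𝓝 (∫ x, f x * φ x))) :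
    HasSymmetry f α := by
  intro β
  refine ae_eq_of_integral_mul_schwartz_eq (hf.comp_reflect β) ?_ fun φ => ?_
  · simp_rw [WeightedL1, mul_assoc]
    exact Integrable.const_mul hf _
  have hlimit : ∫ x, f (reflect β x) * φ x = ∫ x, f x * reflectTest β φ x := by
    rw [← integral_reflect β fun x => f x * reflectTest β φ x]
    simp_rw [reflectTest_apply, reflect_reflect]
  have hiterate n : ∫ x, p n x * reflectTest β φ x = reflectSign α β * ∫ x, p n x * φ x := by
    rw [← integral_reflect β, ← integral_const_mul]
    refine integral_congr_ae ?_
    filter_upwards [hp n β] with x hx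
    rw [hx, reflectTest_apply, reflect_reflect, mul_assoc]
  have htendsto := h (reflectTest β φ)
  simp_rw [hiterate] at htendsto
  rw [hlimit, tendsto_nhds_unique htendsto ((h φ).const_mul _)]
  simp_rw [mul_assoc, integral_const_mul]

lemma HasSymmetryType.heatVec {v : E3 → E3} {α : Fin 3 → Fin 3 → ZMod 2}
    (h : HasSymmetryType v α) (t : ℝ) : HasSymmetryType (heatVec t v) α :=
  fun l => (h l).heat t

lemma HasSymmetryType.picard {u₀ : E3 → E3} (h : HasSymmetryType u₀ basicType) (n : ℕ) (t : ℝ) :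
    HasSymmetryType (picard u₀ n t) basicType := by
  induction n generalizing t with
  | zero => exact h.heatVec t
  | succ n ih =>
    refine fun l => (h.heatVec t l).sub ?_
    change HasSymmetry (fun x => ∑ j, ∑ k,
      NavierStokes.duhamelSummand (NavierStokes.picard u₀ n) j k l t x) (basicType l)
    refine HasSymmetry.sum fun j => HasSymmetry.sum fun k => ?_
    have hsummand := HasSymmetryType.duhamelSummand (t := t) (fun s _ => ih s) j k l
    rwa [defect_eq_zero_iff.2 rfl, defect_eq_zero_iff.2 rfl, add_zero, add_zero] at hsummand

lemma partialDeriv_neg (j : Fin 3) (f : E3 → ℝ) :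
    partialDeriv j (fun x => -f x) = fun x => -partialDeriv j f x :=
  funext fun x => by simp only [partialDeriv, fderiv_fun_neg, neg_apply]

lemma lerayDeriv_compConstSub (j k l : Fin 3) (x : E3) (φ : 𝓢(E3, ℝ)) (y : E3) :
    lerayDeriv j k l (compConstSub x φ) y = -lerayDeriv j k l φ (x - y) := by
  have hcomp i (f : E3 → ℝ) :
      partialDeriv i (fun z => f (x - z)) = fun z => -partialDeriv i f (x - z) :=
    funext fun z => partialDeriv_comp_sub i f x z
  have hnorm z : ‖y - (x - z)‖ = ‖x - y - z‖ := by
    rw [← norm_neg, neg_sub, sub_right_comm]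
  change lerayDeriv j k l (fun z => φ (x - z)) y = _
  simp_rw [lerayDeriv, invNegLaplacian, hcomp, partialDeriv_neg, hcomp, partialDeriv_neg, hcomp]
  rw [← integral_sub_left_eq_self _ volume x]
  simp only [sub_sub_cancel, neg_neg, mul_neg, integral_neg, hnorm]
  split_ifs <;> ring

lemma lerayDeriv_compConstSub_heatKernelSchwartz (j k l : Fin 3) {a : ℝ} (ha : 0 < a) (x y : E3) :
    lerayDeriv j k l (compConstSub x (heatKernelSchwartz ha)) y = -oseenKernel j k l a (x - y) := by
  rw [lerayDeriv_compConstSub, coe_heatKernelSchwartz ha, oseenKernel]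

lemma duhamel_congr {v w : ℝ → E3 → E3} {t : ℝ}
    (h : ∀ s ∈ Set.Ioo 0 t, v s =ᵐ[volume] w s) (x : E3) : duhamel v v t x = duhamel w w t x := by
  ext l
  simp_rw [duhamel_apply]
  congr! 2 with j - k -
  refine setIntegral_congr_fun measurableSet_Ioo fun s hs => ?_
  exact congrFun (oseenConv_congr j k l _ ((h s hs).mono fun y hy => by simp only [hy])) x

namespace IsBeltramiType

variable {u₀ : E3 → E3}

lemma sum_oseenConv_heatVec_eq_zero (h : IsBeltramiType u₀) (l : Fin 3) {s a : ℝ} (hs : 0 < s)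
    (ha : 0 < a) (x : E3) :
    ∑ j, ∑ k, oseenConv j k l a (fun y => heatVec s u₀ y j * heatVec s u₀ y k) x = 0 := by
  have htest := h.2 s hs l (compConstSub x (heatKernelSchwartz ha))
  simp_rw [lerayBilinear, lerayDeriv_compConstSub_heatKernelSchwartz, mul_neg, integral_neg,
    Finset.sum_neg_distrib, neg_neg] at htest
  simpa only [oseenConv, mul_comm (oseenKernel _ _ _ _ _)] using htest

lemma ae_duhamel_heatVec_eq_zero (h : IsBeltramiType u₀)
    (hpath : InPathSpace fun t => heatVec t u₀) {t : ℝ} (ht : 0 < t) :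
    ∀ᵐ x, duhamel (fun t => heatVec t u₀) (fun t => heatVec t u₀) t x = 0 := by
  filter_upwards [hpath.duhamel_integrable t ht] with x hx
  refine PiLp.ext fun l => ?_
  have hint j k : Integrable (fun s => oseenConv j k l (t - s)
      (fun y => heatVec s u₀ y j * heatVec s u₀ y k) x) (volume.restrict (Set.Ioo 0 t)) :=
    (hx j k l).integral_prod_left
  simp_rw [duhamel_apply, duhamelTerm, ← integral_finsetSum _ fun k _ => hint _ k]
  rw [← integral_finsetSum _ fun j _ => integrable_finsetSum _ fun k _ => hint j k]
  exact setIntegral_eq_zero_of_forall_eq_zero fun s hs =>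
    h.sum_oseenConv_heatVec_eq_zero l hs.1 (sub_pos.2 hs.2) x

lemma ae_picard_eq_heatVec (h : IsBeltramiType u₀) (hpath : InPathSpace fun t => heatVec t u₀)
    (n : ℕ) {t : ℝ} (ht : 0 < t) : picard u₀ n t =ᵐ[volume] heatVec t u₀ := by
  induction n generalizing t with
  | zero => rfl
  | succ n ih =>
    filter_upwards [h.ae_duhamel_heatVec_eq_zero hpath ht] with x hx
    change heatVec t u₀ x - duhamel (picard u₀ n) (picard u₀ n) t x = heatVec t u₀ x
    rw [duhamel_congr (w := fun s => heatVec s u₀) (fun s hs => ih hs.1), hx, sub_zero]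

end IsBeltramiType

namespace IsMildSolution

variable {u₀ : E3 → E3} {u : ℝ → E3 → E3}

theorem ae_eq_heatVec (hu : IsMildSolution u₀ u) (h : IsBeltramiType u₀) {t : ℝ} (ht : 0 < t) :
    u t =ᵐ[volume] heatVec t u₀ := by
  have hpath : InPathSpace fun t => heatVec t u₀ := hu.picard_inPathSpace 0
  have hcoord l : ∀ᵐ x, u t x l = heatVec t u₀ x l := by
    refine ae_eq_of_integral_mul_schwartz_eq ((hu.weightedL2 ht.le).weightedL1_coord l)
      ((hpath.weightedL2 t ht).weightedL1_coord l) fun φ => ?_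
    have hpicard n : ∫ x, picard u₀ n t x l * φ x = ∫ x, heatVec t u₀ x l * φ x :=
      integral_congr_ae
        ((h.ae_picard_eq_heatVec hpath n ht).mono fun x hx => by simp only [hx])
    have htendsto := hu.picard_tendsto t ht l φ
    simp_rw [hpicard] at htendsto
    exact tendsto_nhds_unique htendsto tendsto_const_nhds
  exact (ae_all_iff.2 hcoord).mono fun x hx => PiLp.ext hx

theorem hasSymmetryType_basicType (hu : IsMildSolution u₀ u) (h : HasSymmetryType u₀ basicType)
    {t : ℝ} (ht : 0 ≤ t) : HasSymmetryType (u t) basicType := by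
  rcases ht.eq_or_lt with rfl | hpos
  · exact h.congr hu.initial.symm
  · exact fun l => HasSymmetry.of_tendsto ((hu.weightedL2 ht).weightedL1_coord l)
      (fun n => h.picard n t l) (hu.picard_tendsto t hpos l)

theorem hasSymmetryType_of_isBeltramiType (hu : IsMildSolution u₀ u) (h : IsBeltramiType u₀)
    {α : Fin 3 → Fin 3 → ZMod 2} (hα : HasSymmetryType u₀ α) {t : ℝ} (ht : 0 ≤ t) :
    HasSymmetryType (u t) α := by
  rcases ht.eq_or_lt with rfl | hpos
  · exact hα.congr hu.initial.symm
  · exact (hα.heatVec t).congr (hu.ae_eq_heatVec h hpos).symm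

end IsMildSolution

end NavierStokes

end

theorem mainTheorem1 (u₀ : NavierStokes.E3 → NavierStokes.E3)
    (u : ℝ → NavierStokes.E3 → NavierStokes.E3)
    (hu : NavierStokes.IsMildSolution u₀ u)
    (hsym : ∃ α : Fin 3 → Fin 3 → ZMod 2, NavierStokes.HasSymmetryType u₀ α)
    (hdim : ∀ t : ℝ, 0 ≤ t → NavierStokes.NotTwoAndHalfDimensional (u t)) :
    (∃ α : Fin 3 → Fin 3 → ZMod 2, ∀ t : ℝ, 0 ≤ t → NavierStokes.HasSymmetryType (u t) α) ↔
      (NavierStokes.HasSymmetryType u₀ NavierStokes.basicType ∨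
        NavierStokes.IsBeltramiType u₀) := by
  constructor
  · rintro ⟨α, hα⟩
    exact hu.basic_or_beltrami hα hdim
  · rintro (hbasic | hbeltrami)
    · exact ⟨NavierStokes.basicType, fun t ht => hu.hasSymmetryType_basicType hbasic ht⟩
    · obtain ⟨α, hα⟩ := hsym
      exact ⟨α, fun t ht => hu.hasSymmetryType_of_isBeltramiType hbeltrami hα ht⟩
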